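/- **Setting.** Let $W$ be a binary-input memoryless channel with output in $\mathcal Y=\mathbb R^d$, i.e. probability measures $W(\cdot\mid 0),W(\cdot\mid 1)$ on $\mathbb R^d$ (arbitrary; an output alphabet that is a measurable subset of $\mathbb R^d$ is included). Let $N=2^n$, $n\in\mathbb N$ (including $0$), and let $(X_t,Y_t)_{t\ge 1}$ be i.i.d. with law $P_X\otimes W$, where $P_X$ is uniform on $\{0,1\}$. The first $MN$ pairs form the sample $\mathcal D_{MN}$, or $\mathcal D_{M,N}=\{(x_{j,i},y_{j,i})\}_{j\in[M],i\in[N]}$ when cut into $M$ consecutive blocks of length $N$. All logarithms are natural (another common base for the entropies only rescales $\varepsilon$). **Polar transform.** $u_{j,i}=(x_{j,1}^N G_N)_i$ over $\mathrm{GF}(2)$, where $G_N=B_NF^{\otimes n}$ is Arıkan's polar transform, $F=\begin{pmatrix}1&0\\1&1\end{pmatrix}$ and $B_N$ the bit-reversal permutation matrix. $\mathsf H(U_i\mid U^{i-1},Y^N)$ is the conditional entropy for one block $(X^N,Y^N)\sim(P_X\otimes W)^{\otimes N}$ with $U^N=X^NG_N$. **MINE.** For $k\in\mathbb N$ and $\phi=(\beta_j,w_j,b_j)_{j\le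 k}\in\mathbb R^p$, $p=k(d+3)$, let $T_\phi(x,y)=\sum_{j=1}^k\beta_j\max(\langle w_j,(x,y)\rangle+b_j,0)$ be the shallow ReLU network on $\{0,1\}\times\mathbb R^d\subset\mathbb R^{d+1}$. For a compact nonempty $\Phi\subset\mathbb R^p$ and each $M\geq 1$, let $T_\Phi=T_{\hat\phi}$ with $\hat\phi$ any maximizer over $\phi\in\Phi$ of $$\frac1{MN}\sum_{t=1}^{MN}T_\phi(x_t,y_t)-\log\frac1{MN}\sum_{t=1}^{MN}e^{T_\phi(x_t,\tilde y_t)},$$ where $\tilde y^{MN}$ is a uniformly random permutation of $y^{MN}$, the permutation being independent of the data. Put $E^W_\Phi(y)=T_\Phi(1,y)-T_\Phi(0,y)$, a proxy for $\log\frac{W(y\mid 1)}{W(y\mid 0)}$. **SC decoder.** From $e_i=E(y_i)$, $i\in[N]$, set $E_1^{(1)}=e_1$ and, for $i\in[N']$, $N'=1,2,4,\dots$, $$E^{(2i-1)}_{2N'}(e_1^{2N'},u^{2i-2})=F(a,b),\qquad E^{(2i)}_{2N'}(e_1^{2N'},u^{2i-1})=G(a,b,u_{2i-1}),$$ where $a=E^{(i)}_{N'}(e_1^{N'},u^{2i-2}_{\mathrm{odd}}\oplus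 u^{2i-2}_{\mathrm{even}})$, $b=E^{(i)}_{N'}(e_{N'+1}^{2N'},u^{2i-2}_{\mathrm{even}})$, with $F(e_1,e_2)=-2\tanh^{-1}\!\big(\tanh\frac{e_1}2\tanh\frac{e_2}2\big)$, $G(e_1,e_2,u)=e_2+(-1)^ue_1$. The probability assigned to $u_i=1$ given $u^{i-1},y^N$ is $\sigma\big(E_N^{(i)}(e_1^N,u^{i-1})\big)$, $\sigma(x)=1/(1+e^{-x})$. (The minus sign in $F$ corresponds to the orientation "bit $1$ over bit $0$" of the log-likelihood ratios.) Let $P^\Phi_{U_i\mid U^{i-1},Y^N}$ be the result with $E=E^W_\Phi$ and $$\mathsf H^M_\Phi(U_i\mid U^{i-1},Y^N)=-\frac1M\sum_{j=1}^M\log P^\Phi_{U_i\mid U^{i-1},Y^N}(u_{j,i}\mid u_{j,1}^{i-1},y_{j,1}^N).$$ **Theorem.** For every $\varepsilon>0$ there are $k\in\mathbb N$ and a nonempty compact (non-random) $\Phi\subset\mathbb R^p$, $p=k(d+3)$, such that almost surely there is $m\in\mathbb N$ such that for all $M>m$ the MINE maximum over $\Phi$ is attained and, for every maximizer and all $i\in[N]$,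 $$\left|\mathsf H^M_\Phi(U_i\mid U^{i-1},Y^N)-\mathsf H(U_i\mid U^{i-1},Y^N)\right|<\varepsilon .$$ -/

import Mathlib

open MeasureTheory ProbabilityTheory

noncomputable section

namespace PolarMINE

/-! ### Arikan's polar transform over GF(2) -/

/-- Row and column labels of a Kronecker product of a `2 × 2` with a `2ⁿ × 2ⁿ` matrix, in the usual
block order: `(a, b) ↦ a * 2ⁿ + b`. -/
def kronIdx (n : ℕ) : Fin 2 × Fin (2 ^ n) ≃ Fin (2 ^ (n + 1)) :=
  finProdFinEquiv.trans (finCongr (pow_succ' 2 n).symm)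

/-- The Kronecker product `A ⊗ B` as a `2ⁿ⁺¹ × 2ⁿ⁺¹` matrix. -/
def kron {n : ℕ} (A : Matrix (Fin 2) (Fin 2) (ZMod 2))
    (B : Matrix (Fin (2 ^ n)) (Fin (2 ^ n)) (ZMod 2)) :
    Matrix (Fin (2 ^ (n + 1))) (Fin (2 ^ (n + 1))) (ZMod 2) :=
  Matrix.reindex (kronIdx n) (kronIdx n) (Matrix.kroneckerMap (fun a b => a * b) A B)

/-- Arikan's kernel `F = [1 0; 1 1]`. -/
def arikanF : Matrix (Fin 2) (Fin 2) (ZMod 2) := !![1, 0; 1, 1]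

/-- `F^{⊗ n}`. -/
def kronPowF : (n : ℕ) → Matrix (Fin (2 ^ n)) (Fin (2 ^ n)) (ZMod 2)
  | 0 => 1
  | n + 1 => kron arikanF (kronPowF n)

/-- The reverse-shuffle permutation matrix `R_{2ⁿ⁺¹}`, which acts on row vectors by
`(s₁, s₂, …, s_{2N}) R = (s₁, s₃, …, s_{2N-1}, s₂, s₄, …, s_{2N})` with `N = 2ⁿ`. -/
def reverseShuffle (n : ℕ) : Matrix (Fin (2 ^ (n + 1))) (Fin (2 ^ (n + 1))) (ZMod 2) :=
  Matrix.of fun i j =>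
    if (i : ℕ) = 2 * ((j : ℕ) % 2 ^ n) + (j : ℕ) / 2 ^ n then 1 else 0

/-- The bit-reversal permutation matrix, `B_{2N} = R_{2N} (I₂ ⊗ B_N)`. -/
def bitReversal : (n : ℕ) → Matrix (Fin (2 ^ n)) (Fin (2 ^ n)) (ZMod 2)
  | 0 => 1
  | n + 1 => reverseShuffle n * kron 1 (bitReversal n)

/-- Arikan's polar transform `G_N = B_N F^{⊗ n}`, `N = 2ⁿ`. -/
def polarMatrix (n : ℕ) : Matrix (Fin (2 ^ n)) (Fin (2 ^ n)) (ZMod 2) :=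
  bitReversal n * kronPowF n

/-- `u = x G_N`, with `x` a row vector over GF(2). -/
def polarTransform (n : ℕ) (x : Fin (2 ^ n) → ZMod 2) : Fin (2 ^ n) → ZMod 2 :=
  Matrix.vecMul x (polarMatrix n)

/-! ### Successive cancellation decoding

An embedding is a log-likelihood ratio, the logarithm of (likelihood of bit `1`) / (likelihood of
bit `0`). -/

/-- Check node. With ratios oriented as "bit `1` over bit `0`", the ratio of the sum modulo 2 of
two bits carries the minus sign. -/
def checkNode (e₁ e₂ : ℝ) : ℝ :=
  -(2 * Real.artanh (Real.tanh (e₁ / 2) * Real.tanh (e₂ / 2)))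

/-- Bit node, `e₂ + (-1)ᵘ e₁`. -/
def bitNode (e₁ e₂ : ℝ) (u : ZMod 2) : ℝ := e₂ + (-1) ^ u.val * e₁

/-- The embedding of the `i`-th (from `0`) effective bit channel, computed by the successive
cancellation recursion from the embeddings `e` of the `2ⁿ` channel outputs and the true bits `u`;
only the bits `u j` with `j < i` enter. -/
def scEmbedding : (n : ℕ) → (Fin (2 ^ n) → ℝ) → (Fin (2 ^ n) → ZMod 2) → Fin (2 ^ n) → ℝ
  | 0, e, _, i => e i
  | n + 1, e, u, i =>
    have hN : 2 ^ (n + 1) = 2 * 2 ^ n := pow_succ' 2 n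
    let i' : Fin (2 ^ n) := ⟨i / 2, by have := i.2; omega⟩
    let uOdd : Fin (2 ^ n) → ZMod 2 := fun k => u ⟨2 * k, by have := k.2; omega⟩
    let uEven : Fin (2 ^ n) → ZMod 2 := fun k => u ⟨2 * k + 1, by have := k.2; omega⟩
    let e₁ := scEmbedding n (fun k => e ⟨k, by have := k.2; omega⟩) (uOdd + uEven) i'
    let e₂ := scEmbedding n (fun k => e ⟨2 ^ n + k, by have := k.2; omega⟩) uEven i'
    if (i : ℕ) % 2 = 0 then checkNode e₁ e₂
    else bitNode e₁ e₂ (u ⟨i - 1, by have := i.2; omega⟩)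

/-- The probability `P(uᵢ | u^{i-1}, y^N)` that the decoder assigns to the true bit `u i`, from the
embeddings `e` of the channel outputs; the soft decision `σ` gives the probability of bit `1`. -/
def scProb (n : ℕ) (e : Fin (2 ^ n) → ℝ) (u : Fin (2 ^ n) → ZMod 2) (i : Fin (2 ^ n)) : ℝ :=
  if u i = 1 then Real.sigmoid (scEmbedding n e u i) else 1 - Real.sigmoid (scEmbedding n e u i)

/-! ### The channel and the true conditional entropies -/

/-- The joint law `P_X ⊗ W` of one input-output pair, with uniform input on `{0, 1}`. -/
def pairLaw {d : ℕ} (W : Kernel (ZMod 2) (Fin d → ℝ)) : Measure (ZMod 2 × (Fin d → ℝ)) :=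
  (PMF.uniformOfFintype (ZMod 2)).toMeasure ⊗ₘ W

/-- The law `(P_X ⊗ W)^{⊗ N}` of one block of length `N = 2ⁿ`. -/
def blockLaw {d : ℕ} (W : Kernel (ZMod 2) (Fin d → ℝ)) (n : ℕ) :
    Measure (Fin (2 ^ n) → ZMod 2 × (Fin d → ℝ)) :=
  Measure.pi fun _ => pairLaw W

/-- The conditional Shannon entropy `H(U | V)` in nats of a finitely valued `U` given `V`. -/
def condEntropy {Ω α β : Type*} [MeasurableSpace Ω] [MeasurableSpace α] [StandardBorelSpace α]
    [Nonempty α] [Fintype α] [MeasurableSpace β] (μ : Measure Ω) [IsFiniteMeasure μ]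
    (U : Ω → α) (V : Ω → β) : ℝ :=
  ∫ v, ∑ a : α, Real.negMulLog ((condDistrib U V μ v).real {a}) ∂(μ.map V)

instance {d : ℕ} (W : Kernel (ZMod 2) (Fin d → ℝ)) [IsMarkovKernel W] :
    IsProbabilityMeasure (pairLaw W) := by
  unfold pairLaw; infer_instance

instance {d : ℕ} (W : Kernel (ZMod 2) (Fin d → ℝ)) [IsMarkovKernel W] (n : ℕ) :
    IsProbabilityMeasure (blockLaw W n) := by
  unfold blockLaw; infer_instance

/-- `H(Uᵢ | U^{i-1}, Y^N)` for one block, `U = X G_N`. -/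
def bitEntropy {d : ℕ} (W : Kernel (ZMod 2) (Fin d → ℝ)) [IsMarkovKernel W] (n : ℕ)
    (i : Fin (2 ^ n)) : ℝ :=
  condEntropy (blockLaw W n)
    (fun z => polarTransform n (fun k => (z k).1) i)
    (fun z => ((fun j : Set.Iio i => polarTransform n (fun k => (z k).1) j),
      (fun k => (z k).2)))

/-! ### Neural networks and MINE -/

/-- Parameters of a shallow network with `k` neurons, input dimension `d + 1` and scalar output:
a point of `ℝᵖ`, `p = k (d + 3)`. -/
abbrev Params (k d : ℕ) : Type := Fin (k * (d + 3)) → ℝ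

/-- The shallow ReLU network `v ↦ ∑ⱼ βⱼ max(⟨wⱼ, v⟩ + bⱼ, 0)`; the `j`-th group of `d + 3` entries
of the parameter vector is `(βⱼ, bⱼ, wⱼ)`. -/
def reluNet {k d : ℕ} (φ : Params k d) (v : Fin (d + 1) → ℝ) : ℝ :=
  ∑ j : Fin k,
    φ (finProdFinEquiv (j, 0)) *
      max ((∑ l : Fin (d + 1), φ (finProdFinEquiv (j, l.succ.succ)) * v l)
        + φ (finProdFinEquiv (j, 1))) 0

/-- `T_φ(x, y)`: the network evaluated at `(x, y) ∈ {0, 1} × ℝᵈ ⊂ ℝᵈ⁺¹`. -/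
def statNet {k d : ℕ} (φ : Params k d) (x : ZMod 2) (y : Fin d → ℝ) : ℝ :=
  reluNet φ (Fin.cons (x.val : ℝ) y)

/-- The empirical Donsker-Varadhan objective of the sample `(xₜ, yₜ)`, `t < L`, with shuffled
outputs `ỹ`. -/
def dvObjective {k d L : ℕ} (x : Fin L → ZMod 2) (y yt : Fin L → Fin d → ℝ)
    (φ : Params k d) : ℝ :=
  (1 / (L : ℝ)) * ∑ t, statNet φ (x t) (y t)
    - Real.log ((1 / (L : ℝ)) * ∑ t, Real.exp (statNet φ (x t) (yt t)))

/-- `φ` is an output of MINE: a maximizer over `Φ` of the objective, with shuffle `π`. -/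
def IsMINE {k d L : ℕ} (Φ : Set (Params k d)) (x : Fin L → ZMod 2) (y : Fin L → Fin d → ℝ)
    (π : Equiv.Perm (Fin L)) (φ : Params k d) : Prop :=
  φ ∈ Φ ∧ ∀ ψ ∈ Φ, dvObjective x y (fun t => y (π t)) ψ ≤ dvObjective x y (fun t => y (π t)) φ

/-- The estimated channel embedding `E_φ(y) = T_φ(1, y) - T_φ(0, y)`. -/
def mineEmbedding {k d : ℕ} (φ : Params k d) (y : Fin d → ℝ) : ℝ :=
  statNet φ 1 y - statNet φ 0 y

/-- The `j`-th block (from `0`) of length `N` of a sequence. -/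
def block {α : Type*} (N : ℕ) (a : ℕ → α) (j : ℕ) : Fin N → α := fun i => a (j * N + i)

/-- The empirical negative log-likelihood `H_Φ^M(Uᵢ | U^{i-1}, Y^N)` in nats on the first `M` blocks
of the sample, with the channel embedding given by `φ`. -/
def empiricalNLL {k d : ℕ} (n M : ℕ) (x : ℕ → ZMod 2) (y : ℕ → Fin d → ℝ) (φ : Params k d)
    (i : Fin (2 ^ n)) : ℝ :=
  -((1 / (M : ℝ)) * ∑ j ∈ Finset.range M,
    Real.log (scProb n (fun t => mineEmbedding φ (block (2 ^ n) y j t))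
      (polarTransform n (block (2 ^ n) x j)) i))

/-- Every set of permutations of a finite index set is an event. -/
instance (L : ℕ) : MeasurableSpace (Equiv.Perm (Fin L)) := ⊤

end PolarMINE

end

/-! No stability analysis of the decoder is needed, because the successive cancellation recursion is
exact for every embedding. Given arbitrary numbers `e t`, let the bits of `x` be independent with
log-likelihood ratios `e t`. The check and bit nodes compute the conditional laws of the bits of `u
= x G_N` under this product law (`bitProb_check_mul_bit`), so the log-probabilities of the bits of
`u` add up to those of the bits of `x` (`sum_log_scProb`). Hence the cross entropies of the `N`
synthetic bits sum to `N` times the cross entropy of one letter. The true bit entropies sum to at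
least `N H(X|Y)` by the chain rule, and Gibbs' inequality puts every cross entropy above its
entropy. The excess of each single bit is therefore between `0` and `N` times the one-letter excess
(`abs_bitCrossEntropy_sub_le`).

The one-letter excess is controlled by MINE. By Jensen, the cross entropy of `T(1,·) - T(0,·)` is at
most `log 2` minus the Donsker-Varadhan functional of `T` (`pairCrossEntropy_le`), so it is nearly
optimal as soon as `T` nearly attains the mutual information `log 2 - H(X|Y)`. The logarithm of the
posterior is optimal. Truncated, it is bounded and measurable for an arbitrary channel, and a
bounded network approximates it in mean, together with its exponential (`exists_reluSpan_expClose`,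
`exists_dvFunctional_ge`).

It remains to pass from samples to expectations uniformly over a compact set of uniformly bounded
networks (`SatisfiesLLN.uniform`): for `T` on the sample, for `exp T` on the shuffled sample, and
for the log-loss of the decoder on blocks. For the shuffled sample, McDiarmid's inequality applies
for each fixed permutation, the bias comes only from fixed points, and their second moment is at
most `2`; the resulting tail of order `1/L²` feeds Borel-Cantelli
(`ae_eventually_abs_shuffleAvg_sub_lt`). -/

namespace PolarMINE

/-! ### Halves and parity classes of vectors of length `2ⁿ⁺¹` -/

section Halves

variable {α : Type*} {n : ℕ}

/-- The first half of a vector of length `2ⁿ⁺¹`. -/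
def fstHalf (a : Fin (2 ^ (n + 1)) → α) : Fin (2 ^ n) → α :=
  fun k => a ⟨k, by have := k.2; have := pow_succ' 2 n; omega⟩

/-- The second half of a vector of length `2ⁿ⁺¹`. -/
def sndHalf (a : Fin (2 ^ (n + 1)) → α) : Fin (2 ^ n) → α :=
  fun k => a ⟨2 ^ n + k, by have := k.2; have := pow_succ' 2 n; omega⟩

/-- The entries with even index (from `0`). -/
def evens (a : Fin (2 ^ (n + 1)) → α) : Fin (2 ^ n) → α :=
  fun k => a ⟨2 * k, by have := k.2; have := pow_succ' 2 n; omega⟩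

/-- The entries with odd index (from `0`). -/
def odds (a : Fin (2 ^ (n + 1)) → α) : Fin (2 ^ n) → α :=
  fun k => a ⟨2 * k + 1, by have := k.2; have := pow_succ' 2 n; omega⟩

lemma ext_halves {a b : Fin (2 ^ (n + 1)) → α} (h₁ : fstHalf a = fstHalf b)
    (h₂ : sndHalf a = sndHalf b) : a = b := by
  have hp := pow_succ' 2 n
  funext ⟨i, hi⟩
  by_cases h : i < 2 ^ n
  · exact congrFun h₁ ⟨i, h⟩
  · have := congrFun h₂ ⟨i - 2 ^ n, by omega⟩
    simp only [sndHalf] at this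
    convert this using 3 <;> omega

lemma sndHalf_evens (a : Fin (2 ^ (n + 1 + 1)) → α) : sndHalf (evens a) = evens (sndHalf a) := by
  have hp := pow_succ' 2 n
  funext k
  simp only [sndHalf, evens]
  congr 2
  omega

lemma sndHalf_odds (a : Fin (2 ^ (n + 1 + 1)) → α) : sndHalf (odds a) = odds (sndHalf a) := by
  have hp := pow_succ' 2 n
  funext k
  simp only [sndHalf, odds]
  congr 2
  omega

lemma sum_eq_halves [AddCommMonoid α] (a : Fin (2 ^ (n + 1)) → α) :
    ∑ i, a i = ∑ k, fstHalf a k + ∑ k, sndHalf a k := by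
  have hp : 2 ^ (n + 1) = 2 ^ n + 2 ^ n := by rw [pow_succ']; omega
  rw [← Equiv.sum_comp (finCongr hp.symm) a, Fin.sum_univ_add]
  rfl

lemma sum_eq_evens_odds [AddCommMonoid α] (a : Fin (2 ^ (n + 1)) → α) :
    ∑ i, a i = ∑ k, (evens a k + odds a k) := by
  have hp : 2 ^ (n + 1) = 2 ^ n * 2 := by rw [pow_succ]
  rw [← Equiv.sum_comp (finCongr hp.symm) a, ← Equiv.sum_comp finProdFinEquiv,
    Fintype.sum_prod_type]
  refine Finset.sum_congr rfl fun k _ => ?_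
  rw [Fin.sum_univ_two]
  congr 1 <;> · simp only [evens, odds]; congr 1; ext; simp [finProdFinEquiv]; try omega

end Halves

/-! ### Recursive structure of the polar transform -/

lemma kron_mul {n : ℕ} (A A' : Matrix (Fin 2) (Fin 2) (ZMod 2))
    (B B' : Matrix (Fin (2 ^ n)) (Fin (2 ^ n)) (ZMod 2)) :
    kron A B * kron A' B' = kron (A * A') (B * B') := by
  simp only [kron, Matrix.reindex_apply, Matrix.submatrix_mul_equiv]
  exact congrArg (fun M => M.submatrix (kronIdx n).symm (kronIdx n).symm)
    (Matrix.mul_kronecker_mul A A' B B').symm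

/-- The mixed-product rule: `(I₂ ⊗ B)(F ⊗ F^{⊗n}) = F ⊗ (B F^{⊗n})`. -/
lemma polarMatrix_succ (n : ℕ) :
    polarMatrix (n + 1) = reverseShuffle n * kron arikanF (polarMatrix n) := by
  simp [polarMatrix, bitReversal, kronPowF, Matrix.mul_assoc, kron_mul]

lemma vecMul_reverseShuffle {n : ℕ} (x : Fin (2 ^ (n + 1)) → ZMod 2) :
    fstHalf (Matrix.vecMul x (reverseShuffle n)) = evens x ∧
    sndHalf (Matrix.vecMul x (reverseShuffle n)) = odds x := by
  have hp := pow_succ' 2 n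
  constructor <;> funext k
  · simp only [fstHalf, evens, Matrix.vecMul, dotProduct, reverseShuffle, Matrix.of_apply,
      Nat.mod_eq_of_lt k.2, Nat.div_eq_of_lt k.2]
    rw [Finset.sum_eq_single ⟨2 * k, by omega⟩]
    · simp
    · intro b _ hb
      rw [if_neg, mul_zero]
      exact fun h => hb (Fin.ext (by simpa using h))
    · simp
  · have h1 : (2 ^ n + (k : ℕ)) % 2 ^ n = k := by simp [Nat.mod_eq_of_lt k.2]
    have h2 : (2 ^ n + (k : ℕ)) / 2 ^ n = 1 := by
      rw [Nat.add_div_left _ (by positivity), Nat.div_eq_of_lt k.2]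
    simp only [sndHalf, odds, Matrix.vecMul, dotProduct, reverseShuffle, Matrix.of_apply, h1, h2]
    rw [Finset.sum_eq_single ⟨2 * k + 1, by omega⟩]
    · simp
    · intro b _ hb
      rw [if_neg, mul_zero]
      exact fun h => hb (Fin.ext (by simpa using h))
    · simp

lemma vecMul_kron_arikanF {n : ℕ} (v : Fin (2 ^ (n + 1)) → ZMod 2)
    (B : Matrix (Fin (2 ^ n)) (Fin (2 ^ n)) (ZMod 2)) :
    fstHalf (Matrix.vecMul v (kron arikanF B)) = Matrix.vecMul (fstHalf v + sndHalf v) B ∧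
    sndHalf (Matrix.vecMul v (kron arikanF B)) = Matrix.vecMul (sndHalf v) B := by
  have key : ∀ (a : Fin 2) (k : Fin (2 ^ n)),
      Matrix.vecMul v (kron arikanF B) (kronIdx n (a, k)) =
        ∑ b : Fin (2 ^ n), (fstHalf v b * (arikanF 0 a * B b k) +
          sndHalf v b * (arikanF 1 a * B b k)) := by
    intro a k
    have h0 : ∀ b : Fin (2 ^ n), v (kronIdx n (0, b)) = fstHalf v b := fun b => by
      simp only [fstHalf]; congr 1
    have h1 : ∀ b : Fin (2 ^ n), v (kronIdx n (1, b)) = sndHalf v b := fun b => by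
      simp only [sndHalf]; congr 1; ext; simp [kronIdx, add_comm]
    simp only [Matrix.vecMul, dotProduct]
    rw [← Equiv.sum_comp (kronIdx n), Fintype.sum_prod_type, Fin.sum_univ_two,
      ← Finset.sum_add_distrib]
    refine Finset.sum_congr rfl fun b _ => ?_
    simp [kron, h0, h1]
  constructor <;> funext k
  · have : fstHalf (Matrix.vecMul v (kron arikanF B)) k =
        Matrix.vecMul v (kron arikanF B) (kronIdx n (0, k)) := by
      simp only [fstHalf]; congr 1
    rw [this, key]
    simp [arikanF, Matrix.vecMul, dotProduct, add_mul]
  · have : sndHalf (Matrix.vecMul v (kron arikanF B)) k =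
        Matrix.vecMul v (kron arikanF B) (kronIdx n (1, k)) := by
      simp only [sndHalf]; congr 1; ext; simp [kronIdx, add_comm]
    rw [this, key]
    simp [arikanF, Matrix.vecMul, dotProduct]

lemma polarTransform_zero (x : Fin (2 ^ 0) → ZMod 2) : polarTransform 0 x = x := by
  simp [polarTransform, polarMatrix, bitReversal, kronPowF]

lemma fstHalf_polarTransform {n : ℕ} (x : Fin (2 ^ (n + 1)) → ZMod 2) :
    fstHalf (polarTransform (n + 1) x) = polarTransform n (evens x + odds x) := by
  rw [polarTransform, polarMatrix_succ, ← Matrix.vecMul_vecMul, (vecMul_kron_arikanF _ _).1,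
    (vecMul_reverseShuffle x).1, (vecMul_reverseShuffle x).2, polarTransform]

lemma sndHalf_polarTransform {n : ℕ} (x : Fin (2 ^ (n + 1)) → ZMod 2) :
    sndHalf (polarTransform (n + 1) x) = polarTransform n (odds x) := by
  rw [polarTransform, polarMatrix_succ, ← Matrix.vecMul_vecMul, (vecMul_kron_arikanF _ _).2,
    (vecMul_reverseShuffle x).2, polarTransform]

/-- The matrix recursion splits the input by parity and the output into halves, whereas the decoder
splits the input into halves and the output by parity. Induction exchanges the two: one matrix step
outside, the hypothesis inside, one matrix step back. For length `2` parity classes and halves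
coincide, which gives the base case. -/
lemma polarTransform_evens_odds {n : ℕ} (x : Fin (2 ^ (n + 1)) → ZMod 2) :
    evens (polarTransform (n + 1) x) =
        polarTransform n (fstHalf x) + polarTransform n (sndHalf x) ∧
      odds (polarTransform (n + 1) x) = polarTransform n (sndHalf x) := by
  induction n with
  | zero =>
    have h1 := fstHalf_polarTransform x
    have h2 := sndHalf_polarTransform x
    simp only [polarTransform_zero] at h1 h2 ⊢
    have e1 : ∀ y : Fin (2 ^ 1) → ZMod 2, evens y = fstHalf y := fun y => by
      funext k; simp only [evens, fstHalf]; congr 1; ext; have := k.2; simp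
    have e2 : ∀ y : Fin (2 ^ 1) → ZMod 2, odds y = sndHalf y := fun y => by
      funext k; simp only [odds, sndHalf]; congr 1; ext; have := k.2; simp
    rw [e1, e2] at h1
    rw [e2] at h2
    exact ⟨(e1 _).trans h1, (e2 _).trans h2⟩
  | succ n ih =>
    have f1 := fstHalf_polarTransform x
    have f2 := sndHalf_polarTransform x
    constructor
    · apply ext_halves
      · change evens (fstHalf (polarTransform (n + 2) x)) =
          fstHalf (polarTransform (n + 1) (fstHalf x)) +
            fstHalf (polarTransform (n + 1) (sndHalf x))
        rw [f1, (ih _).1, fstHalf_polarTransform, fstHalf_polarTransform, ← sndHalf_evens,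
          ← sndHalf_odds]
        rfl
      · change sndHalf (evens (polarTransform (n + 2) x)) =
          sndHalf (polarTransform (n + 1) (fstHalf x)) +
            sndHalf (polarTransform (n + 1) (sndHalf x))
        rw [sndHalf_evens, f2, (ih _).1, sndHalf_polarTransform, sndHalf_polarTransform,
          ← sndHalf_odds]
        rfl
    · apply ext_halves
      · change odds (fstHalf (polarTransform (n + 2) x)) =
          fstHalf (polarTransform (n + 1) (sndHalf x))
        rw [f1, (ih _).2, fstHalf_polarTransform, ← sndHalf_evens, ← sndHalf_odds]
        rfl
      · rw [sndHalf_odds, f2, (ih _).2, sndHalf_polarTransform, ← sndHalf_odds]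

/-- In characteristic two the contribution of the second half cancels. Thus the bits handed to the
sub-decoder of the first half are the true transformed bits of that half. -/
lemma evens_add_odds_polarTransform {n : ℕ} (x : Fin (2 ^ (n + 1)) → ZMod 2) :
    evens (polarTransform (n + 1) x) + odds (polarTransform (n + 1) x) =
      polarTransform n (fstHalf x) := by
  rw [(polarTransform_evens_odds x).1, (polarTransform_evens_odds x).2]
  funext k
  simp [add_assoc, CharTwo.add_self_eq_zero]

lemma polarTransform_injective (n : ℕ) : Function.Injective (polarTransform n) := by
  induction n with
  | zero => exact fun x y h => by simpa [polarTransform_zero] using h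
  | succ n ih =>
    intro x y h
    apply ext_halves <;> apply ih
    · rw [← evens_add_odds_polarTransform, h, evens_add_odds_polarTransform]
    · rw [← (polarTransform_evens_odds x).2, h, (polarTransform_evens_odds y).2]

/-! ### The successive cancellation recursion -/

/-- The probability of the bit `u` under the log-likelihood ratio `e`. -/
noncomputable def bitProb (e : ℝ) (u : ZMod 2) : ℝ :=
  if u = 1 then Real.sigmoid e else 1 - Real.sigmoid e

lemma scProb_eq (n : ℕ) (e : Fin (2 ^ n) → ℝ) (u : Fin (2 ^ n) → ZMod 2) (i : Fin (2 ^ n)) :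
    scProb n e u i = bitProb (scEmbedding n e u i) (u i) := rfl

lemma scEmbedding_even {n : ℕ} (e : Fin (2 ^ (n + 1)) → ℝ) (u : Fin (2 ^ (n + 1)) → ZMod 2)
    (k : Fin (2 ^ n)) :
    evens (scEmbedding (n + 1) e u) k =
      checkNode (scEmbedding n (fstHalf e) (evens u + odds u) k)
        (scEmbedding n (sndHalf e) (odds u) k) := by
  simp [evens, scEmbedding]
  rfl

lemma scEmbedding_odd {n : ℕ} (e : Fin (2 ^ (n + 1)) → ℝ) (u : Fin (2 ^ (n + 1)) → ZMod 2)
    (k : Fin (2 ^ n)) :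
    odds (scEmbedding (n + 1) e u) k =
      bitNode (scEmbedding n (fstHalf e) (evens u + odds u) k)
        (scEmbedding n (sndHalf e) (odds u) k) (evens u k) := by
  have h : (2 * (k : ℕ) + 1) / 2 = k := by omega
  simp [odds, scEmbedding, h, Nat.add_mod]
  rfl

lemma forall_fin_evens_odds {n : ℕ} {p : Fin (2 ^ (n + 1)) → Prop}
    (h₁ : ∀ k : Fin (2 ^ n), p ⟨2 * k, by have := k.2; have := pow_succ' 2 n; omega⟩)
    (h₂ : ∀ k : Fin (2 ^ n), p ⟨2 * k + 1, by have := k.2; have := pow_succ' 2 n; omega⟩) :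
    ∀ i, p i := by
  intro ⟨i, hi⟩
  have hp := pow_succ' 2 n
  rcases Nat.even_or_odd' i with ⟨k, rfl | rfl⟩
  · exact h₁ ⟨k, by omega⟩
  · exact h₂ ⟨k, by omega⟩

/-- Positions `2k` and `2k + 1` call the sub-decoders at `k`, whose pasts come from the positions
`2j, 2j + 1` with `j < k`; the bit node also reads position `2k`, which precedes `2k + 1`. This
causality is what makes `scProb` a conditional law given the past. -/
lemma scEmbedding_congr {n : ℕ} (e : Fin (2 ^ n) → ℝ) {u u' : Fin (2 ^ n) → ZMod 2}
    (i : Fin (2 ^ n)) (h : ∀ j < i, u j = u' j) : scEmbedding n e u i = scEmbedding n e u' i := by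
  induction n with
  | zero => rfl
  | succ n ih =>
    revert i
    apply forall_fin_evens_odds
    · intro k h
      have h1 : ∀ j < k, (evens u + odds u) j = (evens u' + odds u') j := fun j hj => by
        have hj' : (j : ℕ) < k := hj
        simp only [Pi.add_apply, evens, odds]
        rw [h _ (by simp; omega), h _ (by simp; omega)]
      have h2 : ∀ j < k, odds u j = odds u' j := fun j hj => by
        have hj' : (j : ℕ) < k := hj
        simp only [odds]
        rw [h _ (by simp; omega)]
      refine (scEmbedding_even e u k).trans (Eq.trans ?_ (scEmbedding_even e u' k).symm)
      rw [ih _ k h1, ih _ k h2]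
    · intro k h
      have h1 : ∀ j < k, (evens u + odds u) j = (evens u' + odds u') j := fun j hj => by
        have hj' : (j : ℕ) < k := hj
        simp only [Pi.add_apply, evens, odds]
        rw [h _ (by simp; omega), h _ (by simp; omega)]
      have h2 : ∀ j < k, odds u j = odds u' j := fun j hj => by
        have hj' : (j : ℕ) < k := hj
        simp only [odds]
        rw [h _ (by simp; omega)]
      have h3 : evens u k = evens u' k := h _ (by simp)
      refine (scEmbedding_odd e u k).trans (Eq.trans ?_ (scEmbedding_odd e u' k).symm)
      rw [ih _ k h1, ih _ k h2, h3]

lemma tanh_half_eq (x : ℝ) : Real.tanh (x / 2) = 2 * Real.sigmoid x - 1 := by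
  rw [Real.tanh_eq_sinh_div_cosh, Real.sinh_eq, Real.cosh_eq, Real.sigmoid_def]
  have h1 : Real.exp (-x) = Real.exp (-(x / 2)) * Real.exp (-(x / 2)) := by
    rw [← Real.exp_add]; ring_nf
  have h2 : Real.exp (x / 2) * Real.exp (-(x / 2)) = 1 := by rw [← Real.exp_add]; simp
  rw [h1]
  have p1 := Real.exp_pos (x / 2)
  have p2 := Real.exp_pos (-(x / 2))
  field_simp
  linear_combination (2 * Real.exp (-(x / 2))) * h2

lemma tanh_mul_tanh_mem (a b : ℝ) : Real.tanh a * Real.tanh b ∈ Set.Ioo (-1 : ℝ) 1 := by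
  rw [Set.mem_Ioo, ← abs_lt, abs_mul]
  exact mul_lt_one_of_nonneg_of_lt_one_left (abs_nonneg _) (Real.abs_tanh_lt_one a)
    (Real.abs_tanh_lt_one b).le

/-- In terms of the biases `tanh (e / 2) = 2 σ(e) - 1` the check node is multiplication up to sign,
which is the rule for the sum modulo 2 of two independent bits. -/
lemma sigmoid_checkNode (a b : ℝ) :
    Real.sigmoid (checkNode a b) =
      Real.sigmoid a * (1 - Real.sigmoid b) + (1 - Real.sigmoid a) * Real.sigmoid b := by
  have h : Real.tanh (checkNode a b / 2) = -(Real.tanh (a / 2) * Real.tanh (b / 2)) := by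
    rw [checkNode, neg_div, mul_div_cancel_left₀ _ two_ne_zero, Real.tanh_neg,
      Real.tanh_artanh (tanh_mul_tanh_mem _ _)]
  simp only [tanh_half_eq] at h
  linarith

lemma bitProb_pos (e : ℝ) (u : ZMod 2) : 0 < bitProb e u := by
  unfold bitProb
  split_ifs
  · exact Real.sigmoid_pos e
  · linarith [Real.sigmoid_lt_one e]

/-- For independent bits `s + r` and `r` with ratios `a` and `b`, the check node gives the law of
their sum `s` and the bit node the law of `r` given `s`; their product is the joint law. This holds
for all real `a`, `b`, not only for true likelihood ratios. -/
lemma bitProb_check_mul_bit (a b : ℝ) (s r : ZMod 2) :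
    bitProb (checkNode a b) s * bitProb (bitNode a b s) r = bitProb a (s + r) * bitProb b r := by
  have h2 : (1 : ZMod 2) + 1 = 0 := rfl
  have h3 : ∀ x : ℝ, Real.sigmoid x = 1 / (1 + Real.exp (-x)) := fun x => by
    rw [Real.sigmoid_def]; simp
  have pa := Real.exp_pos (-a)
  have pb := Real.exp_pos (-b)
  have e1 : Real.exp (-(b + a)) = Real.exp (-a) * Real.exp (-b) := by
    rw [← Real.exp_add]; ring_nf
  have e2 : Real.exp (-(b - a)) = Real.exp (-b) / Real.exp (-a) := by
    rw [← Real.exp_sub]; ring_nf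
  have v1 : ZMod.val (1 : ZMod 2) = 1 := rfl
  have hs : s = 0 ∨ s = 1 := by revert s; decide
  have hr : r = 0 ∨ r = 1 := by revert r; decide
  rcases hs with rfl | rfl <;> rcases hr with rfl | rfl <;>
    simp only [bitProb, bitNode, sigmoid_checkNode, h2, v1, ZMod.val_zero, pow_zero, pow_one,
      one_mul, neg_one_mul, ← sub_eq_add_neg, add_zero, zero_add, zero_ne_one,
      if_true, if_false] <;>
    simp only [h3, e1, e2] <;> field_simp <;> ring

/-- The chain rule for the law the decoder believes in. Positions `2k` and `2k + 1` together
contribute what position `k` contributes in the two halves, by `bitProb_check_mul_bit`. -/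
lemma sum_log_scProb {n : ℕ} (e : Fin (2 ^ n) → ℝ) (x : Fin (2 ^ n) → ZMod 2) :
    ∑ i, Real.log (scProb n e (polarTransform n x) i) = ∑ t, Real.log (bitProb (e t) (x t)) := by
  induction n with
  | zero => simp [polarTransform_zero, scProb_eq, scEmbedding]
  | succ n ih =>
    rw [sum_eq_evens_odds, sum_eq_halves]
    have h1 := ih (fstHalf e) (fstHalf x)
    have h2 := ih (sndHalf e) (sndHalf x)
    change _ = ∑ k, Real.log (bitProb (fstHalf e k) (fstHalf x k)) +
      ∑ k, Real.log (bitProb (sndHalf e k) (sndHalf x k))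
    rw [← h1, ← h2, ← Finset.sum_add_distrib]
    refine Finset.sum_congr rfl fun k _ => ?_
    set u := polarTransform (n + 1) x with hu
    change Real.log (bitProb (evens (scEmbedding (n + 1) e u) k) (evens u k)) +
      Real.log (bitProb (odds (scEmbedding (n + 1) e u) k) (odds u k)) = _
    rw [scEmbedding_even, scEmbedding_odd,
      ← Real.log_mul (bitProb_pos _ _).ne' (bitProb_pos _ _).ne', bitProb_check_mul_bit,
      Real.log_mul (bitProb_pos _ _).ne' (bitProb_pos _ _).ne', scProb_eq, scProb_eq,
      ← evens_add_odds_polarTransform, ← (polarTransform_evens_odds x).2]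
    rfl

/-! ### Bounds and continuity of the decoder -/

lemma abs_tanh (x : ℝ) : |Real.tanh x| = Real.tanh |x| := by
  rcases le_total 0 x with h | h
  · rw [abs_of_nonneg h, abs_of_nonneg]
    rw [Real.tanh_eq_sinh_div_cosh]
    exact div_nonneg (Real.sinh_nonneg_iff.2 h) (Real.cosh_pos x).le
  · rw [abs_of_nonpos h, Real.tanh_neg, abs_of_nonpos]
    rw [Real.tanh_eq_sinh_div_cosh]
    exact div_nonpos_of_nonpos_of_nonneg (Real.sinh_nonpos_iff.2 h) (Real.cosh_pos x).le

lemma abs_checkNode_le (a b : ℝ) : |checkNode a b| ≤ |a| := by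
  have key : |Real.tanh (a / 2) * Real.tanh (b / 2)| ≤ Real.tanh |a / 2| := by
    rw [abs_mul, ← abs_tanh]
    exact mul_le_of_le_one_right (abs_nonneg _) (Real.abs_tanh_lt_one _).le
  have hmem := tanh_mul_tanh_mem (a / 2) (b / 2)
  rw [abs_le] at key
  have habs : |Real.artanh (Real.tanh (a / 2) * Real.tanh (b / 2))| ≤ |a / 2| := by
    rw [abs_le]
    constructor
    · rw [← Real.artanh_tanh (-|a / 2|), Real.tanh_neg]
      exact Real.artanh_le_artanh (by linarith [Real.tanh_lt_one |a / 2|]) hmem.2 key.1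
    · rw [← Real.artanh_tanh |a / 2|, Real.artanh_tanh |a / 2|, ← Real.artanh_tanh |a / 2|]
      exact Real.artanh_le_artanh hmem.1 (Real.tanh_lt_one _) key.2
  rw [checkNode, abs_neg, abs_mul, abs_two]
  rw [abs_div, abs_two] at habs
  linarith

lemma abs_bitNode_le (a b : ℝ) (u : ZMod 2) : |bitNode a b u| ≤ |a| + |b| := by
  refine (abs_add_le _ _).trans ?_
  rw [abs_mul, abs_pow, abs_neg, abs_one, one_pow, one_mul, add_comm]

/-- A check node does not increase the modulus and a bit node at most adds two moduli, so each level
at most doubles the bound. The log-losses are then bounded, as the laws of large numbers below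
require. -/
lemma abs_scEmbedding_le {n : ℕ} {e : Fin (2 ^ n) → ℝ} {B : ℝ} (hB : ∀ t, |e t| ≤ B)
    (u : Fin (2 ^ n) → ZMod 2) (i : Fin (2 ^ n)) : |scEmbedding n e u i| ≤ 2 ^ n * B := by
  induction n with
  | zero => simpa [scEmbedding] using hB i
  | succ n ih =>
    have hB0 : 0 ≤ B := (abs_nonneg _).trans (hB i)
    have hp : (0 : ℝ) ≤ 2 ^ n * B := by positivity
    have h1 := fun u k => ih (e := fstHalf e) (fun t => hB _) u k
    have h2 := fun u k => ih (e := sndHalf e) (fun t => hB _) u k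
    rw [pow_succ']
    revert i
    apply forall_fin_evens_odds
    · intro k
      change |evens (scEmbedding (n + 1) e u) k| ≤ _
      rw [scEmbedding_even]
      refine (abs_checkNode_le _ _).trans ((h1 _ k).trans ?_)
      linarith
    · intro k
      change |odds (scEmbedding (n + 1) e u) k| ≤ _
      rw [scEmbedding_odd]
      refine (abs_bitNode_le _ _ _).trans ((add_le_add (h1 _ k) (h2 _ k)).trans ?_)
      linarith

lemma bitProb_add (e : ℝ) (u : ZMod 2) : bitProb e u + bitProb e (u + 1) = 1 := by
  have h2 : (1 : ZMod 2) + 1 = 0 := rfl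
  have hu : u = 0 ∨ u = 1 := by revert u; decide
  rcases hu with rfl | rfl <;> simp [bitProb, h2]

lemma sum_bitProb (e : ℝ) : ∑ a, bitProb e a = 1 :=
  (Fin.sum_univ_two (bitProb e)).trans (bitProb_add e 0)

lemma bitProb_le_one (e : ℝ) (u : ZMod 2) : bitProb e u ≤ 1 := by
  linarith [bitProb_add e u, bitProb_pos e (u + 1)]

lemma log_sigmoid_ge (e : ℝ) : -(|e| + Real.log 2) ≤ Real.log (Real.sigmoid e) := by
  rw [Real.sigmoid_def, Real.log_inv, neg_le_neg_iff]
  have h : 1 + Real.exp (-e) ≤ Real.exp |e| * 2 := by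
    have h1 : 1 ≤ Real.exp |e| := Real.one_le_exp (abs_nonneg _)
    have h2 : Real.exp (-e) ≤ Real.exp |e| := Real.exp_le_exp.2 (neg_le_abs e)
    linarith
  calc Real.log (1 + Real.exp (-e)) ≤ Real.log (Real.exp |e| * 2) :=
        Real.log_le_log (by positivity) h
    _ = |e| + Real.log 2 := by rw [Real.log_mul (by positivity) two_ne_zero, Real.log_exp]

lemma abs_log_bitProb_le (e : ℝ) (u : ZMod 2) : |Real.log (bitProb e u)| ≤ |e| + Real.log 2 := by
  rw [abs_of_nonpos (Real.log_nonpos (bitProb_pos e u).le (bitProb_le_one e u))]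
  unfold bitProb
  split_ifs
  · linarith [log_sigmoid_ge e]
  · rw [← Real.sigmoid_neg]
    linarith [log_sigmoid_ge (-e), abs_neg e]

lemma abs_log_scProb_le {n : ℕ} {e : Fin (2 ^ n) → ℝ} {B : ℝ} (hB : ∀ t, |e t| ≤ B)
    (u : Fin (2 ^ n) → ZMod 2) (i : Fin (2 ^ n)) :
    |Real.log (scProb n e u i)| ≤ 2 ^ n * B + Real.log 2 :=
  (abs_log_bitProb_le _ _).trans (by gcongr; exact abs_scEmbedding_le hB u i)

lemma continuous_tanh : Continuous Real.tanh := by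
  simp_rw [funext Real.tanh_eq_sinh_div_cosh]
  exact Real.continuous_sinh.div Real.continuous_cosh fun x => (Real.cosh_pos x).ne'

lemma continuous_checkNode : Continuous fun p : ℝ × ℝ => checkNode p.1 p.2 := by
  have hc : Continuous fun p : ℝ × ℝ => Real.tanh (p.1 / 2) * Real.tanh (p.2 / 2) :=
    (continuous_tanh.comp (by fun_prop)).mul (continuous_tanh.comp (by fun_prop))
  unfold checkNode Real.artanh
  refine (continuous_const.mul (Continuous.log (Continuous.sqrt ?_) fun p => ?_)).neg
  · exact (continuous_const.add hc).div (continuous_const.sub hc) fun p =>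
      by linarith [(tanh_mul_tanh_mem (p.1 / 2) (p.2 / 2)).2]
  · have h := tanh_mul_tanh_mem (p.1 / 2) (p.2 / 2)
    exact (Real.sqrt_pos.2 (div_pos (by linarith [h.1]) (by linarith [h.2]))).ne'

lemma continuous_scEmbedding {n : ℕ} (u : Fin (2 ^ n) → ZMod 2) (i : Fin (2 ^ n)) :
    Continuous fun e : Fin (2 ^ n) → ℝ => scEmbedding n e u i := by
  induction n with
  | zero => simpa [scEmbedding] using continuous_apply i
  | succ n ih =>
    have c1 : Continuous fun e : Fin (2 ^ (n + 1)) → ℝ => fstHalf e := by unfold fstHalf; fun_prop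
    have c2 : Continuous fun e : Fin (2 ^ (n + 1)) → ℝ => sndHalf e := by unfold sndHalf; fun_prop
    revert i
    apply forall_fin_evens_odds
    · intro k
      change Continuous fun e => evens (scEmbedding (n + 1) e u) k
      rw [funext fun e => scEmbedding_even e u k]
      have h1 : Continuous fun e : Fin (2 ^ (n + 1)) → ℝ =>
          scEmbedding n (fstHalf e) (evens u + odds u) k :=
        Continuous.comp (g := fun e => scEmbedding n e (evens u + odds u) k) (ih _ k) c1
      have h2 : Continuous fun e : Fin (2 ^ (n + 1)) → ℝ =>
          scEmbedding n (sndHalf e) (odds u) k :=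
        Continuous.comp (g := fun e => scEmbedding n e (odds u) k) (ih _ k) c2
      have h3 := h1.prodMk h2
      have h4 := Continuous.comp (g := fun p : ℝ × ℝ => checkNode p.1 p.2) continuous_checkNode h3
      exact h4
    · intro k
      change Continuous fun e => odds (scEmbedding (n + 1) e u) k
      rw [funext fun e => scEmbedding_odd e u k]
      have h1 : Continuous fun e : Fin (2 ^ (n + 1)) → ℝ =>
          scEmbedding n (fstHalf e) (evens u + odds u) k :=
        Continuous.comp (g := fun e => scEmbedding n e (evens u + odds u) k) (ih _ k) c1
      have h2 : Continuous fun e : Fin (2 ^ (n + 1)) → ℝ =>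
          scEmbedding n (sndHalf e) (odds u) k :=
        Continuous.comp (g := fun e => scEmbedding n e (odds u) k) (ih _ k) c2
      exact h2.add (h1.const_mul _)

lemma continuous_bitProb (u : ZMod 2) : Continuous fun e => bitProb e u := by
  unfold bitProb
  split_ifs
  · exact continuous_sigmoid
  · exact continuous_const.sub continuous_sigmoid

lemma continuous_log_scProb {n : ℕ} (u : Fin (2 ^ n) → ZMod 2) (i : Fin (2 ^ n)) :
    Continuous fun e : Fin (2 ^ n) → ℝ => Real.log (scProb n e u i) :=
  ((continuous_bitProb (u i)).comp (continuous_scEmbedding u i)).log fun _ => (bitProb_pos _ _).ne'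

end PolarMINE

namespace PolarMINE

/-! ### Shallow networks are dense -/

/-- The piecewise linear functions of one variable. -/
def reluSpanLine : Submodule ℝ (ℝ → ℝ) :=
  Submodule.span ℝ (Set.range fun (p : ℝ × ℝ) t => max (p.1 * t + p.2) 0)

/-- The functions computed by shallow ReLU networks. -/
def reluSpan (D : ℕ) : Submodule ℝ ((Fin D → ℝ) → ℝ) :=
  Submodule.span ℝ
    (Set.range fun (p : (Fin D → ℝ) × ℝ) v => max (∑ l, p.1 l * v l + p.2) 0)

/-- The trigonometric polynomials. -/
def cosSpan (D : ℕ) : Submodule ℝ ((Fin D → ℝ) → ℝ) :=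
  Submodule.span ℝ
    (Set.range fun (p : (Fin D → ℝ) × ℝ) v => Real.cos (∑ l, p.1 l * v l + p.2))

lemma reluNet_finProdFinEquiv {k d : ℕ} (β b : Fin k → ℝ) (w : Fin k → Fin (d + 1) → ℝ)
    (v : Fin (d + 1) → ℝ) :
    reluNet (fun m => (Fin.cons (β (finProdFinEquiv.symm m).1)
        (Fin.cons (b (finProdFinEquiv.symm m).1) (w (finProdFinEquiv.symm m).1)) :
          Fin (d + 3) → ℝ) (finProdFinEquiv.symm m).2) v =
      ∑ j, β j * max (∑ l, w j l * v l + b j) 0 := by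
  unfold reluNet
  refine Finset.sum_congr rfl fun j _ => ?_
  simp only [Equiv.symm_apply_apply]
  rfl

lemma exists_reluNet_eq {d : ℕ} {f : (Fin (d + 1) → ℝ) → ℝ} (hf : f ∈ reluSpan (d + 1)) :
    ∃ (k : ℕ) (φ : Params k d), reluNet φ = f := by
  obtain ⟨k, β, g, rfl⟩ := Submodule.mem_span_set'.1 hf
  choose p hp using fun j => (g j).2
  refine ⟨k, _, funext fun v =>
    (reluNet_finProdFinEquiv β (fun j => (p j).2) (fun j => (p j).1) v).trans ?_⟩
  simp [← hp]

lemma comp_mem_reluSpan {D : ℕ} {h : ℝ → ℝ} (hh : h ∈ reluSpanLine) (w : Fin D → ℝ) (b : ℝ) :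
    (fun v => h (∑ l, w l * v l + b)) ∈ reluSpan D := by
  induction hh using Submodule.span_induction with
  | mem x hx =>
    obtain ⟨⟨a, c⟩, rfl⟩ := hx
    refine Submodule.subset_span ⟨(a • w, a * b + c), ?_⟩
    funext v
    simp only [Pi.smul_apply, smul_eq_mul, mul_add, Finset.mul_sum, mul_assoc, add_assoc]
  | zero => exact Submodule.zero_mem _
  | add x y _ _ hx hy => exact Submodule.add_mem _ hx hy
  | smul a x _ hx => exact Submodule.smul_mem _ a hx

lemma continuous_of_mem_reluSpan {D : ℕ} {f : (Fin D → ℝ) → ℝ} (hf : f ∈ reluSpan D) :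
    Continuous f := by
  induction hf using Submodule.span_induction with
  | mem x hx =>
    obtain ⟨p, rfl⟩ := hx
    fun_prop
  | zero => exact continuous_const
  | add x y _ _ hx hy => exact hx.add hy
  | smul a x _ hx => exact hx.const_smul a

/-- The piecewise linear interpolation of `ρ` at `t₀, t₀ + δ, …, t₀ + m δ`. -/
noncomputable def interpolation (ρ : ℝ → ℝ) (t₀ δ : ℝ) (m : ℕ) (t : ℝ) : ℝ :=
  ρ t₀ + ∑ j ∈ Finset.range m, (ρ (t₀ + (j + 1 : ℕ) * δ) - ρ (t₀ + j * δ)) *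
    (max ((t - (t₀ + j * δ)) / δ) 0 - max ((t - (t₀ + j * δ)) / δ - 1) 0)

lemma interpolation_mem (ρ : ℝ → ℝ) (t₀ δ : ℝ) (m : ℕ) :
    interpolation ρ t₀ δ m ∈ reluSpanLine := by
  have h1 : ∀ a b : ℝ, (fun t : ℝ => max (a * t + b) 0) ∈ reluSpanLine := fun a b =>
    Submodule.subset_span ⟨(a, b), rfl⟩
  have h2 : interpolation ρ t₀ δ m = ρ t₀ • (fun t : ℝ => max (0 * t + 1) 0) +
      ∑ j ∈ Finset.range m, (ρ (t₀ + (j + 1 : ℕ) * δ) - ρ (t₀ + j * δ)) •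
        ((fun t : ℝ => max (δ⁻¹ * t + (-(t₀ + j * δ) / δ)) 0) -
          (fun t : ℝ => max (δ⁻¹ * t + (-(t₀ + j * δ) / δ - 1)) 0)) := by
    funext t
    simp only [interpolation, Pi.add_apply, Pi.smul_apply, Finset.sum_apply, Pi.sub_apply,
      smul_eq_mul, zero_mul, zero_add, max_eq_left zero_le_one, mul_one]
    congr 1
    refine Finset.sum_congr rfl fun j _ => ?_
    ring_nf
  rw [h2]
  exact Submodule.add_mem _ (Submodule.smul_mem _ _ (h1 _ _)) (Submodule.sum_mem _ fun j _ =>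
    Submodule.smul_mem _ _ (Submodule.sub_mem _ (h1 _ _) (h1 _ _)))

lemma interpolation_succ (ρ : ℝ → ℝ) (t₀ δ : ℝ) (m : ℕ) (t : ℝ) :
    interpolation ρ t₀ δ (m + 1) t = interpolation ρ t₀ δ m t +
      (ρ (t₀ + (m + 1 : ℕ) * δ) - ρ (t₀ + m * δ)) *
        (max ((t - (t₀ + m * δ)) / δ) 0 - max ((t - (t₀ + m * δ)) / δ - 1) 0) := by
  rw [interpolation, Finset.sum_range_succ, ← add_assoc, interpolation]

/-- To the right of the last node every ramp has reached its plateau `1`, and the increments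
telescope. -/
lemma interpolation_eq_of_ge (ρ : ℝ → ℝ) (t₀ : ℝ) {δ : ℝ} (hδ : 0 < δ) (m : ℕ) {t : ℝ}
    (ht : t₀ + m * δ ≤ t) : interpolation ρ t₀ δ m t = ρ (t₀ + m * δ) := by
  induction m with
  | zero => simp [interpolation]
  | succ m ih =>
    push_cast at ht
    have h1 : 1 ≤ (t - (t₀ + m * δ)) / δ := by rw [le_div_iff₀ hδ]; linarith
    rw [interpolation_succ, ih (by linarith), max_eq_left (by linarith), max_eq_left (by linarith)]
    push_cast
    ring

/-- A new node changes the interpolant only to the right of the previous one, where it becomes a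
convex combination of the last two nodal values. Both the global bound and the error estimate follow
from this by induction. -/
lemma interpolation_cases (ρ : ℝ → ℝ) (t₀ : ℝ) {δ : ℝ} (hδ : 0 < δ) (m : ℕ) (t : ℝ) :
    (t ≤ t₀ + m * δ ∧ interpolation ρ t₀ δ (m + 1) t = interpolation ρ t₀ δ m t) ∨
    (t₀ + m * δ ≤ t ∧ ∃ s ∈ Set.Icc (0 : ℝ) 1, interpolation ρ t₀ δ (m + 1) t =
      (1 - s) * ρ (t₀ + m * δ) + s * ρ (t₀ + (m + 1 : ℕ) * δ)) := by
  rcases le_total t (t₀ + m * δ) with h | h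
  · left
    have h1 : (t - (t₀ + m * δ)) / δ ≤ 0 := div_nonpos_of_nonpos_of_nonneg (by linarith) hδ.le
    refine ⟨h, ?_⟩
    rw [interpolation_succ, max_eq_right h1, max_eq_right (by linarith)]
    ring
  · right
    have h1 : 0 ≤ (t - (t₀ + m * δ)) / δ := div_nonneg (by linarith) hδ.le
    refine ⟨h, max ((t - (t₀ + m * δ)) / δ) 0 - max ((t - (t₀ + m * δ)) / δ - 1) 0, ?_, ?_⟩
    · rw [max_eq_left h1]
      rcases le_total ((t - (t₀ + m * δ)) / δ) 1 with h2 | h2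
      · rw [max_eq_right (by linarith)]; constructor <;> linarith
      · rw [max_eq_left (by linarith)]; constructor <;> linarith
    · rw [interpolation_succ, interpolation_eq_of_ge ρ t₀ hδ m h]
      ring

lemma abs_interpolation_le {ρ : ℝ → ℝ} {C : ℝ} (hρ : ∀ t, |ρ t| ≤ C) (t₀ : ℝ) {δ : ℝ}
    (hδ : 0 < δ) (m : ℕ) (t : ℝ) : |interpolation ρ t₀ δ m t| ≤ C := by
  induction m with
  | zero => simpa [interpolation] using hρ t₀
  | succ m ih =>
    rcases interpolation_cases ρ t₀ hδ m t with ⟨-, h⟩ | ⟨-, s, hs, h⟩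
    · rwa [h]
    · have a := abs_le.1 (hρ (t₀ + m * δ))
      have b := abs_le.1 (hρ (t₀ + (m + 1 : ℕ) * δ))
      rw [h, abs_le]
      constructor <;> nlinarith [hs.1, hs.2, mul_nonneg hs.1 (sub_nonneg.2 b.2),
        mul_nonneg hs.1 (sub_nonneg.2 b.1), mul_nonneg (sub_nonneg.2 hs.2) (sub_nonneg.2 a.1),
        mul_nonneg (sub_nonneg.2 hs.2) (sub_nonneg.2 a.2)]

lemma abs_interpolation_sub_le {ρ : ℝ → ℝ} (hρ : ∀ s t, |ρ s - ρ t| ≤ |s - t|) (t₀ : ℝ) {δ : ℝ}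
    (hδ : 0 < δ) (m : ℕ) {t : ℝ} (h₀ : t₀ ≤ t) (h₁ : t ≤ t₀ + m * δ) :
    |interpolation ρ t₀ δ m t - ρ t| ≤ δ := by
  induction m with
  | zero =>
    have : t = t₀ := le_antisymm (by simpa using h₁) h₀
    simp [interpolation, this, hδ.le]
  | succ m ih =>
    rcases interpolation_cases ρ t₀ hδ m t with ⟨h2, h⟩ | ⟨h2, s, hs, h⟩
    · rw [h]; exact ih h2
    · push_cast at h h₁
      have a : |ρ (t₀ + m * δ) - ρ t| ≤ δ :=
        (hρ _ _).trans (by rw [abs_le]; constructor <;> linarith)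
      have b : |ρ (t₀ + (m + 1) * δ) - ρ t| ≤ δ :=
        (hρ _ _).trans (by rw [abs_le]; constructor <;> linarith)
      rw [abs_le] at a b
      rw [h, abs_le]
      constructor <;> nlinarith [hs.1, hs.2, mul_nonneg hs.1 (sub_nonneg.2 b.2),
        mul_nonneg hs.1 (sub_nonneg.2 b.1), mul_nonneg (sub_nonneg.2 hs.2) (sub_nonneg.2 a.1),
        mul_nonneg (sub_nonneg.2 hs.2) (sub_nonneg.2 a.2)]

/-- The functions that are approximated uniformly on bounded sets by uniformly bounded shallow
networks. -/
def bddApprox (D : ℕ) : Submodule ℝ ((Fin D → ℝ) → ℝ) where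
  -- `C` is chosen before `R` and `ε`: the error outside a large ball is then `C` times a mass that
  -- can still be made small.
  carrier := {f | ∃ C, ∀ R, ∀ ε > 0, ∃ g ∈ reluSpan D, (∀ v, |g v| ≤ C) ∧
    ∀ v, ‖v‖ ≤ R → |g v - f v| ≤ ε}
  zero_mem' := ⟨0, fun _ ε hε => ⟨0, Submodule.zero_mem _, by simp, by simp [hε.le]⟩⟩
  add_mem' := by
    rintro f₁ f₂ ⟨C₁, h₁⟩ ⟨C₂, h₂⟩
    refine ⟨C₁ + C₂, fun R ε hε => ?_⟩
    obtain ⟨g₁, m₁, b₁, a₁⟩ := h₁ R (ε / 2) (by positivity)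
    obtain ⟨g₂, m₂, b₂, a₂⟩ := h₂ R (ε / 2) (by positivity)
    refine ⟨g₁ + g₂, Submodule.add_mem _ m₁ m₂,
      fun v => (abs_add_le _ _).trans (add_le_add (b₁ v) (b₂ v)), fun v hv => ?_⟩
    have e : (g₁ + g₂) v - (f₁ + f₂) v = (g₁ v - f₁ v) + (g₂ v - f₂ v) := by
      simp only [Pi.add_apply]; ring
    rw [e]
    exact (abs_add_le _ _).trans (by linarith [a₁ v hv, a₂ v hv])
  smul_mem' := by
    rintro c f ⟨C, h⟩
    refine ⟨|c| * C, fun R ε hε => ?_⟩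
    obtain ⟨g, m, b, a⟩ := h R (ε / (|c| + 1)) (by positivity)
    refine ⟨c • g, Submodule.smul_mem _ c m, fun v => ?_, fun v hv => ?_⟩
    · simp only [Pi.smul_apply, smul_eq_mul, abs_mul]
      exact mul_le_mul_of_nonneg_left (b v) (abs_nonneg c)
    · simp only [Pi.smul_apply, smul_eq_mul, ← mul_sub, abs_mul]
      calc |c| * |g v - f v| ≤ (|c| + 1) * (ε / (|c| + 1)) := by
            gcongr
            · linarith
            · exact a v hv
        _ = ε := by field_simp

lemma abs_cos_sub_cos_le (s t : ℝ) : |Real.cos s - Real.cos t| ≤ |s - t| := by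
  rw [Real.cos_sub_cos, abs_mul, abs_mul, abs_neg, abs_two]
  have h1 := Real.abs_sin_le_one ((s + t) / 2)
  have h2 : |Real.sin ((s - t) / 2)| ≤ |(s - t) / 2| := Real.abs_sin_le_abs
  rw [abs_div, abs_two] at h2
  nlinarith [abs_nonneg (Real.sin ((s + t) / 2)), abs_nonneg (Real.sin ((s - t) / 2))]

lemma abs_sum_mul_le {D : ℕ} (w v : Fin D → ℝ) {R : ℝ} (hv : ‖v‖ ≤ R) :
    |∑ l, w l * v l| ≤ (∑ l, |w l|) * R := by
  refine (Finset.abs_sum_le_sum_abs _ _).trans ?_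
  rw [Finset.sum_mul]
  refine Finset.sum_le_sum fun l _ => ?_
  rw [abs_mul]
  exact mul_le_mul_of_nonneg_left ((norm_le_pi_norm v l).trans hv) (abs_nonneg _)

/-- Interpolating the cosine, which is 1-Lipschitz, turns each wave into a network. The interpolant
is bounded by `1` on the whole line, whatever the grid, so `C = 1` serves. -/
lemma cosSpan_le_bddApprox (D : ℕ) : cosSpan D ≤ bddApprox D := by
  refine Submodule.span_le.2 ?_
  rintro _ ⟨⟨w, b⟩, rfl⟩
  refine ⟨1, fun R ε hε => ?_⟩
  -- On the ball the argument of the cosine stays in `[-r, r]`, which is covered by `2r / ε` cells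
  -- of length `ε`.
  set r := (∑ l, |w l|) * R + |b| with hr
  refine ⟨_, comp_mem_reluSpan (interpolation_mem Real.cos (-r) ε ⌈2 * r / ε⌉₊) w b,
    fun v => abs_interpolation_le Real.abs_cos_le_one _ hε _ _, fun v hv => ?_⟩
  have h1 : |∑ l, w l * v l + b| ≤ r :=
    (abs_add_le _ _).trans (add_le_add (abs_sum_mul_le w v hv) le_rfl)
  rw [abs_le] at h1
  refine abs_interpolation_sub_le abs_cos_sub_cos_le _ hε _ h1.1 ?_
  have h2 := Nat.le_ceil (2 * r / ε)
  rw [div_le_iff₀ hε] at h2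
  linarith [h1.2]

lemma one_mem_cosSpan (D : ℕ) : (1 : (Fin D → ℝ) → ℝ) ∈ cosSpan D :=
  Submodule.subset_span ⟨(0, 0), by funext v; simp⟩

/-- The product-to-sum formula. Unlike the networks, the trigonometric polynomials form an algebra,
so Stone-Weierstrass applies to them. -/
lemma mul_mem_cosSpan {D : ℕ} (f g : (Fin D → ℝ) → ℝ) (hf : f ∈ cosSpan D) (hg : g ∈ cosSpan D) :
    f * g ∈ cosSpan D := by
  induction hf, hg using Submodule.span_induction₂ with
  | mem_mem x y hx hy =>
    obtain ⟨⟨w₁, b₁⟩, rfl⟩ := hx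
    obtain ⟨⟨w₂, b₂⟩, rfl⟩ := hy
    have h : ∀ (w : Fin D → ℝ) (b : ℝ), (fun v : Fin D → ℝ => Real.cos (∑ l, w l * v l + b)) ∈
        cosSpan D :=
      fun w b => Submodule.subset_span ⟨(w, b), rfl⟩
    convert Submodule.smul_mem _ (1 / 2 : ℝ)
      (Submodule.add_mem _ (h (w₁ + w₂) (b₁ + b₂)) (h (w₁ - w₂) (b₁ - b₂))) using 1
    funext v
    simp only [Pi.mul_apply, Pi.smul_apply, Pi.add_apply, Pi.sub_apply, smul_eq_mul, add_mul,
      sub_mul, Finset.sum_add_distrib, Finset.sum_sub_distrib]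
    set p := ∑ l, w₁ l * v l
    set q := ∑ l, w₂ l * v l
    rw [show p + q + (b₁ + b₂) = (p + b₁) + (q + b₂) by ring,
      show p - q + (b₁ - b₂) = (p + b₁) - (q + b₂) by ring, Real.cos_add (p + b₁), Real.cos_sub]
    ring
  | zero_left y _ => simp
  | zero_right x _ => simp
  | add_left x y z _ _ _ h1 h2 => rw [add_mul]; exact Submodule.add_mem _ h1 h2
  | add_right x y z _ _ _ h1 h2 => rw [mul_add]; exact Submodule.add_mem _ h1 h2
  | smul_left r x y _ _ h => rw [smul_mul_assoc]; exact Submodule.smul_mem _ r h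
  | smul_right r x y _ _ h => rw [mul_smul_comm]; exact Submodule.smul_mem _ r h

lemma sin_mem_cosSpan {D : ℕ} (c : ℝ) (j : Fin D) :
    (fun v : Fin D → ℝ => Real.sin (v j / c)) ∈ cosSpan D := by
  refine Submodule.subset_span ⟨(Pi.single j c⁻¹, -(Real.pi / 2)), ?_⟩
  funext v
  simp only [Pi.single_apply, ite_mul, zero_mul, Finset.sum_ite_eq', Finset.mem_univ, if_true]
  rw [← sub_eq_add_neg, Real.cos_sub_pi_div_two]
  ring_nf

/-- A bounded continuous function is approximated uniformly on bounded sets by uniformly bounded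
trigonometric polynomials. -/
lemma exists_cosSpan_near {D : ℕ} {f : (Fin D → ℝ) → ℝ} (hf : Continuous f) {B : ℝ}
    (hB : ∀ v, |f v| ≤ B) {R ε : ℝ} (hR : 0 < R) (hε : 0 < ε) :
    ∃ g ∈ cosSpan D, Continuous g ∧ (∀ v, |g v| ≤ B + ε) ∧ ∀ v, ‖v‖ ≤ R → |g v - f v| ≤ ε := by
  -- The sines map all of `ℝᴰ` into a compact cube. Approximation on the cube by Stone-Weierstrass
  -- thus pulls back to an approximant that is bounded everywhere, not only on the ball.
  let s : (Fin D → ℝ) → (Fin D → Set.Icc (-1 : ℝ) 1) := fun v j =>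
    ⟨Real.sin (v j / R), Real.sin_mem_Icc _⟩
  have hs : Continuous s := by
    refine continuous_pi fun j => Continuous.subtype_mk ?_ _
    fun_prop
  let T : C(Fin D → Set.Icc (-1 : ℝ) 1, ℝ) →ₐ[ℝ] ((Fin D → ℝ) → ℝ) :=
    { toFun := fun K v => K (s v)
      map_one' := rfl
      map_mul' := fun _ _ => rfl
      map_zero' := rfl
      map_add' := fun _ _ => rfl
      commutes' := fun _ => rfl }
  let A := ((cosSpan D).toSubalgebra (one_mem_cosSpan D) mul_mem_cosSpan).comap T
  have hA : A.SeparatesPoints := by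
    intro x y hxy
    obtain ⟨j, hj⟩ := Function.ne_iff.1 hxy
    refine ⟨fun x => (x j : ℝ), ⟨⟨fun x => (x j : ℝ), by fun_prop⟩, ?_, rfl⟩,
      fun h => hj (Subtype.ext h)⟩
    exact sin_mem_cosSpan R j
  -- For `‖v‖ ≤ R` one has `|v j / R| ≤ 1 < π / 2`, so `arcsin` undoes the sine and `K ∘ s = f`
  -- there; elsewhere `K` still inherits the bound `B`.
  let K : C(Fin D → Set.Icc (-1 : ℝ) 1, ℝ) :=
    ⟨fun x => f fun j => R * Real.arcsin (x j), hf.comp (continuous_pi fun j =>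
      continuous_const.mul (Real.continuous_arcsin.comp
        (continuous_subtype_val.comp (continuous_apply j))))⟩
  obtain ⟨⟨g, hg⟩, hgK⟩ :=
    ContinuousMap.exists_mem_subalgebra_near_continuousMap_of_separatesPoints A hA K ε hε
  have near : ∀ x, |g x - K x| ≤ ε := fun x =>
    ((g - K).norm_coe_le_norm x).trans hgK.le
  refine ⟨T g, hg, g.continuous.comp hs, fun v => ?_, fun v hv => ?_⟩
  · have h1 := near (s v)
    have h2 : |K (s v)| ≤ B := hB _
    calc |g (s v)| = |K (s v) + (g (s v) - K (s v))| := by ring_nf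
      _ ≤ B + ε := (abs_add_le _ _).trans (add_le_add h2 h1)
  · have h1 : K (s v) = f v := by
      change f (fun j => R * Real.arcsin (Real.sin (v j / R))) = f v
      congr 1
      funext j
      have h2 : |v j / R| ≤ 1 := by
        rw [abs_div, abs_of_pos hR, div_le_one hR]
        exact (norm_le_pi_norm v j).trans hv
      rw [abs_le] at h2
      rw [Real.arcsin_sin (by linarith [Real.pi_gt_three]) (by linarith [Real.pi_gt_three])]
      field_simp
    rw [← h1]
    exact near (s v)

lemma abs_exp_sub_exp_le {a b C : ℝ} (ha : a ≤ C) (hb : b ≤ C) :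
    |Real.exp a - Real.exp b| ≤ Real.exp C * |a - b| := by
  wlog h : b ≤ a generalizing a b
  · rw [abs_sub_comm, abs_sub_comm a]
    exact this hb ha (le_of_not_ge h)
  rw [abs_of_nonneg (sub_nonneg.2 (Real.exp_le_exp.2 h)), abs_of_nonneg (sub_nonneg.2 h)]
  have h1 : Real.exp b = Real.exp a * Real.exp (b - a) := by rw [← Real.exp_add]; ring_nf
  have h2 := Real.add_one_le_exp (b - a)
  have h3 := Real.exp_le_exp.2 ha
  have h4 := Real.exp_pos a
  nlinarith

/-! ### Mean distance of bounded functions and of their exponentials -/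

section L1

variable {α : Type*} [MeasurableSpace α] {Q : Measure α} [IsProbabilityMeasure Q]

lemma integral_abs_sub_le_of_near {a b : α → ℝ} {C δ : ℝ} {s : Set α}
    (hs : MeasurableSet s) (haC : ∀ v, |a v| ≤ C) (hbC : ∀ v, |b v| ≤ C) (hδ : 0 ≤ δ)
    (h : ∀ v ∈ s, |a v - b v| ≤ δ) :
    ∫ v, |a v - b v| ∂Q ≤ δ + 2 * C * Q.real sᶜ := by
  have key : ∀ v, |a v - b v| ≤ δ + 2 * C * sᶜ.indicator 1 v := fun v => by
    by_cases hv : v ∈ s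
    · simpa [hv] using h v hv
    · have := (abs_sub (a v) (b v)).trans (add_le_add (haC v) (hbC v))
      simp [hv]; linarith
  have hi₀ : Integrable (fun v => 2 * C * sᶜ.indicator (1 : α → ℝ) v) Q :=
    ((integrable_const (1 : ℝ)).indicator hs.compl).const_mul _
  have hi : Integrable (fun v => δ + 2 * C * sᶜ.indicator (1 : α → ℝ) v) Q :=
    (integrable_const _).add hi₀
  refine (integral_mono_of_nonneg (ae_of_all _ fun v => abs_nonneg _) hi (ae_of_all _ key)).trans ?_
  rw [integral_add (integrable_const _) hi₀, integral_const_mul,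
    integral_indicator_one hs.compl]
  simp

lemma integrable_of_abs_le {a : α → ℝ} (ha : Measurable a) {C : ℝ} (haC : ∀ v, |a v| ≤ C) :
    Integrable a Q :=
  Integrable.of_bound ha.aestronglyMeasurable C (ae_of_all _ haC)

lemma integrable_exp_of_abs_le {a : α → ℝ} (ha : Measurable a) {C : ℝ} (haC : ∀ v, |a v| ≤ C) :
    Integrable (fun v => Real.exp (a v)) Q :=
  integrable_of_abs_le (C := Real.exp C) (Real.measurable_exp.comp ha) fun v => by
    rw [abs_of_pos (Real.exp_pos _)]
    exact Real.exp_le_exp.2 ((le_abs_self _).trans (haC v))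

lemma integral_abs_exp_sub_le {a b : α → ℝ} (ha : Measurable a) (hb : Measurable b) {C : ℝ}
    (haC : ∀ v, |a v| ≤ C) (hbC : ∀ v, |b v| ≤ C) :
    ∫ v, |Real.exp (a v) - Real.exp (b v)| ∂Q ≤ Real.exp C * ∫ v, |a v - b v| ∂Q := by
  rw [← integral_const_mul]
  refine integral_mono_of_nonneg (ae_of_all _ fun v => abs_nonneg _) ?_ (ae_of_all _ fun v => ?_)
  · exact ((integrable_of_abs_le ha haC).sub (integrable_of_abs_le hb hbC)).abs.const_mul _
  · exact abs_exp_sub_exp_le ((le_abs_self _).trans (haC v)) ((le_abs_self _).trans (hbC v))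

end L1

lemma integral_abs_sub_triangle {α : Type*} [MeasurableSpace α] {Q : Measure α} {a b c : α → ℝ}
    (ha : Integrable a Q) (hb : Integrable b Q)
    (hc : Integrable c Q) :
    ∫ v, |a v - c v| ∂Q ≤ ∫ v, |a v - b v| ∂Q + ∫ v, |b v - c v| ∂Q := by
  refine le_trans ?_ (integral_add (ha.sub hb).abs (hb.sub hc).abs).le
  exact integral_mono (ha.sub hc).abs ((ha.sub hb).abs.add (hb.sub hc).abs) fun v =>
    abs_sub_le _ _ _

lemma exists_measureReal_closedBall_compl_le {E : Type*} [NormedAddCommGroup E]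
    [MeasurableSpace E] [BorelSpace E] (Q : Measure E) [IsProbabilityMeasure Q] {ε : ℝ}
    (hε : 0 < ε) : ∃ R > 0, Q.real {v : E | ‖v‖ ≤ R}ᶜ ≤ ε := by
  have h1 : Filter.Tendsto (fun m : ℕ => Q.real {v : E | ‖v‖ ≤ (m : ℝ)}ᶜ) Filter.atTop
      (nhds 0) := by
    have h2 := tendsto_measure_iInter_atTop (μ := Q) (s := fun m : ℕ => {v : E | ‖v‖ ≤ (m : ℝ)}ᶜ)
      (fun m => (measurableSet_le measurable_norm measurable_const).compl.nullMeasurableSet)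
      (fun m m' h v hv hv' => hv (le_trans (show ‖v‖ ≤ (m : ℝ) from hv') (by exact_mod_cast h)))
      ⟨0, measure_ne_top _ _⟩
    have h3 : ⋂ m : ℕ, {v : E | ‖v‖ ≤ (m : ℝ)}ᶜ = ∅ := by
      ext v
      obtain ⟨m, hm⟩ := exists_nat_ge ‖v‖
      simp only [Set.mem_iInter, Set.mem_compl_iff, Set.mem_ofPred_eq, Set.mem_empty_iff_false,
        iff_false, not_forall, not_not]
      exact ⟨m, hm⟩
    rw [h3, measure_empty] at h2
    exact (ENNReal.tendsto_toReal ENNReal.zero_ne_top).comp h2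
  obtain ⟨m, hm1, hm2⟩ := ((h1.eventually_lt_const hε).and (Filter.eventually_gt_atTop 0)).exists
  exact ⟨m, by exact_mod_cast hm2, hm1.le⟩

/-- The two distances in which networks approximate the target are at most `η`. -/
def ExpClose {α : Type*} [MeasurableSpace α] (Q : Measure α) (η : ℝ) (a b : α → ℝ) : Prop :=
  ∫ v, |a v - b v| ∂Q ≤ η ∧ ∫ v, |Real.exp (a v) - Real.exp (b v)| ∂Q ≤ η

/-- On `[-C, C]` the exponential is Lipschitz with constant `exp C ≥ 1`, so one mean estimate
settles both distances. -/
lemma expClose_of_integral_le {α : Type*} [MeasurableSpace α] {Q : Measure α}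
    [IsProbabilityMeasure Q] {a b : α → ℝ} (ha : Measurable a) (hb : Measurable b) {C η : ℝ}
    (hC : 0 ≤ C) (haC : ∀ v, |a v| ≤ C) (hbC : ∀ v, |b v| ≤ C)
    (h : ∫ v, |a v - b v| ∂Q ≤ η / Real.exp C) : ExpClose Q η a b := by
  have h1 : 0 ≤ ∫ v, |a v - b v| ∂Q := integral_nonneg fun v => abs_nonneg _
  rw [le_div_iff₀ (Real.exp_pos C)] at h
  refine ⟨?_, (integral_abs_exp_sub_le ha hb haC hbC).trans (by linarith)⟩
  nlinarith [Real.one_le_exp hC]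

/-- A bounded measurable function is approximated by a bounded shallow network, in mean and after
exponentiation. -/
theorem exists_reluSpan_expClose {D : ℕ} (Q : Measure (Fin D → ℝ)) [IsProbabilityMeasure Q]
    {g : (Fin D → ℝ) → ℝ} (hg : Measurable g) {B : ℝ} (hB : ∀ v, |g v| ≤ B) {η : ℝ}
    (hη : 0 < η) :
    ∃ f ∈ reluSpan D, (∃ C, ∀ v, |f v| ≤ C) ∧ ExpClose Q η f g := by
  have hB0 : 0 ≤ B := (abs_nonneg _).trans (hB 0)
  have hη3 : 0 < η / 3 := by positivity
  -- a bounded continuous function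
  obtain ⟨c, hc, hcB, hcg⟩ : ∃ c : (Fin D → ℝ) → ℝ, Continuous c ∧ (∀ v, |c v| ≤ B) ∧
      ExpClose Q (η / 3) c g := by
    obtain ⟨c, -, h1, h2, h3⟩ := (integrable_of_abs_le hg hB :
      Integrable g Q).exists_hasCompactSupport_integral_sub_le
        (show 0 < η / 3 / Real.exp B by positivity)
    -- Truncation to `[-B, B]` fixes `g` and is 1-Lipschitz, so it bounds the approximant without
    -- increasing its distance to `g`.
    have hcont : Continuous fun v => max (-B) (min B (c v)) := by fun_prop
    have hbd : ∀ v, |max (-B) (min B (c v))| ≤ B := fun v => by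
      rw [abs_le]
      exact ⟨le_max_left _ _, max_le (by linarith) (min_le_left _ _)⟩
    refine ⟨_, hcont, hbd, expClose_of_integral_le hcont.measurable hg hB0 hbd hB (le_trans ?_ h1)⟩
    refine integral_mono_of_nonneg (ae_of_all _ fun v => abs_nonneg _)
      ((integrable_of_abs_le hg hB).sub h3).norm (ae_of_all _ fun v => ?_)
    have hgv := abs_le.1 (hB v)
    change |max (-B) (min B (c v)) - g v| ≤ |g v - c v|
    rw [abs_sub_comm (g v)]
    calc |max (-B) (min B (c v)) - g v|
        = |max (-B) (min B (c v)) - max (-B) (min B (g v))| := by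
          rw [min_eq_right hgv.2, max_eq_right hgv.1]
      _ ≤ |min B (c v) - min B (g v)| := by
          rw [max_comm (-B), max_comm (-B)]; exact abs_max_sub_max_le_abs _ _ _
      _ ≤ |c v - g v| := by
          have := abs_min_sub_min_le_max B (c v) B (g v)
          simpa using this
  -- a trigonometric polynomial
  obtain ⟨p, hp, hpc, hpB, hpcl⟩ : ∃ p ∈ cosSpan D, Continuous p ∧ (∀ v, |p v| ≤ B + 1) ∧
      ExpClose Q (η / 3) p c := by
    set κ := η / 3 / Real.exp (B + 1) with hκ
    have hκ0 : 0 < κ := by positivity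
    obtain ⟨R, hR, hRQ⟩ := exists_measureReal_closedBall_compl_le Q
      (show 0 < κ / (4 * (B + 1)) by positivity)
    obtain ⟨p, hp, hpc, hpB, hpR⟩ := exists_cosSpan_near hc hcB hR
      (show 0 < min 1 (κ / 2) by positivity)
    have hpB' : ∀ v, |p v| ≤ B + 1 := fun v => (hpB v).trans (by gcongr; exact min_le_left _ _)
    have hcB' : ∀ v, |c v| ≤ B + 1 := fun v => (hcB v).trans (by linarith)
    refine ⟨p, hp, hpc, hpB', expClose_of_integral_le hpc.measurable hc.measurable (by linarith)
      hpB' hcB' ?_⟩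
    refine (integral_abs_sub_le_of_near (measurableSet_le measurable_norm measurable_const)
      hpB' hcB' (show 0 ≤ κ / 2 by positivity)
      fun v hv => (hpR v hv).trans (min_le_right _ _)).trans ?_
    calc κ / 2 + 2 * (B + 1) * Q.real {v | ‖v‖ ≤ R}ᶜ
        ≤ κ / 2 + 2 * (B + 1) * (κ / (4 * (B + 1))) := by gcongr
      _ = κ := by field_simp; norm_num
  -- a network
  obtain ⟨C₀, hC₀⟩ := cosSpan_le_bddApprox D hp
  -- `C` depends on `p` alone, so the radius below can be chosen with the mass outside it small
  -- compared with `1 / C`.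
  set C := max C₀ (B + 1) with hC
  have hC0 : 0 < C := lt_of_lt_of_le (by linarith) (le_max_right _ _)
  set κ := η / 3 / Real.exp C with hκ
  have hκ0 : 0 < κ := by positivity
  obtain ⟨R, hR, hRQ⟩ := exists_measureReal_closedBall_compl_le Q
    (show 0 < κ / (4 * C) by positivity)
  obtain ⟨f, hf, hfC, hfR⟩ := hC₀ R (κ / 2) (by positivity)
  have hfc := (continuous_of_mem_reluSpan hf).measurable
  have hfC' : ∀ v, |f v| ≤ C := fun v => (hfC v).trans (le_max_left _ _)
  have hpC' : ∀ v, |p v| ≤ C := fun v => (hpB v).trans (le_max_right _ _)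
  have hfp : ExpClose Q (η / 3) f p := by
    refine expClose_of_integral_le hfc hpc.measurable hC0.le hfC' hpC' ?_
    refine (integral_abs_sub_le_of_near (measurableSet_le measurable_norm measurable_const)
      hfC' hpC' (show 0 ≤ κ / 2 by positivity) hfR).trans ?_
    calc κ / 2 + 2 * C * Q.real {v | ‖v‖ ≤ R}ᶜ
        ≤ κ / 2 + 2 * C * (κ / (4 * C)) := by gcongr
      _ = κ := by field_simp; norm_num
  refine ⟨f, hf, ⟨C, hfC'⟩, ?_, ?_⟩
  · have i1 := integrable_of_abs_le (Q := Q) hfc hfC'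
    have i2 := integrable_of_abs_le (Q := Q) hpc.measurable hpB
    have i3 := integrable_of_abs_le (Q := Q) hc.measurable hcB
    have i4 := integrable_of_abs_le (Q := Q) hg hB
    linarith [integral_abs_sub_triangle i1 i2 i4, integral_abs_sub_triangle i2 i3 i4, hfp.1,
      hpcl.1, hcg.1]
  · have i1 := integrable_exp_of_abs_le (Q := Q) hfc hfC'
    have i2 := integrable_exp_of_abs_le (Q := Q) hpc.measurable hpB
    have i3 := integrable_exp_of_abs_le (Q := Q) hc.measurable hcB
    have i4 := integrable_exp_of_abs_le (Q := Q) hg hB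
    linarith [integral_abs_sub_triangle i1 i2 i4, integral_abs_sub_triangle i2 i3 i4, hfp.2,
      hpcl.2, hcg.2]

end PolarMINE

namespace PolarMINE

/-! ### Concentration of functions with bounded differences -/

section BoundedDifferences

variable {S : Type*} [MeasurableSpace S] (μ : Measure S) [IsProbabilityMeasure μ]

lemma measurable_cons {L : ℕ} :
    Measurable fun p : S × (Fin L → S) => (Fin.cons p.1 p.2 : Fin (L + 1) → S) := by
  refine measurable_pi_lambda _ fun i => ?_
  refine Fin.cases ?_ (fun j => ?_) i
  · exact measurable_fst
  · exact (measurable_pi_apply j).comp measurable_snd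

lemma measurePreserving_cons (L : ℕ) :
    MeasurePreserving (fun p : S × (Fin L → S) => (Fin.cons p.1 p.2 : Fin (L + 1) → S))
      (μ.prod (Measure.pi fun _ => μ)) (Measure.pi fun _ => μ) := by
  have h := (measurePreserving_piFinSuccAbove (fun _ : Fin (L + 1) => μ) 0).symm
  convert h using 2 with p
  exact (Fin.insertNth_zero' p.1 p.2).symm

lemma integral_pi_succ {L : ℕ} {F : (Fin (L + 1) → S) → ℝ} (hF : Measurable F) {C : ℝ}
    (hC : ∀ z, |F z| ≤ C) :
    ∫ z, F z ∂(Measure.pi fun _ => μ) =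
      ∫ z, ∫ a, F (Fin.cons a z) ∂μ ∂(Measure.pi fun _ : Fin L => μ) := by
  rw [← (measurePreserving_cons μ L).map_eq,
    integral_map measurable_cons.aemeasurable hF.aestronglyMeasurable]
  rw [integral_prod_symm]
  exact integrable_of_abs_le (hF.comp measurable_cons) fun p => hC _

/-- **McDiarmid's inequality**, as a bound for the moment-generating function. -/
theorem hasSubgaussianMGF_of_boundedDifferences {L : ℕ} {F : (Fin L → S) → ℝ} (hF : Measurable F)
    {C : ℝ} (hC : ∀ z, |F z| ≤ C) {c : NNReal}
    (hc : ∀ (i : Fin L) (z z' : Fin L → S), (∀ j ≠ i, z j = z' j) → |F z - F z'| ≤ c) :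
    HasSubgaussianMGF (fun z => F z - ∫ z, F z ∂(Measure.pi fun _ => μ)) (L * c ^ 2)
      (Measure.pi fun _ => μ) := by
  have hint : ∀ {α : Type _} [MeasurableSpace α] (ν : Measure α) [IsProbabilityMeasure ν]
      {G : α → ℝ} (_ : Measurable G) (_ : ∀ z, |G z| ≤ C) (m t : ℝ),
      Integrable (fun z => Real.exp (t * (G z - m))) ν := by
    intro α _ ν _ G hG hGC m t
    refine integrable_exp_of_abs_le (C := |t| * (C + |m|)) ((hG.sub_const m).const_mul t) fun z => ?_
    rw [abs_mul]
    gcongr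
    exact (abs_sub _ _).trans (by gcongr; exact hGC z)
  refine ⟨fun t => hint _ hF hC _ t, fun t => ?_⟩
  induction L with
  | zero =>
    have h1 : ∀ z : Fin 0 → S, F z = F finZeroElim := fun z => congrArg F (Subsingleton.elim _ _)
    simp [mgf, h1]
  | succ L ih =>
    have hne : Nonempty S := by
      by_contra h
      have := not_nonempty_iff.1 h
      exact (IsProbabilityMeasure.ne_zero μ) (Measure.eq_zero_of_isEmpty μ)
    have hFc := hF.comp measurable_cons
    -- Integrating out the first coordinate keeps the mean and the bounded differences, so the
    -- induction hypothesis applies to `G`, and `F - m = (F - G) + (G - m)` is the martingale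
    -- decomposition.
    set G : (Fin L → S) → ℝ := fun z => ∫ a, F (Fin.cons a z) ∂μ with hGdef
    have hG : Measurable G :=
      (StronglyMeasurable.integral_prod_left' (f := fun p : S × (Fin L → S) =>
        F (Fin.cons p.1 p.2)) hFc.stronglyMeasurable).measurable
    have hi : ∀ z, Integrable (fun a => F (Fin.cons a z)) μ := fun z =>
      integrable_of_abs_le (hFc.comp (measurable_id.prodMk measurable_const)) fun a => hC _
    have hGC : ∀ z, |G z| ≤ C := fun z => by
      refine (abs_integral_le_integral_abs).trans ?_
      refine (integral_mono (hi z).abs (integrable_const C) fun a => hC _).trans ?_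
      simp
    have hGc : ∀ (i : Fin L) (z z' : Fin L → S), (∀ j ≠ i, z j = z' j) → |G z - G z'| ≤ c := by
      intro i z z' h
      rw [hGdef, ← integral_sub (hi z) (hi z')]
      refine (abs_integral_le_integral_abs).trans ?_
      refine (integral_mono ((hi z).sub (hi z')).abs (integrable_const (c : ℝ))
        fun a => hc i.succ _ _ fun j hj => ?_).trans (by simp)
      refine Fin.cases (fun _ => rfl) (fun j hj => ?_) j hj
      simpa using h j fun e => hj (by rw [e])
    have hm : ∫ z, F z ∂(Measure.pi fun _ => μ) = ∫ z, G z ∂(Measure.pi fun _ => μ) :=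
      integral_pi_succ μ hF hC
    have ih' := ih hG hGC hGc
    set m := ∫ z, F z ∂(Measure.pi fun _ => μ) with hmdef
    rw [← hm] at ih'
    -- For fixed `z` the increment `F - G` has mean zero and lies in `[-c, c]`, so Hoeffding's lemma
    -- gives the variance proxy `c²`. The sharp `c² / 4` is not needed.
    have inner : ∀ z, ∫ a, Real.exp (t * (F (Fin.cons a z) - m)) ∂μ ≤
        Real.exp (c ^ 2 * t ^ 2 / 2) * Real.exp (t * (G z - m)) := by
      intro z
      have hsub := hasSubgaussianMGF_of_mem_Icc_of_integral_eq_zero (μ := μ)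
        (X := fun a => F (Fin.cons a z) - G z) (a := -c) (b := c)
        ((hi z).aestronglyMeasurable.aemeasurable.sub_const _) (ae_of_all _ fun a => by
          rw [Set.mem_Icc, ← abs_le]
          have h1 : F (Fin.cons a z) - G z =
              ∫ b, (F (Fin.cons a z) - F (Fin.cons b z)) ∂μ := by
            rw [integral_sub (integrable_const _) (hi z)]; simp [hGdef]
          rw [h1]
          refine (abs_integral_le_integral_abs).trans ?_
          refine (integral_mono ((integrable_const _).sub (hi z)).abs (integrable_const (c : ℝ))
            fun b => hc 0 _ _ fun j hj => ?_).trans (by simp)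
          refine Fin.cases (fun h => absurd rfl h) (fun j _ => ?_) j hj
          simp)
        (by rw [integral_sub (hi z) (integrable_const _)]; simp [hGdef])
      have h2 := hsub.mgf_le t
      have h3 : (((‖(c : ℝ) - -(c : ℝ)‖₊ / 2) ^ 2 : NNReal) : ℝ) = c ^ 2 := by
        have : ‖(c : ℝ) - -(c : ℝ)‖ = 2 * c := by
          rw [sub_neg_eq_add, ← two_mul, Real.norm_of_nonneg (by positivity)]
        push_cast
        rw [this]; ring
      rw [h3] at h2
      calc ∫ a, Real.exp (t * (F (Fin.cons a z) - m)) ∂μ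
          = ∫ a, Real.exp (t * (F (Fin.cons a z) - G z)) * Real.exp (t * (G z - m)) ∂μ := by
            refine integral_congr_ae (ae_of_all _ fun a => ?_)
            simp only [← Real.exp_add]
            ring_nf
        _ = (∫ a, Real.exp (t * (F (Fin.cons a z) - G z)) ∂μ) * Real.exp (t * (G z - m)) :=
            integral_mul_const _ _
        _ ≤ _ := mul_le_mul_of_nonneg_right h2 (Real.exp_pos _).le
    have hexp : Measurable fun z => Real.exp (t * (F z - m)) :=
      Real.measurable_exp.comp ((hF.sub_const m).const_mul t)
    have hexpC : ∀ z, |Real.exp (t * (F z - m))| ≤ Real.exp (|t| * (C + |m|)) := fun z => by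
      rw [abs_of_pos (Real.exp_pos _), Real.exp_le_exp]
      refine (le_abs_self _).trans ?_
      rw [abs_mul]
      gcongr
      exact (abs_sub _ _).trans (by gcongr; exact hC z)
    calc ∫ z, Real.exp (t * (F z - m)) ∂(Measure.pi fun _ => μ)
        = ∫ z, ∫ a, Real.exp (t * (F (Fin.cons a z) - m)) ∂μ ∂(Measure.pi fun _ => μ) :=
          integral_pi_succ μ hexp hexpC
      _ ≤ ∫ z, Real.exp (c ^ 2 * t ^ 2 / 2) * Real.exp (t * (G z - m))
            ∂(Measure.pi fun _ => μ) :=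
          integral_mono_of_nonneg (ae_of_all _ fun z => integral_nonneg fun a =>
            (Real.exp_pos _).le) ((hint _ hG hGC m t).const_mul _) (ae_of_all _ inner)
      _ = Real.exp (c ^ 2 * t ^ 2 / 2) * ∫ z, Real.exp (t * (G z - m))
            ∂(Measure.pi fun _ => μ) := integral_const_mul _ _
      _ ≤ Real.exp (c ^ 2 * t ^ 2 / 2) * Real.exp (((L * c ^ 2 : NNReal) : ℝ) * t ^ 2 / 2) :=
          mul_le_mul_of_nonneg_left ih' (Real.exp_pos _).le
      _ = _ := by
          rw [← Real.exp_add]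
          push_cast
          ring_nf

/-- **McDiarmid's inequality**. -/
theorem measureReal_abs_sub_integral_ge_le {L : ℕ} {F : (Fin L → S) → ℝ} (hF : Measurable F)
    {C : ℝ} (hC : ∀ z, |F z| ≤ C) {c : NNReal}
    (hc : ∀ (i : Fin L) (z z' : Fin L → S), (∀ j ≠ i, z j = z' j) → |F z - F z'| ≤ c)
    {r : ℝ} (hr : 0 ≤ r) :
    (Measure.pi fun _ => μ).real {z | r ≤ |F z - ∫ z, F z ∂(Measure.pi fun _ => μ)|} ≤
      2 * Real.exp (-r ^ 2 / (2 * (L * c ^ 2))) := by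
  have h1 := hasSubgaussianMGF_of_boundedDifferences μ hF hC hc
  have a := h1.measure_ge_le hr
  have b := h1.neg.measure_ge_le hr
  push_cast at a b
  rw [two_mul]
  refine (measureReal_mono ?_).trans ((measureReal_union_le _ _).trans (add_le_add a b))
  intro z hz
  rcases le_abs.1 (show r ≤ |_| from hz) with h | h
  · exact Or.inl h
  · exact Or.inr h

end BoundedDifferences

/-! ### Random permutations -/

/-- The number of fixed points of a permutation. -/
def numFixed {L : ℕ} (σ : Equiv.Perm (Fin L)) : ℕ := (Finset.univ.filter fun t => σ t = t).card

/-- Two transpositions suffice. The symmetric group thus has at most two orbits on ordered pairs,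
the diagonal and its complement. -/
lemma exists_perm_pair {α : Type*} [DecidableEq α] {a b c d : α} (h : a = b ↔ c = d) :
    ∃ σ : Equiv.Perm α, σ c = a ∧ σ d = b := by
  by_cases hab : a = b
  · subst hab
    have := h.1 rfl
    subst this
    exact ⟨Equiv.swap c a, by simp⟩
  · have hcd : c ≠ d := fun e => hab (h.2 e)
    refine ⟨Equiv.swap (Equiv.swap c a d) b * Equiv.swap c a, ?_, ?_⟩
    · rw [Equiv.Perm.mul_apply, Equiv.swap_apply_left]
      refine Equiv.swap_apply_of_ne_of_ne (fun e => hcd ?_) hab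
      have := congrArg (Equiv.swap c a) e
      simpa using this
    · simp

/-- The second moment of the number of fixed points is at most `2`. -/
lemma sum_numFixed_sq_le (L : ℕ) :
    ∑ σ : Equiv.Perm (Fin L), numFixed σ ^ 2 ≤ 2 * Fintype.card (Equiv.Perm (Fin L)) := by
  classical
  -- `numFixed σ ^ 2` counts the pairs fixed by `σ`, so Burnside's lemma expresses the second moment
  -- as the number of orbits on pairs.
  have h1 : ∀ σ : Equiv.Perm (Fin L),
      Fintype.card (MulAction.fixedBy (Fin L × Fin L) σ) = numFixed σ ^ 2 := fun σ => by
    rw [sq, numFixed, ← Finset.card_product, Fintype.card_of_subtype]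
    rintro ⟨a, b⟩
    simp [MulAction.mem_fixedBy, Prod.ext_iff]
  have h2 := MulAction.sum_card_fixedBy_eq_card_orbits_mul_card_group
    (Equiv.Perm (Fin L)) (Fin L × Fin L)
  simp only [h1] at h2
  rw [h2]
  refine Nat.mul_le_mul_right _ ?_
  rw [← Fintype.card_bool]
  let f : Quotient (MulAction.orbitRel (Equiv.Perm (Fin L)) (Fin L × Fin L)) → Bool :=
    Quotient.lift (fun p => decide (p.1 = p.2)) (by
      rintro p q ⟨σ, rfl⟩
      simp)
  refine Fintype.card_le_of_injective f ?_
  rintro ⟨a, b⟩ ⟨c, d⟩ h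
  have h' : a = b ↔ c = d := by simpa [f] using h
  obtain ⟨σ, h3, h4⟩ := exists_perm_pair h'
  exact Quotient.sound ⟨σ, Prod.ext h3 h4⟩

end PolarMINE

namespace PolarMINE

/-! ### Averages over shuffled samples -/

section Shuffle

variable {A B : Type*} [MeasurableSpace A] [MeasurableSpace B]

/-- The average of `f` over a sample of pairs whose second components are permuted. -/
noncomputable def shuffleAvg {L : ℕ} (f : A × B → ℝ) (σ : Equiv.Perm (Fin L))
    (z : Fin L → A × B) : ℝ :=
  (1 / (L : ℝ)) * ∑ t, f ((z t).1, (z (σ t)).2)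

lemma measurable_shuffleAvg {L : ℕ} {f : A × B → ℝ} (hf : Measurable f)
    (σ : Equiv.Perm (Fin L)) : Measurable (shuffleAvg f σ) := by
  unfold shuffleAvg
  fun_prop

/-- Weakens the exponential tail to order `1 / L²`, the order of the contribution of the fixed
points. -/
lemma exp_neg_le_div_sq {x : ℝ} (hx : 0 < x) : Real.exp (-x) ≤ 2 / x ^ 2 := by
  rw [Real.exp_neg, inv_le_comm₀ (Real.exp_pos x) (by positivity), inv_div]
  have := Real.quadratic_le_exp_of_nonneg hx.le
  linarith

variable (μ : Measure (A × B)) [IsProbabilityMeasure μ]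

lemma integral_pi_pair {L : ℕ} {f : A × B → ℝ} (hf : Measurable f)
    {s t : Fin L} (hst : s ≠ t) :
    ∫ z : Fin L → A × B, f ((z s).1, (z t).2) ∂(Measure.pi fun _ => μ) =
      ∫ p, f p ∂((μ.map Prod.fst).prod (μ.map Prod.snd)) := by
  have hind : IndepFun (fun z : Fin L → A × B => (z s).1) (fun z => (z t).2)
      (Measure.pi fun _ => μ) :=
    ((iIndepFun_pi (X := fun (_ : Fin L) (p : A × B) => p)
      fun _ => aemeasurable_id).indepFun hst).comp measurable_fst measurable_snd
  have hms : Measurable fun z : Fin L → A × B => (z s).1 :=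
    measurable_fst.comp (measurable_pi_apply s)
  have hmt : Measurable fun z : Fin L → A × B => (z t).2 :=
    measurable_snd.comp (measurable_pi_apply t)
  have h1 := (indepFun_iff_map_prod_eq_prod_map_map hms.aemeasurable hmt.aemeasurable).1 hind
  have e1 : (Measure.pi fun _ : Fin L => μ).map (fun z => (z s).1) = μ.map Prod.fst := by
    conv_rhs => rw [← (measurePreserving_eval (fun _ : Fin L => μ) s).map_eq]
    rw [Measure.map_map measurable_fst (measurable_pi_apply s)]
    rfl
  have e2 : (Measure.pi fun _ : Fin L => μ).map (fun z => (z t).2) = μ.map Prod.snd := by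
    conv_rhs => rw [← (measurePreserving_eval (fun _ : Fin L => μ) t).map_eq]
    rw [Measure.map_map measurable_snd (measurable_pi_apply t)]
    rfl
  rw [e1, e2] at h1
  rw [← h1, integral_map (hms.prodMk hmt).aemeasurable hf.aestronglyMeasurable]

/-- The mean of a shuffled average is the mean under the product of the marginals, up to the
contribution of the fixed points. -/
lemma abs_integral_shuffleAvg_sub_le {L : ℕ} (hL : 0 < L) {f : A × B → ℝ} (hf : Measurable f)
    {C : ℝ} (hC : ∀ p, |f p| ≤ C) (σ : Equiv.Perm (Fin L)) :
    |∫ z, shuffleAvg f σ z ∂(Measure.pi fun _ => μ) -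
      ∫ p, f p ∂((μ.map Prod.fst).prod (μ.map Prod.snd))| ≤ 2 * C * numFixed σ / L := by
  have hL' : (0 : ℝ) < L := by exact_mod_cast hL
  have : IsProbabilityMeasure (μ.map Prod.fst) :=
    Measure.isProbabilityMeasure_map measurable_fst.aemeasurable
  have : IsProbabilityMeasure (μ.map Prod.snd) :=
    Measure.isProbabilityMeasure_map measurable_snd.aemeasurable
  set m := ∫ p, f p ∂((μ.map Prod.fst).prod (μ.map Prod.snd)) with hm
  have hint : ∀ t : Fin L, Integrable (fun z : Fin L → A × B => f ((z t).1, (z (σ t)).2))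
      (Measure.pi fun _ => μ) := fun t =>
    integrable_of_abs_le (by fun_prop) fun _ => hC _
  have bound : ∀ {α : Type _} [MeasurableSpace α] (ν : Measure α) [IsProbabilityMeasure ν]
      (g : α → ℝ) (_ : ∀ z, |g z| ≤ C), |∫ z, g z ∂ν| ≤ C := by
    intro α _ ν _ g hg
    refine (norm_integral_le_of_norm_le_const (μ := ν) (f := g) (ae_of_all _ hg)).trans ?_
    simp
  have h1 : ∫ z, shuffleAvg f σ z ∂(Measure.pi fun _ => μ) - m =
      (1 / (L : ℝ)) * ∑ t, (∫ z : Fin L → A × B, f ((z t).1, (z (σ t)).2)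
        ∂(Measure.pi fun _ => μ) - m) := by
    unfold shuffleAvg
    rw [integral_const_mul, integral_finsetSum _ fun t _ => hint t, Finset.sum_sub_distrib]
    simp only [Finset.sum_const, Finset.card_univ, Fintype.card_fin, nsmul_eq_mul]
    field_simp
  have h2 : |∑ t, (∫ z : Fin L → A × B, f ((z t).1, (z (σ t)).2) ∂(Measure.pi fun _ => μ) - m)| ≤
      2 * C * numFixed σ := by
    refine (Finset.abs_sum_le_sum_abs _ _).trans ?_
    have h3 : ∀ t : Fin L, |∫ z : Fin L → A × B, f ((z t).1, (z (σ t)).2)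
        ∂(Measure.pi fun _ => μ) - m| ≤ if σ t = t then 2 * C else 0 := by
      intro t
      split_ifs with ht
      · refine (abs_sub _ _).trans ?_
        linarith [bound (Measure.pi fun _ : Fin L => μ) _ fun z => hC ((z t).1, (z (σ t)).2),
          bound ((μ.map Prod.fst).prod (μ.map Prod.snd)) f hC]
      · rw [integral_pi_pair μ hf (Ne.symm ht), sub_self, abs_zero]
    refine (Finset.sum_le_sum fun t _ => h3 t).trans (le_of_eq ?_)
    rw [← Finset.sum_filter, Finset.sum_const, nsmul_eq_mul, mul_comm, numFixed]
  rw [h1, abs_mul, abs_of_pos (by positivity), one_div, inv_mul_eq_div]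
  gcongr

/-- Coordinate `i` enters only the summands `t = i` and `t = σ⁻¹ i`, and each of them moves by at
most `2C`. -/
lemma shuffleAvg_boundedDifferences {A B : Type*} {L : ℕ} {f : A × B → ℝ}
    {C : ℝ} (hC : ∀ p, |f p| ≤ C) (σ : Equiv.Perm (Fin L)) (i : Fin L) (z z' : Fin L → A × B)
    (h : ∀ j ≠ i, z j = z' j) :
    |shuffleAvg f σ z - shuffleAvg f σ z'| ≤ 4 * C / L := by
  have hC0 : 0 ≤ C := (abs_nonneg _).trans (hC (z i))
  unfold shuffleAvg
  rw [← mul_sub, ← Finset.sum_sub_distrib, abs_mul, abs_of_nonneg (by positivity), one_div,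
    inv_mul_eq_div]
  gcongr
  refine (Finset.abs_sum_le_sum_abs _ _).trans ?_
  have h3 : ∀ t : Fin L, |f ((z t).1, (z (σ t)).2) - f ((z' t).1, (z' (σ t)).2)| ≤
      (if t = i then 2 * C else 0) + (if t = σ.symm i then 2 * C else 0) := by
    intro t
    have hle : |f ((z t).1, (z (σ t)).2) - f ((z' t).1, (z' (σ t)).2)| ≤ 2 * C :=
      (abs_sub _ _).trans (by linarith [hC ((z t).1, (z (σ t)).2), hC ((z' t).1, (z' (σ t)).2)])
    by_cases h1 : t = i
    · rw [if_pos h1]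
      split_ifs <;> linarith
    by_cases h2 : t = σ.symm i
    · rw [if_pos h2, if_neg h1]; linarith
    · have h2' : σ t ≠ i := fun e => h2 (by rw [← e, Equiv.symm_apply_apply])
      rw [h t h1, h (σ t) h2', if_neg h1, if_neg h2]
      simp
  refine (Finset.sum_le_sum fun t _ => h3 t).trans (le_of_eq ?_)
  rw [Finset.sum_add_distrib, Finset.sum_ite_eq', Finset.sum_ite_eq']
  simp
  ring

/-- If `σ` has few fixed points, the bias is at most `δ / 2` and McDiarmid's inequality handles the
rest. Otherwise `1 ≤ (4C numFixed σ / (δ L))²`, and the trivial bound on a probability suffices. -/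
lemma measureReal_shuffleAvg_le {f : A × B → ℝ} (hf : Measurable f) {C : ℝ} (hC0 : 0 < C)
    (hC : ∀ p, |f p| ≤ C) {δ : ℝ} (hδ : 0 < δ) {L : ℕ} (hL : 0 < L) (σ : Equiv.Perm (Fin L)) :
    (Measure.pi fun _ => μ).real {z | δ ≤ |shuffleAvg f σ z -
      ∫ p, f p ∂((μ.map Prod.fst).prod (μ.map Prod.snd))|} ≤
      (4 * (128 * C ^ 2 / δ ^ 2) ^ 2 + (4 * C / δ) ^ 2 * numFixed σ ^ 2) / L ^ 2 := by
  have hL' : (0 : ℝ) < L := by exact_mod_cast hL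
  by_cases hfix : 4 * C / δ * numFixed σ ≤ L
  · have h1 := measureReal_abs_sub_integral_ge_le μ (measurable_shuffleAvg hf σ) (C := C)
      (fun z => by
        unfold shuffleAvg
        rw [abs_mul, abs_of_pos (by positivity), one_div, inv_mul_eq_div, div_le_iff₀ hL']
        refine (Finset.abs_sum_le_sum_abs _ _).trans ?_
        refine (Finset.sum_le_sum fun t _ => hC _).trans ?_
        simp [mul_comm])
      (c := (4 * C / L).toNNReal) (by
        rw [Real.coe_toNNReal _ (by positivity)]
        exact shuffleAvg_boundedDifferences hC σ) (r := δ / 2) (by positivity)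
    have h2 := abs_integral_shuffleAvg_sub_le μ hL hf hC σ
    have h3 : 2 * C * numFixed σ / L ≤ δ / 2 := by
      rw [div_mul_eq_mul_div, div_le_iff₀ hδ] at hfix
      rw [div_le_iff₀ hL']
      linarith
    have h4 := exp_neg_le_div_sq (x := δ ^ 2 * L / (128 * C ^ 2)) (by positivity)
    rw [Real.coe_toNNReal _ (by positivity)] at h1
    refine (measureReal_mono ?_).trans (h1.trans ?_)
    · intro z hz
      have hz' : δ ≤ |_| := hz
      have := abs_sub_le (shuffleAvg f σ z) (∫ z, shuffleAvg f σ z ∂(Measure.pi fun _ => μ))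
        (∫ p, f p ∂((μ.map Prod.fst).prod (μ.map Prod.snd)))
      change δ / 2 ≤ |_|
      linarith
    · have e1 : -(δ / 2) ^ 2 / (2 * (L * (4 * C / L) ^ 2)) =
          -(δ ^ 2 * L / (128 * C ^ 2)) := by
        field_simp
        norm_num
      rw [e1]
      calc 2 * Real.exp (-(δ ^ 2 * L / (128 * C ^ 2)))
          ≤ 2 * (2 / (δ ^ 2 * L / (128 * C ^ 2)) ^ 2) := by gcongr
        _ = 4 * (128 * C ^ 2 / δ ^ 2) ^ 2 / L ^ 2 := by field_simp; norm_num
        _ ≤ _ := by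
          gcongr
          linarith [show 0 ≤ (4 * C / δ) ^ 2 * (numFixed σ : ℝ) ^ 2 by positivity]
  · push Not at hfix
    refine measureReal_le_one.trans ?_
    rw [le_div_iff₀ (by positivity), one_mul]
    have : (L : ℝ) ^ 2 ≤ (4 * C / δ * numFixed σ) ^ 2 := by gcongr
    rw [mul_pow] at this
    linarith [show 0 ≤ 4 * (128 * C ^ 2 / δ ^ 2) ^ 2 by positivity]

/-- Averaging the previous bound over `σ` replaces `numFixed σ ^ 2` by its mean, which is at most
`2`. -/
lemma measureReal_uniform_prod_le {f : A × B → ℝ} (hf : Measurable f) {C : ℝ} (hC0 : 0 < C)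
    (hC : ∀ p, |f p| ≤ C) {δ : ℝ} (hδ : 0 < δ) {L : ℕ} (hL : 0 < L) :
    ((PMF.uniformOfFintype (Equiv.Perm (Fin L))).toMeasure.prod (Measure.pi fun _ => μ)).real
      {p | δ ≤ |shuffleAvg f p.1 p.2 -
        ∫ p, f p ∂((μ.map Prod.fst).prod (μ.map Prod.snd))|} ≤
      (4 * (128 * C ^ 2 / δ ^ 2) ^ 2 + (4 * C / δ) ^ 2 * 2) / L ^ 2 := by
  classical
  have hL' : (0 : ℝ) < L := by exact_mod_cast hL
  have hmeas : Measurable fun p : Equiv.Perm (Fin L) × (Fin L → A × B) =>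
      shuffleAvg f p.1 p.2 :=
    measurable_from_prod_countable_right fun σ => measurable_shuffleAvg hf σ
  set E : Set (Equiv.Perm (Fin L) × (Fin L → A × B)) := {p | δ ≤ |shuffleAvg f p.1 p.2 -
        ∫ p, f p ∂((μ.map Prod.fst).prod (μ.map Prod.snd))|} with hE
  have hset : MeasurableSet E :=
    measurableSet_le measurable_const (hmeas.sub_const _).abs
  have hfixed : (∑ σ : Equiv.Perm (Fin L), (numFixed σ : ℝ) ^ 2) ≤
      2 * Fintype.card (Equiv.Perm (Fin L)) := by exact_mod_cast sum_numFixed_sq_le L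
  set K := 4 * (128 * C ^ 2 / δ ^ 2) ^ 2 with hK
  set n := (Fintype.card (Equiv.Perm (Fin L)) : ℝ) with hn
  have hn0 : 0 < n := by rw [hn]; exact_mod_cast Fintype.card_pos
  have hi : Integrable (E.indicator (1 : Equiv.Perm (Fin L) × (Fin L → A × B) → ℝ))
      ((PMF.uniformOfFintype (Equiv.Perm (Fin L))).toMeasure.prod (Measure.pi fun _ => μ)) :=
    (integrable_const (1 : ℝ)).indicator hset
  rw [← integral_indicator_one hset, integral_prod _ hi, PMF.integral_eq_sum]
  have hinner : ∀ σ : Equiv.Perm (Fin L), ∫ z : Fin L → A × B,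
      E.indicator (1 : Equiv.Perm (Fin L) × (Fin L → A × B) → ℝ) (σ, z)
        ∂(Measure.pi fun _ => μ) ≤ (K + (4 * C / δ) ^ 2 * numFixed σ ^ 2) / L ^ 2 := fun σ => by
    refine le_trans (le_of_eq ?_) (measureReal_shuffleAvg_le μ hf hC0 hC hδ hL σ)
    exact integral_indicator_one (measurable_prodMk_left (x := σ) hset)
  calc _ ≤ ∑ σ : Equiv.Perm (Fin L), n⁻¹ * ((K + (4 * C / δ) ^ 2 * numFixed σ ^ 2) / L ^ 2) := by
        refine Finset.sum_le_sum fun σ _ => ?_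
        have : ((PMF.uniformOfFintype (Equiv.Perm (Fin L))) σ).toReal = n⁻¹ := by
          rw [PMF.uniformOfFintype_apply, ENNReal.toReal_inv, hn, ENNReal.toReal_natCast]
        rw [this, smul_eq_mul]
        exact mul_le_mul_of_nonneg_left (hinner σ) (by positivity)
    _ = (K + (4 * C / δ) ^ 2 * (n⁻¹ * ∑ σ : Equiv.Perm (Fin L), (numFixed σ : ℝ) ^ 2)) /
          L ^ 2 := by
        rw [← Finset.mul_sum, ← Finset.sum_div, Finset.sum_add_distrib, Finset.sum_const,
          Finset.card_univ, nsmul_eq_mul, ← hn, ← Finset.mul_sum, mul_div_assoc']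
        congr 1
        rw [mul_add, inv_mul_cancel_left₀ hn0.ne']
        ring
    _ ≤ _ := by
        gcongr
        rw [inv_mul_le_iff₀ hn0]
        linarith

end Shuffle

/-- The law of large numbers for shuffled samples. -/
theorem ae_eventually_abs_shuffleAvg_sub_lt {A B Ω : Type*} [MeasurableSpace A]
    [MeasurableSpace B] [MeasurableSpace Ω] (μ : Measure (A × B)) [IsProbabilityMeasure μ]
    (P : Measure Ω) [IsProbabilityMeasure P] {L : ℕ → ℕ} (hL : ∀ M, M ≤ L M)
    {π : (M : ℕ) → Ω → Equiv.Perm (Fin (L M))}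
    (hπ : ∀ M, HasLaw (π M) (PMF.uniformOfFintype (Equiv.Perm (Fin (L M)))).toMeasure P)
    {Z : (M : ℕ) → Ω → Fin (L M) → A × B} (hZ : ∀ M, HasLaw (Z M) (Measure.pi fun _ => μ) P)
    (hind : ∀ M, IndepFun (π M) (Z M) P) {f : A × B → ℝ} (hf : Measurable f) {C : ℝ}
    (hC : ∀ p, |f p| ≤ C) {δ : ℝ} (hδ : 0 < δ) :
    ∀ᵐ ω ∂P, ∀ᶠ M in Filter.atTop, |shuffleAvg f (π M ω) (Z M ω) -
      ∫ p, f p ∂((μ.map Prod.fst).prod (μ.map Prod.snd))| < δ := by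
  have hC1 : ∀ p, |f p| ≤ |C| + 1 := fun p => (hC p).trans (by linarith [le_abs_self C])
  have hC0 : 0 < |C| + 1 := by positivity
  set m := ∫ p, f p ∂((μ.map Prod.fst).prod (μ.map Prod.snd)) with hm
  set K := 4 * (128 * (|C| + 1) ^ 2 / δ ^ 2) ^ 2 + (4 * (|C| + 1) / δ) ^ 2 * 2 with hK
  have hK0 : 0 ≤ K := by positivity
  -- Borel-Cantelli needs only the law of `(π M, Z M)` for each single `M`, so the shuffles for
  -- different `M` may depend on each other arbitrarily. The shift to `M + 1` guarantees a nonempty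
  -- sample.
  have hbound : ∀ M : ℕ, P {ω | δ ≤ |shuffleAvg f (π (M + 1) ω) (Z (M + 1) ω) - m|} ≤
      ENNReal.ofReal (K / ((M + 1 : ℕ) : ℝ) ^ 2) := by
    intro M
    have hLM : 0 < L (M + 1) := lt_of_lt_of_le M.succ_pos (hL (M + 1))
    have hmeas : Measurable fun p : Equiv.Perm (Fin (L (M + 1))) × (Fin (L (M + 1)) → A × B) =>
        shuffleAvg f p.1 p.2 :=
      measurable_from_prod_countable_right fun σ => measurable_shuffleAvg hf σ
    have hlaw : P.map (fun ω => (π (M + 1) ω, Z (M + 1) ω)) =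
        (PMF.uniformOfFintype (Equiv.Perm (Fin (L (M + 1))))).toMeasure.prod
          (Measure.pi fun _ => μ) := by
      rw [(indepFun_iff_map_prod_eq_prod_map_map (hπ _).aemeasurable (hZ _).aemeasurable).1
        (hind _), (hπ _).map_eq, (hZ _).map_eq]
    have h1 := measureReal_uniform_prod_le μ hf hC0 hC1 hδ hLM
    rw [← hlaw, map_measureReal_apply_of_aemeasurable
      ((hπ _).aemeasurable.prodMk (hZ _).aemeasurable)
      (measurableSet_le measurable_const (hmeas.sub_const _).abs)] at h1
    rw [← ENNReal.ofReal_toReal (measure_ne_top P _)]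
    refine ENNReal.ofReal_le_ofReal (h1.trans ?_)
    have : ((M + 1 : ℕ) : ℝ) ≤ L (M + 1) := by exact_mod_cast hL (M + 1)
    gcongr
  have hsum : ∑' M : ℕ, P {ω | δ ≤ |shuffleAvg f (π (M + 1) ω) (Z (M + 1) ω) - m|} ≠ ⊤ := by
    refine ne_top_of_le_ne_top ?_ (ENNReal.tsum_le_tsum hbound)
    rw [← ENNReal.ofReal_tsum_of_nonneg (fun M => by positivity)]
    · exact ENNReal.ofReal_ne_top
    · have := (summable_nat_add_iff 1).2 (Real.summable_nat_pow_inv.2 one_lt_two)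
      simpa only [div_eq_mul_inv] using this.mul_left K
  filter_upwards [ae_eventually_notMem hsum] with ω hω
  rw [Filter.eventually_atTop] at hω ⊢
  obtain ⟨a, ha⟩ := hω
  refine ⟨a + 1, fun M hM => ?_⟩
  obtain ⟨M, rfl⟩ : ∃ M', M = M' + 1 := ⟨M - 1, by omega⟩
  exact not_le.1 (ha M (by omega))

end PolarMINE

namespace PolarMINE

/-! ### Laws of large numbers -/

/-- The average of `g` over a finite sample. -/
noncomputable def sampleAvg {S : Type*} {L : ℕ} (g : S → ℝ) (z : Fin L → S) : ℝ :=
  (1 / (L : ℝ)) * ∑ t, g (z t)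

lemma abs_sampleAvg_sub_le {S : Type*} {L : ℕ} (hL : 0 < L) {a b : S → ℝ} {C δ : ℝ} {K : Set S}
    (haC : ∀ s, |a s| ≤ C) (hbC : ∀ s, |b s| ≤ C) (hδ : 0 ≤ δ)
    (h : ∀ s ∈ K, |a s - b s| ≤ δ) (z : Fin L → S) :
    |sampleAvg a z - sampleAvg b z| ≤ δ + 2 * C * sampleAvg (Kᶜ.indicator 1) z := by
  have hL' : (0 : ℝ) < L := by exact_mod_cast hL
  have key : ∀ s, |a s - b s| ≤ δ + 2 * C * Kᶜ.indicator 1 s := fun s => by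
    by_cases hs : s ∈ K
    · simpa [hs] using h s hs
    · have := (abs_sub (a s) (b s)).trans (add_le_add (haC s) (hbC s))
      simp [hs]; linarith
  unfold sampleAvg
  rw [← mul_sub, ← Finset.sum_sub_distrib, abs_mul, abs_of_pos (by positivity)]
  calc 1 / (L : ℝ) * |∑ t, (a (z t) - b (z t))|
      ≤ 1 / (L : ℝ) * ∑ t, (δ + 2 * C * Kᶜ.indicator 1 (z t)) := by
        gcongr
        exact (Finset.abs_sum_le_sum_abs _ _).trans (Finset.sum_le_sum fun t _ => key _)
    _ = δ + 2 * C * (1 / (L : ℝ) * ∑ t, Kᶜ.indicator 1 (z t)) := by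
        rw [Finset.sum_add_distrib, ← Finset.mul_sum]
        simp only [Finset.sum_const, Finset.card_univ, Fintype.card_fin, nsmul_eq_mul]
        field_simp

/-- The averages over the random samples `z` satisfy the law of large numbers with limit `μ`. -/
def SatisfiesLLN {Ω S : Type*} [MeasurableSpace Ω] [MeasurableSpace S] (P : Measure Ω)
    (μ : Measure S) {L : ℕ → ℕ} (z : (M : ℕ) → Ω → Fin (L M) → S) : Prop :=
  ∀ g : S → ℝ, Measurable g → (∃ C, ∀ s, |g s| ≤ C) → ∀ δ > 0,
    ∀ᵐ ω ∂P, ∀ᶠ M in Filter.atTop, |sampleAvg g (z M ω) - ∫ s, g s ∂μ| < δ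

/-- A uniform law of large numbers over a compact parameter set. -/
theorem SatisfiesLLN.uniform {Ω S Θ : Type*} [MeasurableSpace Ω] [MeasurableSpace S]
    [TopologicalSpace Θ] {P : Measure Ω} {μ : Measure S} [IsProbabilityMeasure μ] {L : ℕ → ℕ}
    {z : (M : ℕ) → Ω → Fin (L M) → S} (hz : SatisfiesLLN P μ z) (hL : ∀ M, M ≤ L M)
    {Φ : Set Θ} (hΦ : IsCompact Φ) {f : Θ → S → ℝ} (hf : ∀ θ, Measurable (f θ)) {C : ℝ}
    (hC : ∀ θ ∈ Φ, ∀ s, |f θ s| ≤ C)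
    (htight : ∀ η > 0, ∃ K, MeasurableSet K ∧ μ.real Kᶜ ≤ η ∧
      ∀ θ, ∀ η' > 0, ∀ᶠ θ' in nhds θ, ∀ s ∈ K, |f θ' s - f θ s| ≤ η')
    {δ : ℝ} (hδ : 0 < δ) :
    ∀ᵐ ω ∂P, ∀ᶠ M in Filter.atTop, ∀ θ ∈ Φ,
      |sampleAvg (f θ) (z M ω) - ∫ s, f θ s ∂μ| < δ := by
  rcases Φ.eq_empty_or_nonempty with rfl | ⟨θ₀, hθ₀⟩
  · simp
  have hS : Nonempty S := by
    by_contra h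
    have := not_nonempty_iff.1 h
    exact (IsProbabilityMeasure.ne_zero μ) (Measure.eq_zero_of_isEmpty μ)
  have hC0 : 0 ≤ C := (abs_nonneg _).trans (hC θ₀ hθ₀ hS.some)
  -- Three comparisons of size `δ / 8` on `K`, together with at most `6 C η ≤ 3 δ / 8` from outside
  -- `K`, stay below `δ`.
  set η := δ / (16 * (C + 1)) with hη
  have hη0 : 0 < η := by positivity
  have hCη : C * η ≤ δ / 16 := by
    rw [hη, mul_div_assoc', div_le_div_iff₀ (by positivity) (by norm_num)]
    nlinarith
  obtain ⟨K, hK, hKμ, hKf⟩ := htight η hη0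
  obtain ⟨T, hT⟩ := hΦ.elim_nhds_subcover'
    (fun θ _ => {θ' | ∀ s ∈ K, |f θ' s - f θ s| ≤ δ / 8})
    (fun θ _ => hKf θ (δ / 8) (by positivity))
  have hKind : Measurable (Kᶜ.indicator (1 : S → ℝ)) := measurable_one.indicator hK.compl
  -- The fraction of the sample outside `K` is itself controlled by the law of large numbers,
  -- applied to an indicator.
  have e1 := hz _ hKind ⟨1, fun s => by
    by_cases hs : s ∈ K <;> simp [hs]⟩ η hη0
  have e2 : ∀ᵐ ω ∂P, ∀ θ ∈ T, ∀ᶠ M in Filter.atTop,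
      |sampleAvg (f θ) (z M ω) - ∫ s, f θ s ∂μ| < δ / 8 :=
    (ae_ball_iff T.countable_toSet).2 fun θ _ => hz _ (hf θ) ⟨C, hC θ θ.2⟩ _ (by positivity)
  filter_upwards [e1, e2] with ω h1 h2
  rw [← Filter.eventually_all_finset] at h2
  filter_upwards [h1, h2, Filter.eventually_gt_atTop 0] with M h3 h4 hM θ hθ
  obtain ⟨θ', hθ'T, hθ'⟩ : ∃ θ' ∈ T, ∀ s ∈ K, |f θ s - f θ' s| ≤ δ / 8 := by
    simpa using hT hθ
  have hLM : 0 < L M := lt_of_lt_of_le hM (hL M)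
  rw [integral_indicator_one hK.compl] at h3
  have h5 := abs_sampleAvg_sub_le hLM (hC θ hθ) (hC θ' θ'.2) (by positivity) hθ' (z M ω)
  have h6 : |∫ s, f θ s ∂μ - ∫ s, f θ' s ∂μ| ≤ δ / 8 + 2 * C * μ.real Kᶜ := by
    rw [← integral_sub (integrable_of_abs_le (hf θ) (hC θ hθ))
      (integrable_of_abs_le (hf θ') (hC θ' θ'.2))]
    exact (abs_integral_le_integral_abs).trans
      (integral_abs_sub_le_of_near hK (hC θ hθ) (hC θ' θ'.2) (by positivity) hθ')
  have h7 := h4 θ' hθ'T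
  have h8 : sampleAvg (Kᶜ.indicator 1) (z M ω) ≤ 2 * η := by
    rw [abs_lt] at h3; linarith [h3.2]
  have h9 : C * sampleAvg (Kᶜ.indicator 1) (z M ω) ≤ C * (2 * η) :=
    mul_le_mul_of_nonneg_left h8 hC0
  have h10 : C * μ.real Kᶜ ≤ C * η := mul_le_mul_of_nonneg_left hKμ hC0
  rw [abs_lt] at h7 ⊢
  rw [abs_le] at h5 h6
  constructor <;> linarith [h5.1, h5.2, h6.1, h6.2, h7.1, h7.2]

/-- Joint continuity gives the equicontinuity on large sets that the uniform law needs. -/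
lemma exists_measurableSet_equicontinuous {S Θ : Type*} [MeasurableSpace S] [TopologicalSpace S]
    [BorelSpace S] [SecondCountableTopology S] [TopologicalSpace.IsCompletelyMetrizableSpace S]
    [TopologicalSpace Θ] (μ : Measure S) [IsProbabilityMeasure μ] {f : Θ → S → ℝ}
    (hf : Continuous fun p : Θ × S => f p.1 p.2) {η : ℝ} (hη : 0 < η) :
    ∃ K, MeasurableSet K ∧ μ.real Kᶜ ≤ η ∧
      ∀ θ, ∀ η' > 0, ∀ᶠ θ' in nhds θ, ∀ s ∈ K, |f θ' s - f θ s| ≤ η' := by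
  have htight := isTightMeasureSet_singleton (μ := μ)
  rw [isTightMeasureSet_iff_exists_isCompact_measure_compl_le] at htight
  obtain ⟨K, hK, hKμ⟩ := htight (ENNReal.ofReal η) (by simpa using hη)
  refine ⟨K, hK.measurableSet, ?_, fun θ η' hη' => ?_⟩
  · exact ENNReal.toReal_le_of_le_ofReal hη.le (hKμ μ rfl)
  · refine hK.eventually_forall_of_forall_eventually fun s _ => ?_
    have hc : Continuous fun p : Θ × S => |f p.1 p.2 - f θ p.2| :=
      (hf.sub (hf.comp (continuous_const.prodMk continuous_snd))).abs
    have := hc.continuousAt (x := (θ, s))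
    simp only [ContinuousAt, sub_self, abs_zero] at this
    filter_upwards [this.eventually_lt_const hη'] with p hp
    exact hp.le

/-! ### Raw, blocked and shuffled samples -/

section StrongLaw

variable {Ω S : Type*} [MeasurableSpace Ω] [MeasurableSpace S] {P : Measure Ω}
  {μ : Measure S}

lemma satisfiesLLN_of_pairwise_indepFun [IsProbabilityMeasure μ] {Z : ℕ → Ω → S}
    (hlaw : ∀ t, HasLaw (Z t) μ P)
    (hind : Pairwise fun s t => IndepFun (Z s) (Z t) P) {L : ℕ → ℕ} (hL : ∀ M, M ≤ L M) :
    SatisfiesLLN P μ (L := L) fun _ ω t => Z t ω := by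
  intro g hg ⟨C, hC⟩ δ hδ
  have hint : Integrable (g ∘ Z 0) P := by
    have h : Integrable g (P.map (Z 0)) := by
      rw [(hlaw 0).map_eq]; exact integrable_of_abs_le hg hC
    exact h.comp_aemeasurable (hlaw 0).aemeasurable
  have h1 := strong_law_ae_real (fun t => g ∘ Z t) hint
    (fun s t hst => (hind hst).comp hg hg)
    (fun t => IdentDistrib.comp ⟨(hlaw t).aemeasurable, (hlaw 0).aemeasurable,
      (hlaw t).map_eq.trans (hlaw 0).map_eq.symm⟩ hg)
  have h2 : ∫ ω, (g ∘ Z 0) ω ∂P = ∫ s, g s ∂μ := by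
    rw [← (hlaw 0).map_eq, integral_map (hlaw 0).aemeasurable hg.aestronglyMeasurable]
    rfl
  rw [h2] at h1
  filter_upwards [h1] with ω hω
  have h3 := hω.comp (Filter.tendsto_atTop_mono hL Filter.tendsto_id)
  filter_upwards [(Metric.tendsto_nhds.1 h3) δ hδ] with M hM
  rw [Real.dist_eq] at hM
  convert hM using 3
  rw [sampleAvg, one_div, inv_mul_eq_div, Function.comp_apply, Finset.sum_range]
  rfl

lemma hasLaw_pi_of_iIndepFun [IsProbabilityMeasure P] {Z : ℕ → Ω → S}
    (hlaw : ∀ t, HasLaw (Z t) μ P)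
    (hind : iIndepFun Z P) {N : ℕ} {g : Fin N → ℕ} (hg : Function.Injective g) :
    HasLaw (fun ω i => Z (g i) ω) (Measure.pi fun _ => μ) P := by
  refine ⟨aemeasurable_pi_lambda _ fun i => (hlaw _).aemeasurable, ?_⟩
  rw [(iIndepFun_iff_map_fun_eq_pi_map fun i => (hlaw (g i)).aemeasurable).1 (hind.precomp hg)]
  simp_rw [(hlaw _).map_eq]

lemma satisfiesLLN_block [IsProbabilityMeasure P] [IsProbabilityMeasure μ] {Z : ℕ → Ω → S}
    (hlaw : ∀ t, HasLaw (Z t) μ P) (hind : iIndepFun Z P)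
    (N : ℕ) : SatisfiesLLN P (Measure.pi fun _ : Fin N => μ) (L := fun M => M)
      fun _ ω j => block N (fun t => Z t ω) j := by
  refine satisfiesLLN_of_pairwise_indepFun (Z := fun j ω => block N (fun t => Z t ω) j)
    (fun j => hasLaw_pi_of_iIndepFun hlaw hind (g := fun i => j * N + i) ?_) ?_ fun M => le_rfl
  · intro a b h
    exact Fin.ext (by simpa using h)
  · intro j k hjk
    have hdisj : Disjoint (Finset.univ.image fun i : Fin N => j * N + i)
        (Finset.univ.image fun i : Fin N => k * N + i) := by
      rw [Finset.disjoint_left]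
      intro t h1 h2
      simp only [Finset.mem_image, Finset.mem_univ, true_and] at h1 h2
      obtain ⟨a, rfl⟩ := h1
      obtain ⟨b, hb⟩ := h2
      have hN : 0 < N := a.pos
      have h3 := congrArg (· / N) hb
      simp only [Nat.mul_comm _ N, Nat.mul_add_div hN, Nat.div_eq_of_lt a.2,
        Nat.div_eq_of_lt b.2, add_zero] at h3
      exact hjk h3.symm
    have h := hind.indepFun_finset₀ _ _ hdisj fun t => (hlaw t).aemeasurable
    have hm : ∀ j : ℕ, Measurable
        fun (v : (Finset.univ.image fun i : Fin N => j * N + (i : ℕ) : Finset ℕ) → S) (i : Fin N) =>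
          v ⟨j * N + i, Finset.mem_image_of_mem _ (Finset.mem_univ i)⟩ := fun j =>
      measurable_pi_lambda _ fun i => measurable_pi_apply _
    exact h.comp (hm j) (hm k)

lemma satisfiesLLN_shuffle [IsProbabilityMeasure P] {A B : Type*}
    [MeasurableSpace A] [MeasurableSpace B]
    {μ : Measure (A × B)} [IsProbabilityMeasure μ] {Z : ℕ → Ω → A × B}
    (hlaw : ∀ t, HasLaw (Z t) μ P) (hind : iIndepFun Z P) {L : ℕ → ℕ} (hL : ∀ M, M ≤ L M)
    {π : (M : ℕ) → Ω → Equiv.Perm (Fin (L M))}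
    (hπ : ∀ M, HasLaw (π M) (PMF.uniformOfFintype (Equiv.Perm (Fin (L M)))).toMeasure P)
    (hπind : ∀ M, IndepFun (π M) (fun ω t => Z t ω) P) :
    SatisfiesLLN P ((μ.map Prod.fst).prod (μ.map Prod.snd)) (L := L)
      fun M ω t => ((Z t ω).1, (Z (π M ω t) ω).2) := by
  intro g hg ⟨C, hC⟩ δ hδ
  refine ae_eventually_abs_shuffleAvg_sub_lt μ P hL hπ (Z := fun M ω t => Z t ω)
    (fun M => hasLaw_pi_of_iIndepFun hlaw hind Fin.val_injective) (fun M => ?_) hg hC hδ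
  have hm : Measurable fun (v : ℕ → A × B) (t : Fin (L M)) => v t :=
    measurable_pi_lambda _ fun i => measurable_pi_apply _
  exact (hπind M).comp measurable_id hm

end StrongLaw

end PolarMINE

namespace PolarMINE

/-! ### Entropy inequalities for finite alphabets -/

/-- Gibbs' inequality, from `log x ≤ x - 1` at `x = b i / a i`. Mass missing from `b` only helps. -/
lemma sum_negMulLog_le {α : Type*} [Fintype α] {a b : α → ℝ} (ha : ∀ i, 0 ≤ a i)
    (ha1 : ∑ i, a i = 1) (hb : ∀ i, 0 < b i) (hb1 : ∑ i, b i ≤ 1) :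
    ∑ i, Real.negMulLog (a i) ≤ ∑ i, a i * -Real.log (b i) := by
  have key : ∀ i, Real.negMulLog (a i) ≤ a i * -Real.log (b i) + (b i - a i) := by
    intro i
    rcases (ha i).eq_or_lt with h | h
    · simp [← h, (hb i).le]
    · have h1 := Real.log_le_sub_one_of_pos (div_pos (hb i) h)
      rw [Real.log_div (hb i).ne' h.ne'] at h1
      have h2 := mul_le_mul_of_nonneg_left h1 h.le
      rw [mul_sub, mul_sub, mul_div_cancel₀ _ h.ne', mul_one] at h2
      rw [Real.negMulLog]
      linarith
  have := Finset.sum_le_sum fun i (_ : i ∈ Finset.univ) => key i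
  rw [Finset.sum_add_distrib, Finset.sum_sub_distrib] at this
  linarith

lemma sum_fin_succ_arrow {α β : Type*} [Fintype α] [AddCommMonoid β] {L : ℕ}
    (f : (Fin (L + 1) → α) → β) : ∑ x, f x = ∑ a, ∑ x : Fin L → α, f (Fin.cons a x) := by
  rw [← (Fin.consEquiv fun _ => α).sum_comp, Fintype.sum_prod_type]
  rfl

lemma sum_prod_eq_one {α : Type*} [Fintype α] {L : ℕ} {p : Fin L → α → ℝ}
    (hp : ∀ t, ∑ a, p t a = 1) : ∑ x : Fin L → α, ∏ t, p t (x t) = 1 := by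
  induction L with
  | zero => simp
  | succ L ih =>
    simp only [sum_fin_succ_arrow, Fin.prod_univ_succ, Fin.cons_zero, Fin.cons_succ,
      ← Finset.mul_sum, ih fun t => hp t.succ, mul_one, hp]

lemma sum_negMulLog_prod {α : Type*} [Fintype α] {L : ℕ} {p : Fin L → α → ℝ}
    (hp : ∀ t, ∑ a, p t a = 1) :
    ∑ x : Fin L → α, Real.negMulLog (∏ t, p t (x t)) = ∑ t, ∑ a, Real.negMulLog (p t a) := by
  induction L with
  | zero => simp
  | succ L ih =>
    simp only [sum_fin_succ_arrow, Fin.prod_univ_succ, Fin.cons_zero, Fin.cons_succ,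
      Real.negMulLog_mul, Finset.sum_add_distrib, ← Finset.mul_sum, ← Finset.sum_mul,
      ih fun t => hp t.succ, sum_prod_eq_one fun t => hp t.succ, hp, one_mul, Fin.sum_univ_succ]

/-- A product of conditional probabilities, each of which depends on the past only, is a
probability. -/
lemma sum_prod_cond_eq_one {α : Type*} [Fintype α] [Nonempty α] {L : ℕ}
    {q : Fin L → (Fin L → α) → α → ℝ}
    (hdep : ∀ i u u', (∀ j < i, u j = u' j) → q i u = q i u') (hq : ∀ i u, ∑ a, q i u a = 1) :
    ∑ u : Fin L → α, ∏ i, q i u (u i) = 1 := by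
  induction L with
  | zero => simp
  | succ L ih =>
    simp only [sum_fin_succ_arrow, Fin.prod_univ_succ, Fin.cons_zero, Fin.cons_succ]
    have c : Fin (L + 1) → α := fun _ => Classical.arbitrary α
    -- The first factor has no past and comes out of the sum over the remaining letters; for a fixed
    -- first letter these again form a causal product, whose sum is `1` by induction.
    have h0 : ∀ a (u : Fin L → α), q 0 (Fin.cons a u) = q 0 c := fun a u =>
      hdep 0 _ _ fun j hj => absurd hj (Fin.not_lt_zero j)
    have h1 : ∀ a, ∑ u : Fin L → α, ∏ i, q (Fin.succ i) (Fin.cons a u) (u i) = 1 := fun a => by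
      refine ih (q := fun i u => q i.succ (Fin.cons a u)) (fun i u u' h => hdep _ _ _ fun j hj => ?_)
        fun i u => hq _ _
      induction j using Fin.cases with
      | zero => rfl
      | succ j => simpa using h j (by simpa using hj)
    simp only [h0, ← Finset.mul_sum, h1, mul_one, hq]

/-! ### Disintegration -/

section Disintegration

variable {Ω α β : Type*} [MeasurableSpace Ω] [MeasurableSpace α] [MeasurableSingletonClass α]
  [StandardBorelSpace α] [Nonempty α] [MeasurableSpace β]

lemma sum_condDistrib [Fintype α] (μ : Measure Ω) [IsFiniteMeasure μ] (U : Ω → α) (V : Ω → β)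
    (v : β) :
    ∑ a, (condDistrib U V μ v).real {a} = 1 := by
  rw [sum_measureReal_singleton]
  simp

lemma measurable_condDistrib_real (μ : Measure Ω) [IsFiniteMeasure μ] (U : Ω → α) (V : Ω → β)
    (a : α) : Measurable fun v => (condDistrib U V μ v).real {a} :=
  (Kernel.measurable_coe _ (measurableSet_singleton a)).ennreal_toReal

lemma integral_eq_integral_sum_condDistrib [Fintype α] (μ : Measure Ω) [IsProbabilityMeasure μ]
    {U : Ω → α}
    {V : Ω → β} (hU : Measurable U) (hV : Measurable V) {g : α → β → ℝ}
    (hg : ∀ a, Measurable (g a)) {C : ℝ} (hC : ∀ a v, |g a v| ≤ C) :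
    ∫ ω, g (U ω) (V ω) ∂μ =
      ∫ v, ∑ a, (condDistrib U V μ v).real {a} * g a v ∂(μ.map V) := by
  have : IsProbabilityMeasure (μ.map V) := Measure.isProbabilityMeasure_map hV.aemeasurable
  have hg' : Measurable fun p : β × α => g p.2 p.1 :=
    measurable_from_prod_countable_left fun a => hg a
  have h1 : ∫ ω, g (U ω) (V ω) ∂μ = ∫ p : β × α, g p.2 p.1 ∂(μ.map fun ω => (V ω, U ω)) :=
    (integral_map (hV.prodMk hU).aemeasurable hg'.aestronglyMeasurable).symm
  rw [h1, ← compProd_map_condDistrib hU.aemeasurable,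
    Measure.integral_compProd (integrable_of_abs_le hg' fun p => hC _ _)]
  refine integral_congr_ae (ae_of_all _ fun v => ?_)
  change ∫ a, g a v ∂(condDistrib U V μ v) = _
  rw [integral_fintype (Integrable.of_finite)]
  rfl

end Disintegration

/-! ### Posterior and entropy of memoryless blocks -/

section Block

variable {A B : Type*} [MeasurableSpace A] [StandardBorelSpace A] [Nonempty A]
  [MeasurableSpace B] (μ : Measure (A × B)) [IsProbabilityMeasure μ]

/-- The conditional probability of the first component given the second one. -/
noncomputable def posterior (a : A) (b : B) : ℝ := (condDistrib Prod.fst Prod.snd μ b).real {a}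

lemma posterior_nonneg (a : A) (b : B) : 0 ≤ posterior μ a b := measureReal_nonneg

lemma posterior_le_one (a : A) (b : B) : posterior μ a b ≤ 1 := measureReal_le_one

variable [MeasurableSingletonClass A]

@[fun_prop]
lemma measurable_posterior (a : A) : Measurable (posterior μ a) :=
  measurable_condDistrib_real _ _ _ a

variable [Fintype A]

lemma sum_posterior (b : B) : ∑ a, posterior μ a b = 1 := sum_condDistrib _ _ _ _

lemma integral_eq_integral_sum_posterior {g : A × B → ℝ} (hg : Measurable g) {C : ℝ}
    (hC : ∀ p, |g p| ≤ C) :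
    ∫ p, g p ∂μ = ∫ b, ∑ a, posterior μ a b * g (a, b) ∂(μ.map Prod.snd) :=
  integral_eq_integral_sum_condDistrib μ measurable_fst measurable_snd (g := fun a b => g (a, b))
    (fun _ => hg.comp measurable_prodMk_left) fun _ _ => hC _

/-- The disintegration of a memoryless block given the second components. -/
lemma integral_pi_eq_integral_sum_posterior {L : ℕ} {g : (Fin L → A × B) → ℝ} (hg : Measurable g)
    {C : ℝ} (hC : ∀ z, |g z| ≤ C) :
    ∫ z, g z ∂(Measure.pi fun _ => μ) =
      ∫ y, ∑ x : Fin L → A, (∏ t, posterior μ (x t) (y t)) * g (fun t => (x t, y t))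
        ∂(Measure.pi fun _ => μ.map Prod.snd) := by
  have : IsProbabilityMeasure (μ.map Prod.snd) :=
    Measure.isProbabilityMeasure_map measurable_snd.aemeasurable
  have hprod : ∀ {L : ℕ} (x : Fin L → A) (y : Fin L → B),
      |∏ t, posterior μ (x t) (y t)| ≤ 1 := fun x y => by
    rw [abs_of_nonneg (Finset.prod_nonneg fun t _ => posterior_nonneg _ _ _)]
    exact Finset.prod_le_one (fun t _ => posterior_nonneg _ _ _) fun t _ => posterior_le_one _ _ _
  have hsum : ∀ {L : ℕ} {g : (Fin L → A × B) → ℝ} {C : ℝ} (_ : ∀ z, |g z| ≤ C) (y : Fin L → B),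
      |∑ x : Fin L → A, (∏ t, posterior μ (x t) (y t)) * g (fun t => (x t, y t))| ≤
        ∑ x : Fin L → A, C := fun {L g C} hC y => by
    refine (Finset.abs_sum_le_sum_abs _ _).trans (Finset.sum_le_sum fun x _ => ?_)
    rw [abs_mul]
    exact (mul_le_of_le_one_left (abs_nonneg _) (hprod x y)).trans (hC _)
  have hmeas : ∀ {L : ℕ} {g : (Fin L → A × B) → ℝ} (_ : Measurable g), Measurable fun y : Fin L → B =>
      ∑ x : Fin L → A, (∏ t, posterior μ (x t) (y t)) * g (fun t => (x t, y t)) := fun hg => by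
    fun_prop
  induction L with
  | zero =>
    have h1 : ∀ z : Fin 0 → A × B, g z = g finZeroElim := fun z =>
      congrArg g (Subsingleton.elim _ _)
    simp [h1]
  | succ L ih =>
    rw [integral_pi_succ μ hg hC, integral_pi_succ _ (hmeas hg) (hsum hC)]
    have hgc : ∀ z, Measurable fun p : A × B => g (Fin.cons p z) := fun z =>
      hg.comp (measurable_cons.comp (measurable_id.prodMk measurable_const))
    have hG : Measurable fun z : Fin L → A × B => ∫ p, g (Fin.cons p z) ∂μ :=
      (StronglyMeasurable.integral_prod_left' (f := fun q : (A × B) × (Fin L → A × B) =>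
        g (Fin.cons q.1 q.2)) (hg.comp measurable_cons).stronglyMeasurable).measurable
    have hGC : ∀ z : Fin L → A × B, |∫ p, g (Fin.cons p z) ∂μ| ≤ C := fun z => by
      refine (norm_integral_le_of_norm_le_const (μ := μ) (f := fun p => g (Fin.cons p z))
        (ae_of_all _ fun p => hC _)).trans ?_
      simp
    rw [ih hG hGC]
    refine integral_congr_ae (ae_of_all _ fun y => ?_)
    have hcons : ∀ (a : A) (b : B) (x : Fin L → A),
        (fun t => ((Fin.cons a x : Fin (L + 1) → A) t, (Fin.cons b y : Fin (L + 1) → B) t)) =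
          (Fin.cons (a, b) (fun t => (x t, y t)) : Fin (L + 1) → A × B) := fun a b x => by
      funext t
      induction t using Fin.cases <;> rfl
    have hi : ∀ (x : Fin L → A) (a : A), Integrable (fun b => posterior μ a b *
        g (Fin.cons (a, b) fun t => (x t, y t))) (μ.map Prod.snd) := fun x a =>
      integrable_of_abs_le (C := C) ((measurable_posterior μ a).mul
        ((hgc _).comp measurable_prodMk_left)) fun b => by
        rw [abs_mul, abs_of_nonneg (posterior_nonneg _ _ _)]
        exact (mul_le_of_le_one_left (abs_nonneg _) (posterior_le_one _ _ _)).trans (hC _)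
    simp only [sum_fin_succ_arrow, Fin.prod_univ_succ, Fin.cons_zero, Fin.cons_succ, hcons]
    have e : ∀ (a : A) (b : B) (x : Fin L → A),
        posterior μ a b * (∏ t, posterior μ (x t) (y t)) *
          g (Fin.cons (a, b) fun t => (x t, y t)) =
        (∏ t, posterior μ (x t) (y t)) *
          (posterior μ a b * g (Fin.cons (a, b) fun t => (x t, y t))) := fun a b x => by ring
    simp only [e]
    rw [integral_finsetSum _ fun a _ => integrable_finsetSum _ fun x _ => (hi x a).const_mul _]
    simp_rw [integral_finsetSum _ fun x _ => (hi x _).const_mul _]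
    rw [Finset.sum_comm]
    refine Finset.sum_congr rfl fun x _ => ?_
    rw [integral_eq_integral_sum_posterior μ (hgc _) (fun p => hC _),
      integral_finsetSum _ fun a _ => hi x a, Finset.mul_sum]
    simp_rw [integral_const_mul]

/-- The entropy of the first component given the second one. -/
noncomputable def pairEntropy : ℝ :=
  ∫ b, ∑ a, Real.negMulLog (posterior μ a b) ∂(μ.map Prod.snd)

lemma measurable_sum_negMulLog_posterior :
    Measurable fun b => ∑ a, Real.negMulLog (posterior μ a b) :=
  Finset.measurable_sum _ fun a _ => Real.continuous_negMulLog.measurable.comp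
    (measurable_posterior μ a)

lemma abs_negMulLog_le_one {x : ℝ} (h0 : 0 ≤ x) (h1 : x ≤ 1) : |Real.negMulLog x| ≤ 1 := by
  rw [abs_of_nonneg (Real.negMulLog_nonneg h0 h1)]
  rcases h0.eq_or_lt with h | h
  · simp [← h]
  · have := Real.log_le_sub_one_of_pos (inv_pos.2 h)
    rw [Real.log_inv] at this
    rw [Real.negMulLog]
    have h2 := mul_le_mul_of_nonneg_left this h0
    rw [mul_sub, mul_inv_cancel₀ h.ne'] at h2
    linarith

lemma abs_sum_negMulLog_le {α : Type*} [Fintype α] {p : α → ℝ} (h0 : ∀ a, 0 ≤ p a)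
    (h1 : ∀ a, p a ≤ 1) : |∑ a, Real.negMulLog (p a)| ≤ Fintype.card α := by
  refine (Finset.abs_sum_le_sum_abs _ _).trans
    ((Finset.sum_le_sum fun a _ => abs_negMulLog_le_one (h0 a) (h1 a)).trans ?_)
  simp

/-- Among the conditional codes for a memoryless block none beats the entropy. -/
lemma mul_pairEntropy_le {L : ℕ} {Q : (Fin L → A) → (Fin L → B) → ℝ}
    (hQ : Measurable fun z : Fin L → A × B => Q (fun t => (z t).1) fun t => (z t).2)
    (hpos : ∀ x y, 0 < Q x y) (hsum : ∀ y, ∑ x, Q x y ≤ 1) {C : ℝ}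
    (hC : ∀ x y, |Real.log (Q x y)| ≤ C) :
    L * pairEntropy μ ≤
      ∫ z : Fin L → A × B, -Real.log (Q (fun t => (z t).1) fun t => (z t).2)
        ∂(Measure.pi fun _ => μ) := by
  have : IsProbabilityMeasure (μ.map Prod.snd) :=
    Measure.isProbabilityMeasure_map measurable_snd.aemeasurable
  have hlog : Measurable fun z : Fin L → A × B =>
      -Real.log (Q (fun t => (z t).1) fun t => (z t).2) := (Real.measurable_log.comp hQ).neg
  rw [integral_pi_eq_integral_sum_posterior μ hlog
    (C := C) fun z => by rw [abs_neg]; exact hC _ _]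
  have hint : Integrable (fun b => ∑ a, Real.negMulLog (posterior μ a b)) (μ.map Prod.snd) :=
    integrable_of_abs_le (measurable_sum_negMulLog_posterior μ) fun b =>
      abs_sum_negMulLog_le (fun a => posterior_nonneg μ a b) fun a => posterior_le_one μ a b
  -- The posterior of a block is the product of the letter posteriors, so its entropy is additive;
  -- what remains is Gibbs' inequality for each fixed `y`.
  have h1 : (L : ℝ) * pairEntropy μ = ∫ y : Fin L → B, ∑ x : Fin L → A,
      Real.negMulLog (∏ t, posterior μ (x t) (y t)) ∂(Measure.pi fun _ => μ.map Prod.snd) := by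
    simp_rw [sum_negMulLog_prod fun t => sum_posterior μ _]
    rw [integral_finsetSum _ fun t _ => (integrable_comp_eval (i := t) hint)]
    simp_rw [integral_comp_eval (μ := fun _ : Fin L => μ.map Prod.snd)
      (measurable_sum_negMulLog_posterior μ).aestronglyMeasurable]
    simp [pairEntropy]
  have hQ' : ∀ x, Measurable fun y : Fin L → B => Q x y := fun x => by
    have : Measurable fun (y : Fin L → B) t => (x t, y t) := by fun_prop
    exact hQ.comp this
  have hprod1 : ∀ (x : Fin L → A) (y : Fin L → B), 0 ≤ ∏ t, posterior μ (x t) (y t) := fun x y =>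
    Finset.prod_nonneg fun t _ => posterior_nonneg _ _ _
  have hprod2 : ∀ (x : Fin L → A) (y : Fin L → B), ∏ t, posterior μ (x t) (y t) ≤ 1 := fun x y =>
    Finset.prod_le_one (fun t _ => posterior_nonneg _ _ _) fun t _ => posterior_le_one _ _ _
  rw [h1]
  refine integral_mono ?_ ?_ fun y => ?_
  · refine integrable_of_abs_le (Finset.measurable_sum _ fun x _ =>
      Real.continuous_negMulLog.measurable.comp (by fun_prop)) fun y =>
      abs_sum_negMulLog_le (fun x => hprod1 x y) fun x => hprod2 x y
  · refine integrable_of_abs_le (C := ∑ x : Fin L → A, C) (Finset.measurable_sum _ fun x _ =>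
      Measurable.mul (by fun_prop) (Real.measurable_log.comp (hQ' x)).neg) fun y => ?_
    refine (Finset.abs_sum_le_sum_abs _ _).trans (Finset.sum_le_sum fun x _ => ?_)
    rw [abs_mul, abs_of_nonneg (hprod1 x y), abs_neg]
    exact (mul_le_of_le_one_left (abs_nonneg _) (hprod2 x y)).trans (hC x y)
  · exact sum_negMulLog_le (fun x => hprod1 x y)
      (sum_prod_eq_one fun t => sum_posterior μ (y t)) (fun x => hpos x y) (hsum y)

end Block

end PolarMINE

noncomputable section

namespace PolarMINE

/-! ### The entropies of the synthetic channels -/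

section BitEntropy

variable {d n : ℕ} (W : Kernel (ZMod 2) (Fin d → ℝ)) [IsMarkovKernel W]

/-- The polar transform of the input bits of a block. -/
def blockBits {d n : ℕ} (z : Fin (2 ^ n) → ZMod 2 × (Fin d → ℝ)) : Fin (2 ^ n) → ZMod 2 :=
  polarTransform n fun k => (z k).1

/-- What the decoder of the `i`-th bit knows: the past bits and the channel outputs. -/
def blockPast {d n : ℕ} (i : Fin (2 ^ n)) (z : Fin (2 ^ n) → ZMod 2 × (Fin d → ℝ)) :
    (Set.Iio i → ZMod 2) × (Fin (2 ^ n) → Fin d → ℝ) :=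
  (fun j => blockBits z j, fun k => (z k).2)

lemma measurable_blockBits :
    Measurable (blockBits : (Fin (2 ^ n) → ZMod 2 × (Fin d → ℝ)) → Fin (2 ^ n) → ZMod 2) := by
  have h1 : Measurable (polarTransform n) := measurable_of_finite _
  have h2 : Measurable fun (z : Fin (2 ^ n) → ZMod 2 × (Fin d → ℝ)) k => (z k).1 := by fun_prop
  exact h1.comp h2

lemma measurable_blockPast (i : Fin (2 ^ n)) :
    Measurable (blockPast i : (Fin (2 ^ n) → ZMod 2 × (Fin d → ℝ)) → _) := by
  refine Measurable.prodMk (measurable_pi_lambda _ fun j => ?_) (by fun_prop)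
  exact (measurable_pi_apply _).comp measurable_blockBits

/-- The true conditional probability of the `i`-th bit given the past. -/
def bitPosterior (i : Fin (2 ^ n)) (v : (Set.Iio i → ZMod 2) × (Fin (2 ^ n) → Fin d → ℝ))
    (a : ZMod 2) : ℝ :=
  (condDistrib (fun z => blockBits z i) (blockPast i) (blockLaw W n) v).real {a}

lemma bitPosterior_nonneg (i : Fin (2 ^ n)) (v) (a : ZMod 2) : 0 ≤ bitPosterior W i v a :=
  measureReal_nonneg

lemma bitPosterior_le_one (i : Fin (2 ^ n)) (v) (a : ZMod 2) : bitPosterior W i v a ≤ 1 :=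
  measureReal_le_one

lemma sum_bitPosterior (i : Fin (2 ^ n)) (v) : ∑ a, bitPosterior W i v a = 1 :=
  sum_condDistrib _ _ _ _

lemma measurable_bitPosterior (i : Fin (2 ^ n)) (a : ZMod 2) :
    Measurable fun v => bitPosterior W i v a :=
  measurable_condDistrib_real _ _ _ a

lemma bitEntropy_eq (i : Fin (2 ^ n)) : bitEntropy W n i =
    ∫ v, ∑ a, Real.negMulLog (bitPosterior W i v a) ∂((blockLaw W n).map (blockPast i)) := rfl

lemma integral_bit_eq (i : Fin (2 ^ n))
    {g : ZMod 2 → (Set.Iio i → ZMod 2) × (Fin (2 ^ n) → Fin d → ℝ) → ℝ}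
    (hg : ∀ a, Measurable (g a)) {C : ℝ} (hC : ∀ a v, |g a v| ≤ C) :
    ∫ z, g (blockBits z i) (blockPast i z) ∂(blockLaw W n) =
      ∫ v, ∑ a, bitPosterior W i v a * g a v ∂((blockLaw W n).map (blockPast i)) :=
  integral_eq_integral_sum_condDistrib _ ((measurable_pi_apply i).comp measurable_blockBits)
    (measurable_blockPast i) hg hC

lemma integrable_sum_bitPosterior_mul (i : Fin (2 ^ n))
    {g : ZMod 2 → (Set.Iio i → ZMod 2) × (Fin (2 ^ n) → Fin d → ℝ) → ℝ}
    (hg : ∀ a, Measurable (g a)) {C : ℝ} (hC : ∀ a v, |g a v| ≤ C) :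
    Integrable (fun v => ∑ a, bitPosterior W i v a * g a v)
      ((blockLaw W n).map (blockPast i)) := by
  have : IsProbabilityMeasure ((blockLaw W n).map (blockPast i)) :=
    Measure.isProbabilityMeasure_map (measurable_blockPast i).aemeasurable
  refine integrable_of_abs_le (C := ∑ _a : ZMod 2, C) (Finset.measurable_sum _ fun a _ =>
    (measurable_bitPosterior W i a).mul (hg a)) fun v => ?_
  refine (Finset.abs_sum_le_sum_abs _ _).trans (Finset.sum_le_sum fun a _ => ?_)
  rw [abs_mul, abs_of_nonneg (bitPosterior_nonneg W i v a)]
  exact (mul_le_of_le_one_left (abs_nonneg _) (bitPosterior_le_one W i v a)).trans (hC a v)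

lemma integrable_sum_negMulLog_bitPosterior (i : Fin (2 ^ n)) :
    Integrable (fun v => ∑ a, Real.negMulLog (bitPosterior W i v a))
      ((blockLaw W n).map (blockPast i)) := by
  have : IsProbabilityMeasure ((blockLaw W n).map (blockPast i)) :=
    Measure.isProbabilityMeasure_map (measurable_blockPast i).aemeasurable
  exact integrable_of_abs_le (Finset.measurable_sum _ fun a _ =>
    Real.continuous_negMulLog.measurable.comp (measurable_bitPosterior W i a)) fun v =>
    abs_sum_negMulLog_le (bitPosterior_nonneg W i v) (bitPosterior_le_one W i v)

/-- The cross entropy of the `i`-th bit and the decoder with the channel embedding `e`. -/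
def bitCrossEntropy (e : (Fin d → ℝ) → ℝ) (i : Fin (2 ^ n)) : ℝ :=
  ∫ z, -Real.log (scProb n (fun t => e (z t).2) (blockBits z) i) ∂(blockLaw W n)

lemma measurable_log_scProb {e : (Fin d → ℝ) → ℝ} (he : Measurable e) (i : Fin (2 ^ n)) :
    Measurable fun z : Fin (2 ^ n) → ZMod 2 × (Fin d → ℝ) =>
      Real.log (scProb n (fun t => e (z t).2) (blockBits z) i) := by
  have h1 : Measurable fun p : (Fin (2 ^ n) → ℝ) × (Fin (2 ^ n) → ZMod 2) =>
      Real.log (scProb n p.1 p.2 i) :=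
    measurable_from_prod_countable_left fun u => (continuous_log_scProb u i).measurable
  have h2 : Measurable fun (z : Fin (2 ^ n) → ZMod 2 × (Fin d → ℝ)) t => e (z t).2 := by fun_prop
  exact h1.comp (h2.prodMk measurable_blockBits)

/-- Gibbs' inequality given the past, applicable because the decoder is causal
(`scEmbedding_congr`). -/
lemma bitEntropy_le_bitCrossEntropy {e : (Fin d → ℝ) → ℝ} (he : Measurable e) {B : ℝ}
    (hB : ∀ y, |e y| ≤ B) (i : Fin (2 ^ n)) : bitEntropy W n i ≤ bitCrossEntropy W e i := by
  classical
  -- The padding value `0` for the bits from `i` on is immaterial, since the decoder does not read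
  -- them.
  let ext : (Set.Iio i → ZMod 2) → Fin (2 ^ n) → ZMod 2 := fun h j =>
    if hj : j < i then h ⟨j, hj⟩ else 0
  let g : ZMod 2 → (Set.Iio i → ZMod 2) × (Fin (2 ^ n) → Fin d → ℝ) → ℝ := fun a v =>
    -Real.log (bitProb (scEmbedding n (fun t => e (v.2 t)) (ext v.1) i) a)
  have hg : ∀ a, Measurable (g a) := fun a => by
    refine measurable_from_prod_countable_right fun h => ?_
    have h1 : Measurable fun (y : Fin (2 ^ n) → Fin d → ℝ) t => e (y t) := by fun_prop
    have h2 : Continuous fun e : Fin (2 ^ n) → ℝ =>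
        -Real.log (bitProb (scEmbedding n e (ext h) i) a) :=
      (((continuous_bitProb a).comp (continuous_scEmbedding (ext h) i)).log
        fun _ => (bitProb_pos _ _).ne').neg
    exact h2.measurable.comp h1
  have hC : ∀ a v, |g a v| ≤ 2 ^ n * B + Real.log 2 := fun a v => by
    rw [abs_neg]
    exact (abs_log_bitProb_le _ _).trans (by gcongr; exact abs_scEmbedding_le (fun t => hB _) _ i)
  have h1 : bitCrossEntropy W e i =
      ∫ z, g (blockBits z i) (blockPast i z) ∂(blockLaw W n) := by
    refine integral_congr_ae (ae_of_all _ fun z => ?_)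
    change -Real.log (bitProb (scEmbedding n (fun t => e (z t).2) (blockBits z) i) (blockBits z i)) =
      -Real.log (bitProb (scEmbedding n (fun t => e (z t).2) _ i) (blockBits z i))
    rw [scEmbedding_congr _ i fun j hj => ?_]
    simp [ext, blockPast, hj]
  rw [h1, integral_bit_eq W i hg hC, bitEntropy_eq]
  refine integral_mono (integrable_sum_negMulLog_bitPosterior W i)
    (integrable_sum_bitPosterior_mul W i hg hC) fun v => ?_
  exact sum_negMulLog_le (bitPosterior_nonneg W i v) (sum_bitPosterior W i v)
    (fun a => bitProb_pos _ a) (sum_bitProb _).le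

/-- The posterior of the `i`-th bit, mixed with the uniform distribution. -/
def mixedPosterior (δ : ℝ) (i : Fin (2 ^ n))
    (v : (Set.Iio i → ZMod 2) × (Fin (2 ^ n) → Fin d → ℝ)) (a : ZMod 2) : ℝ :=
  (1 - δ) * bitPosterior W i v a + δ / 2

variable {W} in
lemma mixedPosterior_ge {δ : ℝ} (h1 : δ < 1) (i : Fin (2 ^ n)) (v) (a : ZMod 2) :
    δ / 2 ≤ mixedPosterior W δ i v a :=
  le_add_of_nonneg_left (mul_nonneg (by linarith) (bitPosterior_nonneg W i v a))

lemma sum_mixedPosterior (δ : ℝ) (i : Fin (2 ^ n)) (v) : ∑ a, mixedPosterior W δ i v a = 1 := by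
  simp only [mixedPosterior, Finset.sum_add_distrib, ← Finset.mul_sum, sum_bitPosterior]
  simp [ZMod.card]
  ring

variable {W} in
lemma abs_log_mixedPosterior_le {δ : ℝ} (h0 : 0 < δ) (h1 : δ < 1) (i : Fin (2 ^ n)) (v)
    (a : ZMod 2) : |Real.log (mixedPosterior W δ i v a)| ≤ -Real.log (δ / 2) := by
  have h2 := mixedPosterior_ge (W := W) h1 i v a
  have h3 : mixedPosterior W δ i v a ≤ 1 := by
    rw [← sum_mixedPosterior W δ i v]
    exact Finset.single_le_sum (fun b _ => (by positivity : 0 ≤ δ / 2).trans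
      (mixedPosterior_ge h1 i v b)) (Finset.mem_univ a)
  have h4 : 0 < mixedPosterior W δ i v a := lt_of_lt_of_le (by positivity) h2
  rw [abs_of_nonpos (Real.log_nonpos h4.le h3), neg_le_neg_iff]
  exact Real.log_le_log (by positivity) h2

lemma measurable_mixedPosterior (δ : ℝ) (i : Fin (2 ^ n)) (a : ZMod 2) :
    Measurable fun v => mixedPosterior W δ i v a :=
  ((measurable_bitPosterior W i a).const_mul _).add_const _

lemma measurable_mixedPosterior_block (δ : ℝ) (i : Fin (2 ^ n)) :
    Measurable fun z => mixedPosterior W δ i (blockPast i z) (blockBits z i) := by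
  have h1 : Measurable fun p : ((Set.Iio i → ZMod 2) × (Fin (2 ^ n) → Fin d → ℝ)) × ZMod 2 =>
      mixedPosterior W δ i p.1 p.2 :=
    measurable_from_prod_countable_left fun a => measurable_mixedPosterior W δ i a
  have h2 : Measurable fun z : Fin (2 ^ n) → ZMod 2 × (Fin d → ℝ) => blockBits z i :=
    (measurable_pi_apply i).comp measurable_blockBits
  have h3 := h1.comp ((measurable_blockPast i).prodMk h2)
  exact h3

/-- The true posterior may vanish, which would make its logarithm unbounded. The mixture is at least
`δ / 2`, and as it also dominates `(1 - δ)` times the posterior, it costs at most `-log (1 - δ)`. -/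
lemma integral_neg_log_mixedPosterior_le {δ : ℝ} (h0 : 0 < δ) (h1 : δ < 1) (i : Fin (2 ^ n)) :
    ∫ z, -Real.log (mixedPosterior W δ i (blockPast i z) (blockBits z i)) ∂(blockLaw W n) ≤
      bitEntropy W n i - Real.log (1 - δ) := by
  have : IsProbabilityMeasure ((blockLaw W n).map (blockPast i)) :=
    Measure.isProbabilityMeasure_map (measurable_blockPast i).aemeasurable
  have hg : ∀ a, Measurable fun v => -Real.log (mixedPosterior W δ i v a) := fun a =>
    (Real.measurable_log.comp (measurable_mixedPosterior W δ i a)).neg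
  have hC : ∀ a v, |-Real.log (mixedPosterior W δ i v a)| ≤ -Real.log (δ / 2) := fun a v => by
    rw [abs_neg]
    exact abs_log_mixedPosterior_le h0 h1 i v a
  have e1 : bitEntropy W n i - Real.log (1 - δ) =
      ∫ v, (∑ a, Real.negMulLog (bitPosterior W i v a) - Real.log (1 - δ))
        ∂((blockLaw W n).map (blockPast i)) := by
    rw [integral_sub (integrable_sum_negMulLog_bitPosterior W i) (integrable_const _),
      bitEntropy_eq]
    simp
  rw [integral_bit_eq W i (g := fun a v => -Real.log (mixedPosterior W δ i v a)) hg hC, e1]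
  refine integral_mono (integrable_sum_bitPosterior_mul W i hg hC)
    ((integrable_sum_negMulLog_bitPosterior W i).sub (integrable_const _)) fun v => ?_
  have key : ∀ a, bitPosterior W i v a * -Real.log (mixedPosterior W δ i v a) ≤
      Real.negMulLog (bitPosterior W i v a) + bitPosterior W i v a * -Real.log (1 - δ) := by
    intro a
    rcases (bitPosterior_nonneg W i v a).eq_or_lt with h | h
    · simp [← h]
    · have h2 : Real.log ((1 - δ) * bitPosterior W i v a) ≤
          Real.log (mixedPosterior W δ i v a) :=
        Real.log_le_log (mul_pos (by linarith) h) (le_add_of_nonneg_right (by positivity))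
      rw [Real.log_mul (by linarith) h.ne'] at h2
      rw [Real.negMulLog]
      nlinarith
  refine (Finset.sum_le_sum fun a _ => key a).trans (le_of_eq ?_)
  rw [Finset.sum_add_distrib, ← Finset.sum_mul, sum_bitPosterior]
  ring

/-- The chain rule, as the inequality that is used: the bit entropies sum to at least the entropy
of the inputs given the outputs. -/
lemma mul_pairEntropy_le_sum_bitEntropy (n : ℕ) :
    (2 ^ n : ℝ) * pairEntropy (pairLaw W) ≤ ∑ i, bitEntropy W n i := by
  classical
  refine le_of_forall_pos_le_add fun ε hε => ?_
  -- Chosen so that the `2ⁿ` mixing costs `-log (1 - δ)` add up to exactly `ε`.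
  set δ := 1 - Real.exp (-(ε / 2 ^ n)) with hδ
  have hδ1 : δ < 1 := by rw [hδ]; linarith [Real.exp_pos (-(ε / 2 ^ n))]
  have hδ0 : 0 < δ := by
    have : Real.exp (-(ε / 2 ^ n)) < 1 := Real.exp_lt_one_iff.2 (by
      rw [neg_lt_zero]; positivity)
    linarith
  have hlog : Real.log (1 - δ) = -(ε / 2 ^ n) := by rw [hδ, sub_sub_cancel, Real.log_exp]
  let q : Fin (2 ^ n) → (Fin (2 ^ n) → Fin d → ℝ) → (Fin (2 ^ n) → ZMod 2) → ZMod 2 → ℝ :=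
    fun i y u a => mixedPosterior W δ i (fun j => u j, y) a
  have hq0 : ∀ i y u a, 0 < q i y u a := fun i y u a =>
    lt_of_lt_of_le (by positivity) (mixedPosterior_ge hδ1 _ _ _)
  have hlogQ : ∀ x y, Real.log (∏ i, q i y (polarTransform n x) (polarTransform n x i)) =
      ∑ i, Real.log (q i y (polarTransform n x) (polarTransform n x i)) := fun x y =>
    Real.log_prod fun i _ => (hq0 _ _ _ _).ne'
  -- The product of the mixed bit posteriors is a causal law of `u`, hence, the polar transform
  -- being bijective, a conditional code for `x`. No such code beats the entropy of the block.
  have h1 := mul_pairEntropy_le (pairLaw W) (L := 2 ^ n)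
    (Q := fun x y => ∏ i, q i y (polarTransform n x) (polarTransform n x i))
    (Finset.measurable_prod _ fun i _ => measurable_mixedPosterior_block W δ i)
    (fun x y => Finset.prod_pos fun i _ => hq0 _ _ _ _)
    (fun y => by
      have hb : Function.Bijective (polarTransform n) :=
        Finite.injective_iff_bijective.1 (polarTransform_injective n)
      rw [hb.sum_comp fun u => ∏ i, q i y u (u i)]
      refine (sum_prod_cond_eq_one (q := fun i u => q i y u) (fun i u u' h => ?_)
        fun i u => sum_mixedPosterior W δ _ _).le
      have : (fun j : Set.Iio i => u j) = fun j : Set.Iio i => u' j :=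
        funext fun j => h j j.2
      simp only [q, this])
    (C := ∑ _i : Fin (2 ^ n), -Real.log (δ / 2)) (fun x y => by
      rw [hlogQ]
      exact (Finset.abs_sum_le_sum_abs _ _).trans (Finset.sum_le_sum fun i _ =>
        abs_log_mixedPosterior_le hδ0 hδ1 i _ _))
  push_cast at h1
  refine h1.trans ?_
  simp only [hlogQ, ← Finset.sum_neg_distrib]
  rw [integral_finsetSum _ fun i _ => ?_]
  · calc _ ≤ ∑ i, (bitEntropy W n i - Real.log (1 - δ)) :=
          Finset.sum_le_sum fun i _ => integral_neg_log_mixedPosterior_le W hδ0 hδ1 i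
      _ = ∑ i, bitEntropy W n i + ε := by
          rw [Finset.sum_sub_distrib, hlog]
          simp
          field_simp
  · refine integrable_of_abs_le (C := -Real.log (δ / 2)) (Real.measurable_log.comp
      (measurable_mixedPosterior_block W δ i)).neg fun z => ?_
    rw [abs_neg]
    exact abs_log_mixedPosterior_le hδ0 hδ1 i _ _

/-- The cross entropy of one input and its probability under the embedding `e`. -/
def pairCrossEntropy (e : (Fin d → ℝ) → ℝ) : ℝ :=
  ∫ p, -Real.log (bitProb (e p.2) p.1) ∂(pairLaw W)

lemma measurable_log_bitProb {e : (Fin d → ℝ) → ℝ} (he : Measurable e) :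
    Measurable fun p : ZMod 2 × (Fin d → ℝ) => Real.log (bitProb (e p.2) p.1) :=
  measurable_from_prod_countable_right fun u =>
    (((continuous_bitProb u).log fun _ => (bitProb_pos _ _).ne').measurable.comp he)

/-- The expectation of `sum_log_scProb`. It holds with equality for every embedding, so no error is
amplified by the recursion. -/
lemma sum_bitCrossEntropy {e : (Fin d → ℝ) → ℝ} (he : Measurable e) {B : ℝ}
    (hB : ∀ y, |e y| ≤ B) (n : ℕ) :
    ∑ i, bitCrossEntropy W (n := n) e i = 2 ^ n * pairCrossEntropy W e := by
  unfold bitCrossEntropy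
  rw [← integral_finsetSum _ fun i _ => ?_]
  · have h1 : ∀ z : Fin (2 ^ n) → ZMod 2 × (Fin d → ℝ),
        ∑ i, -Real.log (scProb n (fun t => e (z t).2) (blockBits z) i) =
          ∑ t, -Real.log (bitProb (e (z t).2) (z t).1) := fun z => by
      rw [Finset.sum_neg_distrib, Finset.sum_neg_distrib, blockBits,
        sum_log_scProb (fun t => e (z t).2) fun t => (z t).1]
    have h2 : Integrable (fun p => -Real.log (bitProb (e p.2) p.1)) (pairLaw W) :=
      integrable_of_abs_le (C := B + Real.log 2) (measurable_log_bitProb he).neg fun p => by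
        rw [abs_neg]
        exact (abs_log_bitProb_le _ _).trans (by gcongr; exact hB _)
    simp_rw [h1]
    unfold blockLaw
    rw [integral_finsetSum _ fun t _ => integrable_comp_eval (i := t) h2]
    simp_rw [integral_comp_eval (μ := fun _ : Fin (2 ^ n) => pairLaw W) h2.aestronglyMeasurable]
    simp [pairCrossEntropy]
  · refine integrable_of_abs_le (C := 2 ^ n * B + Real.log 2) (measurable_log_scProb he i).neg
      fun z => ?_
    rw [abs_neg]
    exact abs_log_scProb_le (fun t => hB _) _ _

/-- The excess of the cross entropy of a bit is at most the total excess on the block. -/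
lemma abs_bitCrossEntropy_sub_le {e : (Fin d → ℝ) → ℝ} (he : Measurable e) {B : ℝ}
    (hB : ∀ y, |e y| ≤ B) (i : Fin (2 ^ n)) :
    |bitCrossEntropy W e i - bitEntropy W n i| ≤
      2 ^ n * (pairCrossEntropy W e - pairEntropy (pairLaw W)) := by
  have h1 : ∀ i : Fin (2 ^ n), 0 ≤ bitCrossEntropy W e i - bitEntropy W n i := fun i =>
    sub_nonneg.2 (bitEntropy_le_bitCrossEntropy W he hB i)
  rw [abs_of_nonneg (h1 i)]
  refine (Finset.single_le_sum (fun i _ => h1 i) (Finset.mem_univ i)).trans ?_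
  rw [Finset.sum_sub_distrib, sum_bitCrossEntropy W he hB]
  linarith [mul_pairEntropy_le_sum_bitEntropy W n]

end BitEntropy

end PolarMINE

end

noncomputable section

namespace PolarMINE

/-! ### The Donsker-Varadhan functional -/

section DonskerVaradhan

variable {d : ℕ} (W : Kernel (ZMod 2) (Fin d → ℝ)) [IsMarkovKernel W]

/-- The law `P_X ⊗ P_Y` of an independent pair with the marginals of the channel. -/
def marginalLaw : Measure (ZMod 2 × (Fin d → ℝ)) :=
  ((pairLaw W).map Prod.fst).prod ((pairLaw W).map Prod.snd)

instance : IsProbabilityMeasure ((pairLaw W).map Prod.fst) :=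
  Measure.isProbabilityMeasure_map measurable_fst.aemeasurable

instance : IsProbabilityMeasure ((pairLaw W).map Prod.snd) :=
  Measure.isProbabilityMeasure_map measurable_snd.aemeasurable

instance : IsProbabilityMeasure (marginalLaw W) := by
  unfold marginalLaw; infer_instance

lemma integral_marginalLaw {F : ZMod 2 × (Fin d → ℝ) → ℝ} (hF : Measurable F) {C : ℝ}
    (hC : ∀ p, |F p| ≤ C) :
    ∫ p, F p ∂(marginalLaw W) = 1 / 2 * ∫ y, ∑ x, F (x, y) ∂((pairLaw W).map Prod.snd) := by
  have h1 : (pairLaw W).map Prod.fst = (PMF.uniformOfFintype (ZMod 2)).toMeasure :=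
    Measure.fst_compProd _ _
  rw [marginalLaw, integral_prod_symm _ (integrable_of_abs_le hF hC), h1, ← integral_const_mul]
  refine integral_congr_ae (ae_of_all _ fun y => ?_)
  simp only [PMF.integral_eq_sum, PMF.uniformOfFintype_apply, ZMod.card, smul_eq_mul,
    ← Finset.mul_sum]
  norm_num

/-- The population version of the objective. -/
def dvFunctional (T : ZMod 2 × (Fin d → ℝ) → ℝ) : ℝ :=
  ∫ p, T p ∂(pairLaw W) - Real.log (∫ p, Real.exp (T p) ∂(marginalLaw W))

/-- The sigmoid of a difference of two scores is their softmax. -/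
lemma log_bitProb_sub (T : ZMod 2 → ℝ) (x : ZMod 2) :
    Real.log (bitProb (T 1 - T 0) x) = T x - Real.log (∑ a, Real.exp (T a)) := by
  have hsum : ∑ a, Real.exp (T a) = Real.exp (T 0) + Real.exp (T 1) :=
    Fin.sum_univ_two fun a : ZMod 2 => Real.exp (T a)
  have h0 := Real.exp_pos (T 0)
  have h1 := Real.exp_pos (T 1)
  have hs : Real.sigmoid (T 1 - T 0) = Real.exp (T 1) / (Real.exp (T 0) + Real.exp (T 1)) := by
    rw [Real.sigmoid_def, neg_sub, Real.exp_sub]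
    field_simp
    ring
  have hx : bitProb (T 1 - T 0) x = Real.exp (T x) / (Real.exp (T 0) + Real.exp (T 1)) := by
    have : x = 0 ∨ x = 1 := by revert x; decide
    rcases this with rfl | rfl
    · rw [bitProb, if_neg (by decide), hs]
      field_simp
      ring
    · rw [bitProb, if_pos rfl, hs]
  rw [hx, hsum, Real.log_div (Real.exp_pos _).ne' (by positivity), Real.log_exp]

/-- Jensen's inequality: the cross entropy of the embedding of `T` is controlled by the
Donsker-Varadhan functional. -/
lemma pairCrossEntropy_le {T : ZMod 2 × (Fin d → ℝ) → ℝ} (hT : Measurable T) {C : ℝ}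
    (hC : ∀ p, |T p| ≤ C) :
    pairCrossEntropy W (fun y => T (1, y) - T (0, y)) ≤ Real.log 2 - dvFunctional W T := by
  set S : (Fin d → ℝ) → ℝ := fun y => ∑ a, Real.exp (T (a, y)) with hS
  have hSm : Measurable S := by fun_prop
  have hexp : ∀ p, |Real.exp (T p)| ≤ Real.exp C := fun p => by
    rw [abs_of_pos (Real.exp_pos _)]
    exact Real.exp_le_exp.2 ((le_abs_self _).trans (hC p))
  have hSpos : ∀ y, 0 < S y := fun y => Finset.sum_pos (fun a _ => Real.exp_pos _) ⟨0, by simp⟩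
  have hSC : ∀ y, |S y| ≤ ∑ _a : ZMod 2, Real.exp C := fun y =>
    (Finset.abs_sum_le_sum_abs _ _).trans (Finset.sum_le_sum fun a _ => hexp _)
  set c := ∫ y, S y ∂((pairLaw W).map Prod.snd) with hc
  have hSi : Integrable S ((pairLaw W).map Prod.snd) := integrable_of_abs_le hSm hSC
  have hcpos : 0 < c := by
    rw [hc, integral_pos_iff_support_of_nonneg (fun y => (hSpos y).le) hSi]
    have : Function.support S = Set.univ := Set.eq_univ_of_forall fun y => (hSpos y).ne'
    rw [this]
    simp
  have hm : ∫ p, Real.exp (T p) ∂(marginalLaw W) = 1 / 2 * c :=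
    integral_marginalLaw W (by fun_prop) hexp
  have hTi : Integrable T (pairLaw W) := integrable_of_abs_le hT hC
  have hS2 : Integrable (fun p : ZMod 2 × (Fin d → ℝ) => S p.2) (pairLaw W) :=
    integrable_of_abs_le (hSm.comp measurable_snd) fun p => hSC _
  have hS2c : ∫ p, S p.2 ∂(pairLaw W) = c := by
    rw [hc, integral_map measurable_snd.aemeasurable hSm.aestronglyMeasurable]
  have hbound : ∀ p : ZMod 2 × (Fin d → ℝ),
      |Real.log (bitProb (T (1, p.2) - T (0, p.2)) p.1)| ≤ 2 * C + Real.log 2 :=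
    fun p => (abs_log_bitProb_le _ _).trans (by
      gcongr
      exact (abs_sub _ _).trans (by linarith [hC (1, p.2), hC (0, p.2)]))
  have hlogm : Measurable fun p : ZMod 2 × (Fin d → ℝ) =>
      Real.log (bitProb (T (1, p.2) - T (0, p.2)) p.1) :=
    measurable_log_bitProb (e := fun y => T (1, y) - T (0, y)) (by fun_prop)
  -- Jensen's inequality in tangent form, `log S ≤ log c + S / c - 1` with `c` the mean of `S`. The
  -- factor `1 / 2` of the uniform input in `hm` produces the `log 2`.
  have hle : pairCrossEntropy W (fun y => T (1, y) - T (0, y)) ≤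
      ∫ p, (-T p + (Real.log c + (S p.2 / c - 1))) ∂(pairLaw W) := by
    refine integral_mono (integrable_of_abs_le hlogm hbound).neg
      (hTi.neg.add ((integrable_const _).add ((hS2.div_const c).sub (integrable_const _))))
      fun p => ?_
    have h1 := log_bitProb_sub (fun a => T (a, p.2)) p.1
    have h2 := Real.log_le_sub_one_of_pos (div_pos (hSpos p.2) hcpos)
    rw [Real.log_div (hSpos _).ne' hcpos.ne'] at h2
    change -Real.log _ ≤ -T p + (Real.log c + (S p.2 / c - 1))
    rw [h1]
    change -(T (p.1, p.2) - Real.log (S p.2)) ≤ _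
    simp only [Prod.mk.eta]
    linarith
  refine hle.trans (le_of_eq ?_)
  have i1 : Integrable (fun p => -T p) (pairLaw W) := hTi.neg
  have i2 : Integrable (fun p : ZMod 2 × (Fin d → ℝ) => S p.2 / c - 1) (pairLaw W) :=
    (hS2.div_const c).sub (integrable_const _)
  have i3 : Integrable (fun p : ZMod 2 × (Fin d → ℝ) => Real.log c + (S p.2 / c - 1))
      (pairLaw W) := (integrable_const _).add i2
  rw [integral_add i1 i3, integral_add (integrable_const _) i2,
    integral_sub (hS2.div_const c) (integrable_const _), integral_div, hS2c, integral_neg,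
    div_self hcpos.ne', dvFunctional, hm, Real.log_mul (by norm_num) hcpos.ne', one_div,
    Real.log_inv]
  simp
  ring

/-- Given `y`, the posterior weight of an input is at most `1` against the weight `1 / 2` under the
product law. Approximation under the product of the marginals thus carries over to the joint law. -/
lemma integral_pairLaw_le {F : ZMod 2 × (Fin d → ℝ) → ℝ} (hF : Measurable F) (h0 : ∀ p, 0 ≤ F p)
    {C : ℝ} (hC : ∀ p, |F p| ≤ C) :
    ∫ p, F p ∂(pairLaw W) ≤ 2 * ∫ p, F p ∂(marginalLaw W) := by
  rw [integral_marginalLaw W hF hC, integral_eq_integral_sum_posterior _ hF hC, ← mul_assoc,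
    mul_one_div_cancel two_ne_zero, one_mul]
  have hi : Integrable (fun y => ∑ x, F (x, y)) ((pairLaw W).map Prod.snd) :=
    integrable_of_abs_le (C := ∑ _x : ZMod 2, C) (by fun_prop) fun y =>
      (Finset.abs_sum_le_sum_abs _ _).trans (Finset.sum_le_sum fun a _ => hC _)
  refine integral_mono_of_nonneg (ae_of_all _ fun y => Finset.sum_nonneg fun x _ =>
    mul_nonneg (posterior_nonneg _ _ _) (h0 _)) hi (ae_of_all _ fun y =>
    Finset.sum_le_sum fun x _ => mul_le_of_le_one_left (h0 _) (posterior_le_one _ _ _))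

/-- The logarithm of the posterior, truncated from below. -/
def logPosterior (δ : ℝ) (p : ZMod 2 × (Fin d → ℝ)) : ℝ :=
  Real.log (max (posterior (pairLaw W) p.1 p.2) δ)

lemma measurable_logPosterior (δ : ℝ) : Measurable (logPosterior W δ) := by
  have h : Measurable fun p : ZMod 2 × (Fin d → ℝ) => posterior (pairLaw W) p.1 p.2 :=
    measurable_from_prod_countable_right fun a => measurable_posterior _ a
  exact Real.measurable_log.comp (h.max measurable_const)

lemma abs_logPosterior_le {δ : ℝ} (h0 : 0 < δ) (h1 : δ < 1) (p : ZMod 2 × (Fin d → ℝ)) :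
    |logPosterior W δ p| ≤ -Real.log δ := by
  have h2 : max (posterior (pairLaw W) p.1 p.2) δ ≤ 1 := max_le (posterior_le_one _ _ _) h1.le
  have h3 : 0 < max (posterior (pairLaw W) p.1 p.2) δ := lt_max_of_lt_right h0
  rw [logPosterior, abs_of_nonpos (Real.log_nonpos h3.le h2), neg_le_neg_iff]
  exact Real.log_le_log h0 (le_max_right _ _)

/-- Truncation from below only raises the logarithm, so it errs in the favourable direction. -/
lemma neg_pairEntropy_le_integral_logPosterior {δ : ℝ} (h0 : 0 < δ) (h1 : δ < 1) :
    -pairEntropy (pairLaw W) ≤ ∫ p, logPosterior W δ p ∂(pairLaw W) := by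
  rw [integral_eq_integral_sum_posterior _ (measurable_logPosterior W δ)
    (abs_logPosterior_le W h0 h1), pairEntropy, ← integral_neg]
  have i1 : Integrable (fun y => ∑ a, Real.negMulLog (posterior (pairLaw W) a y))
      ((pairLaw W).map Prod.snd) :=
    integrable_of_abs_le (measurable_sum_negMulLog_posterior _) fun b =>
      abs_sum_negMulLog_le (fun a => posterior_nonneg _ a b) fun a => posterior_le_one _ a b
  have i2 : Integrable (fun y => ∑ a, posterior (pairLaw W) a y * logPosterior W δ (a, y))
      ((pairLaw W).map Prod.snd) := by
    refine integrable_of_abs_le (C := ∑ _a : ZMod 2, -Real.log δ)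
      (Finset.measurable_sum _ fun a _ => (measurable_posterior _ a).mul
        ((measurable_logPosterior W δ).comp measurable_prodMk_left)) fun y => ?_
    refine (Finset.abs_sum_le_sum_abs _ _).trans (Finset.sum_le_sum fun a _ => ?_)
    rw [abs_mul, abs_of_nonneg (posterior_nonneg _ _ _)]
    exact (mul_le_of_le_one_left (abs_nonneg _) (posterior_le_one _ _ _)).trans
      (abs_logPosterior_le W h0 h1 _)
  refine integral_mono i1.neg i2 fun y => ?_
  change -∑ a, Real.negMulLog _ ≤ ∑ a, _
  rw [← Finset.sum_neg_distrib]
  refine Finset.sum_le_sum fun a _ => ?_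
  rw [Real.negMulLog, neg_mul, neg_neg]
  rcases (posterior_nonneg (pairLaw W) a y).eq_or_lt with h | h
  · simp [← h]
  · exact mul_le_mul_of_nonneg_left (Real.log_le_log h (le_max_left _ _)) h.le

/-- Since `max p δ ≤ p + δ` and the posterior sums to `1` over the two inputs, truncation adds at
most `2δ` before the factor `1 / 2`. -/
lemma integral_exp_logPosterior_le {δ : ℝ} (h0 : 0 < δ) (h1 : δ < 1) :
    ∫ p, Real.exp (logPosterior W δ p) ∂(marginalLaw W) ≤ 1 / 2 + δ := by
  have hexp : ∀ p, Real.exp (logPosterior W δ p) = max (posterior (pairLaw W) p.1 p.2) δ :=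
    fun p => Real.exp_log (lt_max_of_lt_right h0)
  have hm : Measurable fun p => Real.exp (logPosterior W δ p) :=
    Real.measurable_exp.comp (measurable_logPosterior W δ)
  have hC : ∀ p, |Real.exp (logPosterior W δ p)| ≤ 1 := fun p => by
    rw [abs_of_pos (Real.exp_pos _), hexp]
    exact max_le (posterior_le_one _ _ _) h1.le
  rw [integral_marginalLaw W hm hC]
  have h2 : ∫ y, ∑ x, Real.exp (logPosterior W δ (x, y)) ∂((pairLaw W).map Prod.snd) ≤
      1 + 2 * δ := by
    have : ∀ y, ∑ x, Real.exp (logPosterior W δ (x, y)) ≤ 1 + 2 * δ := fun y => by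
      calc ∑ x, Real.exp (logPosterior W δ (x, y))
          ≤ ∑ x, (posterior (pairLaw W) x y + δ) := Finset.sum_le_sum fun x _ => by
            rw [hexp]
            exact max_le (by linarith) (by linarith [posterior_nonneg (pairLaw W) x y])
        _ = 1 + 2 * δ := by
            rw [Finset.sum_add_distrib, sum_posterior]
            simp [ZMod.card]
    refine (integral_mono_of_nonneg (ae_of_all _ fun y => Finset.sum_nonneg fun x _ =>
      (Real.exp_pos _).le) (integrable_const (1 + 2 * δ)) (ae_of_all _ this)).trans ?_
    simp
  linarith

/-- The input of the networks, `(x, y) ∈ {0, 1} × ℝᵈ ⊂ ℝᵈ⁺¹`. -/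
def netInput (p : ZMod 2 × (Fin d → ℝ)) : Fin (d + 1) → ℝ := Fin.cons (p.1.val : ℝ) p.2

lemma continuous_netInput :
    Continuous (netInput : ZMod 2 × (Fin d → ℝ) → Fin (d + 1) → ℝ) := by
  refine continuous_pi fun i => ?_
  induction i using Fin.cases with
  | zero =>
    have : Continuous fun x : ZMod 2 => (x.val : ℝ) := continuous_of_discreteTopology
    exact this.comp continuous_fst
  | succ i => exact (continuous_apply i).comp continuous_snd

/-- Some bounded network nearly attains the mutual information in the Donsker-Varadhan
functional. -/
theorem exists_dvFunctional_ge {η : ℝ} (hη : 0 < η) :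
    ∃ (k : ℕ) (φ : Params k d) (B : ℝ), (∀ x y, |statNet φ x y| ≤ B) ∧
      Real.log 2 - pairEntropy (pairLaw W) - η ≤ dvFunctional W fun p => statNet φ p.1 p.2 := by
  set δ := min (1 / 2) (η / 8) with hδ
  have hδ0 : 0 < δ := by positivity
  have hδ1 : δ < 1 := (min_le_left _ _).trans_lt (by norm_num)
  have hδη : δ ≤ η / 8 := min_le_right _ _
  have hnm := (continuous_netInput (d := d)).measurable
  have : IsProbabilityMeasure ((marginalLaw W).map netInput) :=
    Measure.isProbabilityMeasure_map hnm.aemeasurable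
  -- Networks act on `ℝᵈ⁺¹`, so the target must be extended there; any measurable rule that recovers
  -- the bit from its real value will do.
  let bit : ℝ → ZMod 2 := fun r => if 1 / 2 < r then 1 else 0
  have hbit : Measurable bit := Measurable.ite measurableSet_Ioi measurable_const measurable_const
  let g : (Fin (d + 1) → ℝ) → ℝ := fun v => logPosterior W δ (bit (v 0), fun l => v l.succ)
  have hg : Measurable g := (measurable_logPosterior W δ).comp
    ((hbit.comp (measurable_pi_apply 0)).prodMk (measurable_pi_lambda _ fun l =>
      measurable_pi_apply _))
  have hgnet : ∀ p, g (netInput p) = logPosterior W δ p := fun p => by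
    have h1 : bit (p.1.val : ℝ) = p.1 := by
      have : p.1 = 0 ∨ p.1 = 1 := by generalize p.1 = x; revert x; decide
      rcases this with h | h <;> rw [h]
      · simp [bit]
      · have : (1 : ZMod 2).val = 1 := rfl
        simp only [bit, this]
        norm_num
    change logPosterior W δ (bit (p.1.val : ℝ), p.2) = _
    rw [h1]
  obtain ⟨f, hf, ⟨B, hB⟩, hfg⟩ := exists_reluSpan_expClose ((marginalLaw W).map netInput) hg
    (fun v => abs_logPosterior_le W hδ0 hδ1 _) (show 0 < η / 8 by positivity)
  obtain ⟨k, φ, rfl⟩ := exists_reluNet_eq hf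
  have hfc := (continuous_of_mem_reluSpan hf).measurable
  refine ⟨k, φ, B, fun x y => hB _, ?_⟩
  set T : ZMod 2 × (Fin d → ℝ) → ℝ := fun p => statNet φ p.1 p.2 with hT
  have hTm : Measurable T := hfc.comp hnm
  have hTB : ∀ p, |T p| ≤ B := fun p => hB _
  have hlm := measurable_logPosterior W δ
  have hlB := abs_logPosterior_le W hδ0 hδ1
  -- transfer to the law of the pairs
  have c1 : ∫ p, |T p - logPosterior W δ p| ∂(marginalLaw W) ≤ η / 8 := by
    have := hfg.1
    have hm : Measurable fun v => |reluNet φ v - g v| := (hfc.sub hg).abs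
    rw [integral_map hnm.aemeasurable hm.aestronglyMeasurable] at this
    simp only [hgnet] at this
    exact this
  have c2 : ∫ p, |Real.exp (T p) - Real.exp (logPosterior W δ p)| ∂(marginalLaw W) ≤ η / 8 := by
    have := hfg.2
    have hm : Measurable fun v => |Real.exp (reluNet φ v) - Real.exp (g v)| :=
      (hfc.exp.sub hg.exp).abs
    rw [integral_map hnm.aemeasurable hm.aestronglyMeasurable] at this
    simp only [hgnet] at this
    exact this
  have c3 : ∫ p, |T p - logPosterior W δ p| ∂(pairLaw W) ≤ η / 4 := by
    have hm : Measurable fun p => |T p - logPosterior W δ p| := (hTm.sub hlm).abs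
    refine (integral_pairLaw_le W hm (fun p => abs_nonneg _)
      (C := B + -Real.log δ) fun p => ?_).trans (by linarith)
    rw [abs_abs]
    exact (abs_sub _ _).trans (add_le_add (hTB p) (hlB p))
  have d1 : ∫ p, logPosterior W δ p ∂(pairLaw W) - η / 4 ≤ ∫ p, T p ∂(pairLaw W) := by
    have := (abs_integral_le_integral_abs).trans c3
    rw [integral_sub (integrable_of_abs_le hTm hTB) (integrable_of_abs_le hlm hlB), abs_le] at this
    linarith [this.1]
  have d2 : ∫ p, Real.exp (T p) ∂(marginalLaw W) ≤ 1 / 2 + η / 4 := by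
    have := (abs_integral_le_integral_abs).trans c2
    rw [integral_sub (integrable_exp_of_abs_le hTm hTB) (integrable_exp_of_abs_le hlm hlB),
      abs_le] at this
    linarith [this.2, integral_exp_logPosterior_le W hδ0 hδ1]
  have d3 : 0 < ∫ p, Real.exp (T p) ∂(marginalLaw W) :=
    integral_exp_pos (integrable_exp_of_abs_le hTm hTB)
  -- The total loss is `η / 4` in the linear term and `η / 2` here, within the allowed `η`.
  have d4 : Real.log (∫ p, Real.exp (T p) ∂(marginalLaw W)) ≤ -Real.log 2 + η / 2 := by
    refine (Real.log_le_log d3 d2).trans ?_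
    have h1 : (1 : ℝ) / 2 + η / 4 = 2⁻¹ * (1 + η / 2) := by ring
    rw [h1, Real.log_mul (by norm_num) (by positivity), Real.log_inv]
    linarith [Real.log_le_sub_one_of_pos (show 0 < 1 + η / 2 by positivity)]
  have d5 := neg_pairEntropy_le_integral_logPosterior W hδ0 hδ1
  rw [dvFunctional]
  linarith

end DonskerVaradhan

/-! ### Consistency -/

lemma continuous_statNet {k d : ℕ} :
    Continuous fun q : Params k d × (ZMod 2 × (Fin d → ℝ)) => statNet q.1 q.2.1 q.2.2 := by
  have h1 : Continuous fun q : Params k d × (Fin (d + 1) → ℝ) => reluNet q.1 q.2 := by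
    unfold reluNet
    fun_prop
  exact h1.comp (continuous_fst.prodMk (continuous_netInput.comp continuous_snd))

lemma continuous_statNet_left {k d : ℕ} (x : ZMod 2) (y : Fin d → ℝ) :
    Continuous fun φ : Params k d => statNet φ x y := by
  have h : Continuous fun φ : Params k d => (φ, (x, y)) := by fun_prop
  exact Continuous.comp (g := fun q : Params k d × (ZMod 2 × (Fin d → ℝ)) =>
    statNet q.1 q.2.1 q.2.2) continuous_statNet h

lemma measurable_statNet {k d : ℕ} (φ : Params k d) :
    Measurable fun p : ZMod 2 × (Fin d → ℝ) => statNet φ p.1 p.2 := by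
  have h : Continuous fun p : ZMod 2 × (Fin d → ℝ) => (φ, p) := by fun_prop
  have h1 := Continuous.comp (g := fun q : Params k d × (ZMod 2 × (Fin d → ℝ)) =>
    statNet q.1 q.2.1 q.2.2) continuous_statNet h
  exact h1.measurable

lemma continuous_mineEmbedding {k d : ℕ} :
    Continuous fun q : Params k d × (Fin d → ℝ) => mineEmbedding q.1 q.2 := by
  have h : ∀ a : ZMod 2, Continuous fun q : Params k d × (Fin d → ℝ) => statNet q.1 a q.2 :=
    fun a => continuous_statNet.comp
      (continuous_fst.prodMk (continuous_const.prodMk continuous_snd))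
  exact (h 1).sub (h 0)

lemma measurable_mineEmbedding {k d : ℕ} (φ : Params k d) : Measurable (mineEmbedding φ) := by
  have h : Continuous fun y : Fin d → ℝ => (φ, y) := by fun_prop
  have h1 := Continuous.comp (g := fun q : Params k d × (Fin d → ℝ) => mineEmbedding q.1 q.2)
    continuous_mineEmbedding h
  exact h1.measurable

lemma continuous_neg_log_scProb {k d n : ℕ} (i : Fin (2 ^ n)) :
    Continuous fun q : Params k d × (Fin (2 ^ n) → ZMod 2 × (Fin d → ℝ)) =>
      -Real.log (scProb n (fun t => mineEmbedding q.1 (q.2 t).2) (blockBits q.2) i) := by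
  have h1 : Continuous fun q : (Fin (2 ^ n) → ℝ) × (Fin (2 ^ n) → ZMod 2) =>
      -Real.log (scProb n q.1 (polarTransform n q.2) i) :=
    continuous_prod_of_discrete_right.2 fun x => by
      have h := (continuous_log_scProb (polarTransform n x) i).neg
      exact h
  refine h1.comp (Continuous.prodMk (continuous_pi fun t => ?_) (by fun_prop))
  have h2 : Continuous fun q : Params k d × (Fin (2 ^ n) → ZMod 2 × (Fin d → ℝ)) =>
      (q.1, (q.2 t).2) := by fun_prop
  exact Continuous.comp (g := fun q : Params k d × (Fin d → ℝ) => mineEmbedding q.1 q.2)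
    continuous_mineEmbedding h2

lemma abs_log_sub_log_le {a b m : ℝ} (hm : 0 < m) (ha : m ≤ a) (hb : m ≤ b) :
    |Real.log a - Real.log b| ≤ |a - b| / m := by
  have key : ∀ {a b : ℝ}, m ≤ a → m ≤ b → Real.log a - Real.log b ≤ |a - b| / m := by
    intro a b ha hb
    have hb0 : 0 < b := hm.trans_le hb
    have h := Real.log_le_sub_one_of_pos (div_pos (hm.trans_le ha) hb0)
    rw [Real.log_div (hm.trans_le ha).ne' hb0.ne'] at h
    calc Real.log a - Real.log b ≤ a / b - 1 := h
      _ = (a - b) / b := by field_simp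
      _ ≤ |a - b| / b := by gcongr; exact le_abs_self _
      _ ≤ |a - b| / m := by gcongr
  rw [abs_le]
  constructor
  · have := key hb ha
    rw [abs_sub_comm] at this
    linarith
  · exact key ha hb

lemma exp_neg_le_sampleAvg {S : Type*} {L : ℕ} (hL : 0 < L) {T : S → ℝ} {B : ℝ}
    (hB : ∀ s, |T s| ≤ B) (z : Fin L → S) :
    Real.exp (-B) ≤ sampleAvg (fun s => Real.exp (T s)) z := by
  have hL' : (0 : ℝ) < L := by exact_mod_cast hL
  rw [sampleAvg, one_div, inv_mul_eq_div, le_div_iff₀ hL']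
  calc Real.exp (-B) * L = ∑ _t : Fin L, Real.exp (-B) := by simp [mul_comm]
    _ ≤ _ := Finset.sum_le_sum fun t _ => Real.exp_le_exp.2 (neg_le_of_abs_le (hB _))

lemma continuous_dvObjective {k d L : ℕ} (hL : 0 < L) (x : Fin L → ZMod 2)
    (y yt : Fin L → Fin d → ℝ) : Continuous fun φ : Params k d => dvObjective x y yt φ := by
  have h : ∀ (a : ZMod 2) (b : Fin d → ℝ), Continuous fun φ : Params k d => statNet φ a b :=
    continuous_statNet_left
  have hL' : (0 : ℝ) < L := by exact_mod_cast hL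
  unfold dvObjective
  refine (continuous_const.mul (continuous_finsetSum _ fun t _ => h _ _)).sub
    (Continuous.log (continuous_const.mul (continuous_finsetSum _ fun t _ =>
      Real.continuous_exp.comp (h _ _))) fun φ => ?_)
  have : Nonempty (Fin L) := ⟨⟨0, hL⟩⟩
  exact (mul_pos (by positivity) (Finset.sum_pos (fun t _ => Real.exp_pos _)
    Finset.univ_nonempty)).ne'

/-- MINE is consistent over every compact set of uniformly bounded networks that nearly attains
the mutual information. -/
theorem ae_eventually_isMINE {d : ℕ} (W : Kernel (ZMod 2) (Fin d → ℝ)) [IsMarkovKernel W] (n : ℕ)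
    {Ω : Type*} [MeasurableSpace Ω] (P : Measure Ω) [IsProbabilityMeasure P]
    {X : ℕ → Ω → ZMod 2} {Y : ℕ → Ω → Fin d → ℝ}
    (hlaw : ∀ t, HasLaw (fun ω => (X t ω, Y t ω)) (pairLaw W) P)
    (hindep : iIndepFun (fun t ω => (X t ω, Y t ω)) P)
    {π : (M : ℕ) → Ω → Equiv.Perm (Fin (M * 2 ^ n))}
    (hπlaw : ∀ M, HasLaw (π M) (PMF.uniformOfFintype (Equiv.Perm (Fin (M * 2 ^ n)))).toMeasure P)
    (hπindep : ∀ M, IndepFun (π M) (fun ω t => (X t ω, Y t ω)) P)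
    {ε : ℝ} (hε : 0 < ε) {k : ℕ} {Φ : Set (Params k d)} (hΦ : IsCompact Φ) {B : ℝ}
    (hB : ∀ φ ∈ Φ, ∀ x y, |statNet φ x y| ≤ B) {φ₀ : Params k d} (hφ₀ : φ₀ ∈ Φ)
    (hdv : Real.log 2 - pairEntropy (pairLaw W) - ε / (16 * 2 ^ n) ≤
      dvFunctional W fun p => statNet φ₀ p.1 p.2) :
    ∀ᵐ ω ∂P, ∃ m : ℕ, ∀ M > m,
      (∃ φ, IsMINE Φ (fun t : Fin (M * 2 ^ n) => X t ω) (fun t => Y t ω) (π M ω) φ) ∧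
      ∀ φ, IsMINE Φ (fun t : Fin (M * 2 ^ n) => X t ω) (fun t => Y t ω) (π M ω) φ →
        ∀ i : Fin (2 ^ n), |empiricalNLL n M (fun t => X t ω) (fun t => Y t ω) φ i
          - bitEntropy W n i| < ε := by
  set η := ε / (16 * 2 ^ n) with hη
  have hη0 : 0 < η := by positivity
  have hL : ∀ M, M ≤ M * 2 ^ n := fun M => Nat.le_mul_of_pos_right _ (by positivity)
  have hTm : ∀ φ : Params k d, Measurable fun p : ZMod 2 × (Fin d → ℝ) => statNet φ p.1 p.2 :=
    measurable_statNet
  have hem : ∀ φ : Params k d, Measurable (mineEmbedding φ) := measurable_mineEmbedding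
  have heB : ∀ φ ∈ Φ, ∀ y, |mineEmbedding φ y| ≤ 2 * B := fun φ hφ y =>
    (abs_sub _ _).trans (by linarith [hB φ hφ 1 y, hB φ hφ 0 y])
  -- the three uniform laws of large numbers
  have u1 := (satisfiesLLN_of_pairwise_indepFun (L := fun M => M * 2 ^ n) hlaw
    (fun s t hst => hindep.indepFun hst) hL).uniform hL hΦ hTm (fun φ hφ p => hB φ hφ p.1 p.2)
    (fun _ h => exists_measurableSet_equicontinuous (pairLaw W) continuous_statNet h) hη0
  -- Averages of `exp T` are at least `exp (-B)`, where the logarithm has Lipschitz constant `exp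
  -- B`; this tolerance therefore gives an error `η` after the logarithm.
  have u2 := (satisfiesLLN_shuffle hlaw hindep hL hπlaw hπindep).uniform (Φ := Φ)
    (f := fun φ p => Real.exp (statNet φ p.1 p.2)) hL hΦ (fun φ => (hTm φ).exp)
    (C := Real.exp B) (fun φ hφ p => by
      rw [abs_of_pos (Real.exp_pos _)]
      exact Real.exp_le_exp.2 ((le_abs_self _).trans (hB φ hφ p.1 p.2)))
    (fun _ h => exists_measurableSet_equicontinuous _ continuous_statNet.rexp h)
    (show 0 < η * Real.exp (-B) by positivity)
  -- Uniformity over `Φ` is essential here: the network is trained on the very sample on which its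
  -- loss is evaluated.
  have u3 : ∀ᵐ ω ∂P, ∀ i : Fin (2 ^ n), ∀ᶠ M in Filter.atTop, ∀ φ ∈ Φ,
      |empiricalNLL n M (fun t => X t ω) (fun t => Y t ω) φ i -
        bitCrossEntropy W (mineEmbedding φ) i| < ε / 2 := by
    rw [ae_all_iff]
    intro i
    have := (satisfiesLLN_block hlaw hindep (2 ^ n)).uniform (Φ := Φ)
      (f := fun φ z => -Real.log (scProb n (fun t => mineEmbedding φ (z t).2) (blockBits z) i))
      (fun M => le_rfl) hΦ (fun φ => (measurable_log_scProb (hem φ) i).neg)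
      (C := 2 ^ n * (2 * B) + Real.log 2) (fun φ hφ z => by
        rw [abs_neg]
        exact abs_log_scProb_le (fun t => heB φ hφ _) _ _)
      (fun _ h => exists_measurableSet_equicontinuous _ (continuous_neg_log_scProb i) h)
      (show 0 < ε / 2 by positivity)
    filter_upwards [this] with ω hω
    filter_upwards [hω] with M hM φ hφ
    convert hM φ hφ using 3
    · rw [empiricalNLL, sampleAvg, Finset.sum_range, Finset.sum_neg_distrib, mul_neg]
      rfl
    · rfl
  filter_upwards [u1, u2, u3] with ω h1 h2 h3
  obtain ⟨m, hm⟩ := Filter.eventually_atTop.1 (h1.and (h2.and (Filter.eventually_all.2 h3)))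
  refine ⟨m, fun M hM => ?_⟩
  obtain ⟨h1, h2, h3⟩ := hm M hM.le
  have hLM : 0 < M * 2 ^ n := lt_of_lt_of_le (by omega) (hL M)
  refine ⟨?_, fun φ hφ i => ?_⟩
  · obtain ⟨φ, hφ, hmax⟩ := hΦ.exists_isMaxOn ⟨φ₀, hφ₀⟩ (continuous_dvObjective hLM
      (fun t => X t ω) (fun t => Y t ω) (fun t => Y (π M ω t) ω)).continuousOn
    exact ⟨φ, hφ, fun ψ hψ => hmax hψ⟩
  · have close : ∀ φ ∈ Φ, |dvObjective (fun t : Fin (M * 2 ^ n) => X t ω) (fun t => Y t ω)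
        (fun t => Y (π M ω t) ω) φ - dvFunctional W fun p => statNet φ p.1 p.2| ≤ 2 * η := by
      intro φ hφ
      have e1 := h1 φ hφ
      have e2 := h2 φ hφ
      have e3 : Real.exp (-B) ≤ ∫ p, Real.exp (statNet φ p.1 p.2) ∂(marginalLaw W) := by
        have := integral_mono (μ := marginalLaw W) (integrable_const (Real.exp (-B)))
          (integrable_exp_of_abs_le (hTm φ) fun p => hB φ hφ p.1 p.2)
          fun p => Real.exp_le_exp.2 (neg_le_of_abs_le (hB φ hφ p.1 p.2))
        simpa using this
      have e4 := abs_log_sub_log_le (Real.exp_pos (-B))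
        (exp_neg_le_sampleAvg hLM (fun p : ZMod 2 × (Fin d → ℝ) => hB φ hφ p.1 p.2)
          fun t => (X t ω, Y (π M ω t) ω)) e3
      have e5 := e4.trans ((div_le_iff₀ (Real.exp_pos (-B))).2 e2.le)
      rw [abs_lt] at e1
      rw [abs_le] at e5 ⊢
      have e6 : dvObjective (fun t : Fin (M * 2 ^ n) => X t ω) (fun t => Y t ω)
          (fun t => Y (π M ω t) ω) φ =
          sampleAvg (fun p : ZMod 2 × (Fin d → ℝ) => statNet φ p.1 p.2)
            (fun t : Fin (M * 2 ^ n) => (X t ω, Y t ω)) -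
          Real.log (sampleAvg (fun p : ZMod 2 × (Fin d → ℝ) => Real.exp (statNet φ p.1 p.2))
            (fun t : Fin (M * 2 ^ n) => (X t ω, Y (π M ω t) ω))) := rfl
      rw [e6, dvFunctional]
      constructor <;> linarith [e1.1, e1.2, e5.1, e5.2]
    have a1 := abs_le.1 (close φ hφ.1)
    have a2 := abs_le.1 (close φ₀ hφ₀)
    have a3 := hφ.2 φ₀ hφ₀
    have a4 := pairCrossEntropy_le W (hTm φ) fun p => hB φ hφ.1 p.1 p.2
    have a5 := abs_bitCrossEntropy_sub_le W (hem φ) (heB φ hφ.1) i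
    -- The deficit `η` of `φ₀`, plus `2η` for each of the two passages between empirical and
    -- population objective. Multiplied by `2ⁿ` this is `5 ε / 16 < ε / 2`.
    have a6 : pairCrossEntropy W (mineEmbedding φ) - pairEntropy (pairLaw W) ≤ 5 * η := by
      change pairCrossEntropy W (mineEmbedding φ) ≤ _ at a4
      linarith [a1.2, a2.1]
    have a7 : (2 ^ n : ℝ) * (pairCrossEntropy W (mineEmbedding φ) - pairEntropy (pairLaw W)) ≤
        5 * ε / 16 := by
      refine (mul_le_mul_of_nonneg_left a6 (by positivity)).trans (le_of_eq ?_)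
      rw [hη]
      field_simp
    have a8 := h3 i φ hφ.1
    have a9 := abs_sub_le (empiricalNLL n M (fun t => X t ω) (fun t => Y t ω) φ i)
      (bitCrossEntropy W (mineEmbedding φ) i) (bitEntropy W n i)
    linarith

end PolarMINE

end

/-! ### The choice of the parameter set -/

theorem mainTheorem2 {d : ℕ} (W : Kernel (ZMod 2) (Fin d → ℝ)) [IsMarkovKernel W] (n : ℕ)
    {Ω : Type*} [MeasurableSpace Ω] (P : Measure Ω) [IsProbabilityMeasure P]
    (X : ℕ → Ω → ZMod 2) (Y : ℕ → Ω → Fin d → ℝ)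
    (hlaw : ∀ t, HasLaw (fun ω => (X t ω, Y t ω)) (PolarMINE.pairLaw W) P)
    (hindep : iIndepFun (fun t ω => (X t ω, Y t ω)) P)
    (π : (M : ℕ) → Ω → Equiv.Perm (Fin (M * 2 ^ n)))
    (hπlaw : ∀ M, HasLaw (π M) (PMF.uniformOfFintype (Equiv.Perm (Fin (M * 2 ^ n)))).toMeasure P)
    (hπindep : ∀ M, IndepFun (π M) (fun ω t => (X t ω, Y t ω)) P)
    (ε : ℝ) (hε : 0 < ε) :
    ∃ (k : ℕ) (Φ : Set (PolarMINE.Params k d)), IsCompact Φ ∧ Φ.Nonempty ∧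
      ∀ᵐ ω ∂P, ∃ m : ℕ, ∀ M > m,
        (∃ φ, PolarMINE.IsMINE Φ (fun t : Fin (M * 2 ^ n) => X t ω) (fun t => Y t ω) (π M ω) φ) ∧
        ∀ φ, PolarMINE.IsMINE Φ (fun t : Fin (M * 2 ^ n) => X t ω) (fun t => Y t ω) (π M ω) φ →
          ∀ i : Fin (2 ^ n),
            |PolarMINE.empiricalNLL n M (fun t => X t ω) (fun t => Y t ω) φ i
              - PolarMINE.bitEntropy W n i| < ε := by
  obtain ⟨k, φ₀, B, hB, hdv⟩ := PolarMINE.exists_dvFunctional_ge W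
    (show 0 < ε / (16 * 2 ^ n) by positivity)
  -- A bounded set of parameters does not bound the networks, since `y` ranges over all of `ℝᵈ`. The
  -- uniform bound is therefore imposed as a closed condition, which `φ₀` satisfies, and `Φ` is its
  -- intersection with a closed ball.
  have hΦ : IsClosed {φ : PolarMINE.Params k d | ∀ x y, |PolarMINE.statNet φ x y| ≤ B + 1} := by
    simp only [Set.ofPred_forall]
    refine isClosed_iInter fun x => isClosed_iInter fun y => isClosed_le ?_ continuous_const
    exact (PolarMINE.continuous_statNet_left x y).abs
  have hφ₀ : φ₀ ∈ Metric.closedBall 0 (‖φ₀‖ + 1) ∩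
      {φ : PolarMINE.Params k d | ∀ x y, |PolarMINE.statNet φ x y| ≤ B + 1} :=
    ⟨by simp, fun x y => (hB x y).trans (by linarith)⟩
  exact ⟨k, _, (isCompact_closedBall _ _).inter_right hΦ, ⟨φ₀, hφ₀⟩,
    PolarMINE.ae_eventually_isMINE W n P hlaw hindep hπlaw hπindep hε
      ((isCompact_closedBall _ _).inter_right hΦ) (fun φ hφ => hφ.2) hφ₀ hdv⟩
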